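/- **Setting.** Let $p\ge 2$. For $\rho>0$ let $[y]^{\circ\rho}$ be the vector with coordinates $\mathrm{sgn}(y_i)|y_i|^{\rho}$. For a function $h$ of $y$, $\frac{dh(y)}{d[y]^{\circ p-1}}$ denotes the derivative (gradient, or Jacobian matrix) of $z\mapsto h([z]^{\circ 1/(p-1)})$ at $z=[y]^{\circ p-1}$. Let $f,g:\mathbb R^{d_x}\times\mathbb R^{d_y}\to\mathbb R$, $f=\mathbb E_{\xi\sim\mathcal D_f}F(\cdot,\cdot;\xi)$, $g=\mathbb E_{\zeta\sim\mathcal D_g}G(\cdot,\cdot;\zeta)$, $y^*(x)=\arg\min_y g(x,y)$, $\Phi(x)=f(x,y^*(x))$. Assume, with constants $\mu,C,\sigma_{g,1},\Delta_\phi>0$ and $L_0,L_1,l_{g,1},l_{g,2},l_{f,0},l_{f,1},\sigma_f,\sigma_{g,2},B\ge 0$ (all the derivatives written below exist): 1. (lower level) $g(x,y_2)\ge g(x,y_1)+\langle\nabla_yg(x,y_1),y_2-y_1\rangle+\frac{\mu}{p}\|y_2-y_1\|^p$; $\|\nabla^2_{yy}g\|\le L_0+L_1\|\nabla_yg\|$;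 $\nabla_yg$ is $l_{g,1}$-Lipschitz in $x$; $\nabla^2_{xy}g$ and $\frac{d\nabla_yg}{d[y]^{\circ p-1}}$ are $l_{g,2}$-Lipschitz in $(x,y)$; $\frac{d\nabla_yg}{d[y]^{\circ p-1}}\succeq\mu I$ (as a quadratic form) and $\|\frac{d\nabla_yg}{d[y]^{\circ p-1}}\|\le C$. 2. (upper level) $\nabla_xf$ and $\frac{df}{d[y]^{\circ p-1}}$ are $l_{f,1}$-Lipschitz in $(x,y)$; $\|\frac{df}{d[y]^{\circ p-1}}\|\le l_{f,0}$; $\Phi(x_0)-\inf\Phi\le\Delta_\phi$. 3. (oracle) $\nabla_xF$, $\frac{dF}{d[y]^{\circ p-1}}$, $\nabla_yG$, $\nabla^2_{xy}G$, $\frac{d\nabla_yG}{d[y]^{\circ p-1}}$ are unbiased estimators of the corresponding derivatives of $f$, $g$; the first two have variance at most $\sigma_f^2$, the last two at most $\sigma_{g,2}^2$ (at every $(x,y)$), and $\mathbb E\exp(\|\nabla_yG-\nabla_yg\|^2/\sigma_{g,1}^2)\le e$. Moreover $\|y_0-y^*(x_0)\|\le B$. **Algorithm.** *Epoch-SGD*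 with step size $\alpha$, first epoch length $K_1$, radius $R$ and budget $K$ starts at a given point and runs epochs $k=0,1,\dots$ as long as the total number of steps does not exceed $K$. Epoch $k$ makes $\lceil K_1 2^{\tau k}\rceil$ steps, $\tau=2(p-1)/p$, of projected SGD with step size $\alpha/2^k$ on the ball of radius $R/2^{k/p}$ around the current point, and replaces the current point by the average of the iterates of the epoch. *UniBiO* first obtains $y$ from Epoch-SGD on $g(x_0,\cdot)$ started at $y_0$, and puts $x_1=x_0$, $m_0=0$. For $t=1,\dots,T$: if $I\mid t$, $y$ is updated by Epoch-SGD on $g(x_t,\cdot)$ started at $y$; the current value is $y_t$; then $$m_t=\beta m_{t-1}+(1-\beta)\hat\nabla f(x_t,y_t;\bar\xi_t),\qquad x_{t+1}=x_t-\eta\, m_t/\|m_t\|$$ (with $x_{t+1}=x_t$ if $m_t=0$), where $$\hat\nabla f(x,y;\bar\xi)=\nabla_xF(x,y;\xi)-\nabla^2_{xy}G(x,y;\zeta^{(0)})\Big[\frac1{\bar C}\sum_{q=0}^{Q-1}\prod_{j=1}^{q}\Big(\mathrm{Id}-\frac1{\bar C}\frac{d\nabla_yG(x,y;\zeta^{(q,j)})}{d[y]^{\circ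 p-1}}^{\!\top}\Big)\Big]\frac{dF(x,y;\xi)}{d[y]^{\circ p-1}}.$$ All samples are independent. Every stochastic gradient and every matrix-vector product with $\nabla^2_{xy}G$ or a generalized Hessian counts as one oracle call. **Theorem.** There are a bound $\bar C\ge C$ and constants $c_1\in(0,1]$, $c_2,C_1,A>0$, $r\ge 0$, depending only on $p$ and the constants of the assumptions, such that for all $\varepsilon\in(0,1]$ and $\delta\in(0,1)$ the following holds with $\ell=1+\log\frac1{\varepsilon\delta}$. Put $$1-\beta=c_1\varepsilon^2,\quad \eta=c_2\varepsilon^{3p-3},\quad I=\lceil 1/(1-\beta)\rceil,\quad T=\Big\lceil\frac{C_1\Delta_\phi}{\eta\varepsilon}\Big\rceil .$$ There are $Q\le A(1+\log\frac1\varepsilon)$ and Epoch-SGD parameters $\alpha_{t,1}\le A$, $R_{t,1}\le A$, $K_{t,1}\le A\ell^r$, $K_t\le A\varepsilon^{-2p+2}\ell^r$, depending only on $p$, the constants, $\varepsilon$ and $\delta$, such that for every problem satisfying the assumptions $\Phi$ is differentiable and, with probability at least $1-\delta$ over the samples used for the lower-level updates, $$\frac1T\sum_{t=1}^T\mathbb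 E\|\nabla\Phi(x_t)\|\le\varepsilon,$$ where the expectation is over the upper-level samples $\bar\xi_1,\bar\xi_2,\dots$. The total number of oracle calls is at most $A\varepsilon^{-5p+6}\ell^r$, that is $\widetilde O(\varepsilon^{-5p+6})$, and $\widetilde O(\varepsilon^{-4})$ for $p=2$. -/

import Mathlib

open MeasureTheory

noncomputable section

namespace UniBiO

/-- Euclidean space `ℝ^n`. -/
abbrev Vec (n : ℕ) := EuclideanSpace ℝ (Fin n)

/-! ### Calculus: partial gradients and derivatives with respect to coordinatewise powers -/

/-- The (sign-preserving) coordinatewise power `[y]^{∘ρ}`, with coordinates `sgn(yᵢ)|yᵢ|^ρ`. -/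
def signPow {n : ℕ} (ρ : ℝ) (y : Vec n) : Vec n :=
  WithLp.toLp 2 fun i => Real.sign (y i) * |y i| ^ ρ

section Calculus

variable {dx dy : ℕ}

/-- `∇ₓ h(x,y)`. -/
def gradX (h : Vec dx → Vec dy → ℝ) (x : Vec dx) (y : Vec dy) : Vec dx :=
  gradient (fun x' => h x' y) x

/-- `∇_y h(x,y)`. -/
def gradY (h : Vec dx → Vec dy → ℝ) (x : Vec dx) (y : Vec dy) : Vec dy :=
  gradient (h x) y

/-- `∇²_{yy} h(x,y)`. -/
def hessYY (h : Vec dx → Vec dy → ℝ) (x : Vec dx) (y : Vec dy) : Vec dy →L[ℝ] Vec dy :=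
  fderiv ℝ (gradY h x) y

/-- `∇²_{xy} h(x,y)` as a `dx × dy` matrix: the transpose of the Jacobian of `x ↦ ∇_y h(x,y)`. -/
def crossXY (h : Vec dx → Vec dy → ℝ) (x : Vec dx) (y : Vec dy) : Vec dy →L[ℝ] Vec dx :=
  ContinuousLinearMap.adjoint (fderiv ℝ (fun x' => gradY h x' y) x)

/-- `d h(x,y) / d[y]^{∘(p-1)}`: the gradient of `z ↦ h(x,[z]^{∘1/(p-1)})` at `z = [y]^{∘(p-1)}`. -/
def powGrad (p : ℝ) (h : Vec dx → Vec dy → ℝ) (x : Vec dx) (y : Vec dy) : Vec dy :=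
  gradient (fun z => h x (signPow (1 / (p - 1)) z)) (signPow (p - 1) y)

/-- `d ∇_y h(x,y) / d[y]^{∘(p-1)}`: the Jacobian of `z ↦ ∇_y h(x,[z]^{∘1/(p-1)})` at
`z = [y]^{∘(p-1)}`. -/
def powHess (p : ℝ) (h : Vec dx → Vec dy → ℝ) (x : Vec dx) (y : Vec dy) : Vec dy →L[ℝ] Vec dy :=
  fderiv ℝ (fun z => gradY h x (signPow (1 / (p - 1)) z)) (signPow (p - 1) y)

/-- The Euclidean distance between `(x₁,y₁)` and `(x₂,y₂)` in `ℝ^{dx+dy}`. -/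
def jointDist (x₁ x₂ : Vec dx) (y₁ y₂ : Vec dy) : ℝ :=
  Real.sqrt (‖x₁ - x₂‖ ^ 2 + ‖y₁ - y₂‖ ^ 2)

/-- The lower-level solution `y*(x) ∈ argmin_y g(x,y)`. -/
def lowerSol (g : Vec dx → Vec dy → ℝ) (x : Vec dx) : Vec dy :=
  Classical.epsilon fun y => ∀ y', g x y ≤ g x y'

/-- The hyperobjective `Φ(x) = f(x, y*(x))`. -/
def hyperObj (f g : Vec dx → Vec dy → ℝ) (x : Vec dx) : ℝ :=
  f x (lowerSol g x)

/-! ### The problem class -/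

/-- Assumptions on the lower-level function `g`. -/
structure LowerLevel (p μ L₀ L₁ lg₁ lg₂ C : ℝ) (g : Vec dx → Vec dy → ℝ) : Prop where
  diff_y : ∀ x, Differentiable ℝ (g x)
  diff_yy : ∀ x, Differentiable ℝ (gradY g x)
  diff_yx : ∀ y, Differentiable ℝ (fun x => gradY g x y)
  diff_pow : ∀ x, Differentiable ℝ (fun z => gradY g x (signPow (1 / (p - 1)) z))
  uniformlyConvex : ∀ x y₁ y₂,
    g x y₁ + inner ℝ (gradY g x y₁) (y₂ - y₁) + μ / p * ‖y₂ - y₁‖ ^ p ≤ g x y₂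
  relaxedSmooth : ∀ x y, ‖hessYY g x y‖ ≤ L₀ + L₁ * ‖gradY g x y‖
  gradY_lipschitz : ∀ x₁ x₂ y, ‖gradY g x₁ y - gradY g x₂ y‖ ≤ lg₁ * ‖x₁ - x₂‖
  crossXY_lipschitz : ∀ x₁ x₂ y₁ y₂,
    ‖crossXY g x₁ y₁ - crossXY g x₂ y₂‖ ≤ lg₂ * jointDist x₁ x₂ y₁ y₂
  powHess_lipschitz : ∀ x₁ x₂ y₁ y₂,
    ‖powHess p g x₁ y₁ - powHess p g x₂ y₂‖ ≤ lg₂ * jointDist x₁ x₂ y₁ y₂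
  /-- `λ_min ≥ μ`, that is, the generalized Hessian is `⪰ μ I` as a quadratic form. -/
  powHess_ge : ∀ x y v, μ * ‖v‖ ^ 2 ≤ inner ℝ (powHess p g x y v) v
  powHess_le : ∀ x y, ‖powHess p g x y‖ ≤ C

/-- Assumptions on the upper-level function `f` (and on the hyperobjective, at the initial point
`x₀`). -/
structure UpperLevel (p lf₀ lf₁ Δ : ℝ) (f g : Vec dx → Vec dy → ℝ) (x₀ : Vec dx) : Prop where
  diff_x : ∀ y, Differentiable ℝ (fun x => f x y)
  diff_pow : ∀ x, Differentiable ℝ (fun z => f x (signPow (1 / (p - 1)) z))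
  gradX_lipschitz : ∀ x₁ x₂ y₁ y₂,
    ‖gradX f x₁ y₁ - gradX f x₂ y₂‖ ≤ lf₁ * jointDist x₁ x₂ y₁ y₂
  powGrad_lipschitz : ∀ x₁ x₂ y₁ y₂,
    ‖powGrad p f x₁ y₁ - powGrad p f x₂ y₂‖ ≤ lf₁ * jointDist x₁ x₂ y₁ y₂
  powGrad_le : ∀ x y, ‖powGrad p f x y‖ ≤ lf₀
  gap : ∀ x, hyperObj f g x₀ - hyperObj f g x ≤ Δ

end Calculus

section Stochastic

variable {dx dy : ℕ} {Ξ Z : Type*} [MeasurableSpace Ξ] [MeasurableSpace Z]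

/-- Assumptions on the stochastic oracle: the derivatives of the samples `F(·,·;ξ)`, `ξ ∼ Df`, and
`G(·,·;ζ)`, `ζ ∼ Dg`, exist, are measurable, and are unbiased estimators of those of `f = E F` and
`g = E G`, with bounded variance (light tails for the lower-level gradient). -/
structure Oracle (p σf σg₁ σg₂ : ℝ) (f g : Vec dx → Vec dy → ℝ)
    (F : Ξ → Vec dx → Vec dy → ℝ) (G : Z → Vec dx → Vec dy → ℝ)
    (Df : Measure Ξ) (Dg : Measure Z) : Prop where
  -- `f` and `g` are expectations of the samples
  F_integrable : ∀ x y, Integrable (fun ξ => F ξ x y) Df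
  F_mean : ∀ x y, ∫ ξ, F ξ x y ∂Df = f x y
  G_integrable : ∀ x y, Integrable (fun ζ => G ζ x y) Dg
  G_mean : ∀ x y, ∫ ζ, G ζ x y ∂Dg = g x y
  -- the derivatives of the samples exist
  F_diff_x : ∀ ξ y, Differentiable ℝ (fun x => F ξ x y)
  F_diff_pow : ∀ ξ x, Differentiable ℝ (fun z => F ξ x (signPow (1 / (p - 1)) z))
  G_diff_y : ∀ ζ x, Differentiable ℝ (G ζ x)
  G_diff_yx : ∀ ζ y, Differentiable ℝ (fun x => gradY (G ζ) x y)
  G_diff_pow : ∀ ζ x, Differentiable ℝ (fun z => gradY (G ζ) x (signPow (1 / (p - 1)) z))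
  -- they are measurable
  gradX_meas : Measurable fun q : Ξ × Vec dx × Vec dy => gradX (F q.1) q.2.1 q.2.2
  powGrad_meas : Measurable fun q : Ξ × Vec dx × Vec dy => powGrad p (F q.1) q.2.1 q.2.2
  gradY_meas : Measurable fun q : Z × Vec dx × Vec dy => gradY (G q.1) q.2.1 q.2.2
  crossXY_meas : Measurable fun q : Z × Vec dx × Vec dy => crossXY (G q.1) q.2.1 q.2.2
  powHess_meas : Measurable fun q : Z × Vec dx × Vec dy => powHess p (G q.1) q.2.1 q.2.2
  -- unbiasedness
  gradX_integrable : ∀ x y, Integrable (fun ξ => gradX (F ξ) x y) Df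
  gradX_mean : ∀ x y, ∫ ξ, gradX (F ξ) x y ∂Df = gradX f x y
  powGrad_integrable : ∀ x y, Integrable (fun ξ => powGrad p (F ξ) x y) Df
  powGrad_mean : ∀ x y, ∫ ξ, powGrad p (F ξ) x y ∂Df = powGrad p f x y
  gradY_integrable : ∀ x y, Integrable (fun ζ => gradY (G ζ) x y) Dg
  gradY_mean : ∀ x y, ∫ ζ, gradY (G ζ) x y ∂Dg = gradY g x y
  crossXY_integrable : ∀ x y, Integrable (fun ζ => crossXY (G ζ) x y) Dg
  crossXY_mean : ∀ x y, ∫ ζ, crossXY (G ζ) x y ∂Dg = crossXY g x y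
  powHess_integrable : ∀ x y, Integrable (fun ζ => powHess p (G ζ) x y) Dg
  powHess_mean : ∀ x y, ∫ ζ, powHess p (G ζ) x y ∂Dg = powHess p g x y
  -- noise bounds
  gradX_var : ∀ x y,
    ∫⁻ ξ, ‖gradX (F ξ) x y - gradX f x y‖ₑ ^ 2 ∂Df ≤ ENNReal.ofReal (σf ^ 2)
  gradY_lightTail : ∀ x y,
    ∫⁻ ζ, ENNReal.ofReal (Real.exp (‖gradY (G ζ) x y - gradY g x y‖ ^ 2 / σg₁ ^ 2)) ∂Dg
      ≤ ENNReal.ofReal (Real.exp 1)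
  crossXY_var : ∀ x y,
    ∫⁻ ζ, ‖crossXY (G ζ) x y - crossXY g x y‖ₑ ^ 2 ∂Dg ≤ ENNReal.ofReal (σg₂ ^ 2)
  powGrad_var : ∀ x y,
    ∫⁻ ξ, ‖powGrad p (F ξ) x y - powGrad p f x y‖ₑ ^ 2 ∂Df ≤ ENNReal.ofReal (σf ^ 2)
  powHess_var : ∀ x y,
    ∫⁻ ζ, ‖powHess p (G ζ) x y - powHess p g x y‖ₑ ^ 2 ∂Dg ≤ ENNReal.ofReal (σg₂ ^ 2)

end Stochastic

/-! ### Epoch-SGD -/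

section EpochSGD

variable {d : ℕ} {Z : Type*}

/-- Projection onto the closed ball with centre `c` and radius `D ≥ 0`. -/
def ballProj (c : Vec d) (D : ℝ) (v : Vec d) : Vec d :=
  if ‖v - c‖ ≤ D then v else c + (D / ‖v - c‖) • (v - c)

/-- Projected SGD started at `c`, on the ball with centre `c` and radius `D`, with step size `γ`,
stochastic gradient `grad` and samples `s 0, s 1, …`. -/
def ballSGD (grad : Vec d → Z → Vec d) (c : Vec d) (D γ : ℝ) (s : ℕ → Z) : ℕ → Vec d
  | 0 => c
  | i + 1 => ballProj c D
      (ballSGD grad c D γ s i - γ • grad (ballSGD grad c D γ s i) (s i))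

/-- The number of SGD steps in epoch `k = 0, 1, …`: `T₁ 2^{τ k}` with `τ = 2(p-1)/p`,
rounded up. -/
def epochLen (p : ℝ) (T₁ k : ℕ) : ℕ :=
  ⌈(T₁ : ℝ) * 2 ^ (2 * (p - 1) / p * (k : ℝ))⌉₊

/-- The starting point of epoch `k`: the average of the iterates of the previous epoch. Epoch `k`
uses the step size `γ₁/2^k`, the radius `D₁/2^{k/p}` and the samples `s k 0, s k 1, …`. -/
def epochPoint (p : ℝ) (grad : Vec d → Z → Vec d) (γ₁ : ℝ) (T₁ : ℕ) (D₁ : ℝ) (w : Vec d)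
    (s : ℕ → ℕ → Z) : ℕ → Vec d
  | 0 => w
  | k + 1 => (1 / (epochLen p T₁ k : ℝ)) • ∑ i ∈ Finset.range (epochLen p T₁ k),
      ballSGD grad (epochPoint p grad γ₁ T₁ D₁ w s k) (D₁ / 2 ^ ((k : ℝ) / p)) (γ₁ / 2 ^ k) (s k) i

/-- The number of epochs that fit into the budget of `K` SGD steps (as every epoch has at least one
step when `T₁ ≥ 1`, it is at most `K`). -/
def numEpochs (p : ℝ) (T₁ K : ℕ) : ℕ :=
  Nat.findGreatest (fun k => ∑ i ∈ Finset.range k, epochLen p T₁ i ≤ K) K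

/-- Epoch-SGD: returns the final point and the number of stochastic gradients that were used. -/
def epochSGD (p : ℝ) (grad : Vec d → Z → Vec d) (γ₁ : ℝ) (T₁ : ℕ) (D₁ : ℝ) (K : ℕ) (w : Vec d)
    (s : ℕ → ℕ → Z) : Vec d × ℕ :=
  (epochPoint p grad γ₁ T₁ D₁ w s (numEpochs p T₁ K),
    ∑ k ∈ Finset.range (numEpochs p T₁ K), epochLen p T₁ k)

end EpochSGD

/-! ### UniBiO -/

/-- The parameters of UniBiO: `α t`, `K₁ t`, `R t`, `K t` are the initial step size, the length of
the first epoch, the initial radius and the total budget of the call of Epoch-SGD in iteration `t`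
(`t = 0` is the warm start); `C` and `Q` are the scaling and the truncation of the Neumann series;
`I` is the period of the lower-level updates; `T` is the number of iterations. -/
structure Params where
  α : ℕ → ℝ
  K₁ : ℕ → ℕ
  R : ℕ → ℝ
  K : ℕ → ℕ
  C : ℝ
  Q : ℕ
  β : ℝ
  η : ℝ
  I : ℕ
  T : ℕ

/-- The upper-level sample `ξ̄ = (ξ, ζ⁽⁰⁾, (ζ^{(q,j)})_{q,j})`. -/
abbrev UpperSample (Ξ Z : Type*) := Ξ × Z × (ℕ × ℕ → Z)

/-- The state of UniBiO: upper variable, lower variable, momentum, oracle calls so far. -/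
structure State (dx dy : ℕ) where
  x : Vec dx
  y : Vec dy
  m : Vec dx
  calls : ℕ

section Algorithm

variable {dx dy : ℕ} {Ξ Z : Type*}

/-- The Neumann series estimator
`(1/C) ∑_{q<Q} ∏_{j=1}^{q} (I - (1/C) d∇_yG(x,y;ζ^{(q,j)})/d[y]^{∘(p-1)})` of the inverse of the
generalized Hessian. As in the chain rule for `Φ`, matrices act on gradients, so that the
generalized Hessian enters through the transpose of the Jacobian. -/
def neumann (p C : ℝ) (Q : ℕ) (G : Z → Vec dx → Vec dy → ℝ) (x : Vec dx) (y : Vec dy)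
    (ζ : ℕ × ℕ → Z) : Vec dy →L[ℝ] Vec dy :=
  (1 / C) • ∑ q ∈ Finset.range Q, ((List.range q).map fun j =>
    ContinuousLinearMap.id ℝ (Vec dy)
      - (1 / C) • ContinuousLinearMap.adjoint (powHess p (G (ζ (q, j + 1))) x y)).prod

/-- The stochastic hypergradient `∇̂f(x,y;ξ̄)`. -/
def hyperGradEst (p C : ℝ) (Q : ℕ) (F : Ξ → Vec dx → Vec dy → ℝ) (G : Z → Vec dx → Vec dy → ℝ)
    (x : Vec dx) (y : Vec dy) (s : UpperSample Ξ Z) : Vec dx :=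
  gradX (F s.1) x y
    - crossXY (G s.2.1) x y (neumann p C Q G x y s.2.2 (powGrad p (F s.1) x y))

/-- The number of oracle calls in one evaluation of `∇̂f`: `∇ₓF`, `dF/d[y]^{∘(p-1)}`, one product
with `∇²_{xy}G`, and `q` products with generalized Hessians for every `q < Q`. -/
def hyperGradCalls (Q : ℕ) : ℕ := 3 + ∑ q ∈ Finset.range Q, q

/-- The call of Epoch-SGD on `g(x,·)` in iteration `t`, started at `y`. -/
def lowerUpdate (p : ℝ) (P : Params) (G : Z → Vec dx → Vec dy → ℝ) (s : ℕ × ℕ × ℕ → Z) (t : ℕ)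
    (x : Vec dx) (y : Vec dy) : Vec dy × ℕ :=
  epochSGD p (fun w ζ => gradY (G ζ) x w) (P.α t) (P.K₁ t) (P.R t) (P.K t) y
    (fun k i => s (t, k, i))

/-- Iteration `t` of UniBiO (a zero momentum leaves the upper variable in place). -/
def step (p : ℝ) (P : Params) (F : Ξ → Vec dx → Vec dy → ℝ) (G : Z → Vec dx → Vec dy → ℝ)
    (sy : ℕ × ℕ × ℕ → Z) (sx : ℕ → UpperSample Ξ Z) (t : ℕ) (S : State dx dy) : State dx dy :=
  let u : Vec dy × ℕ := if P.I ∣ t then lowerUpdate p P G sy t S.x S.y else (S.y, 0)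
  let m : Vec dx := P.β • S.m + (1 - P.β) • hyperGradEst p P.C P.Q F G S.x u.1 (sx t)
  { x := S.x - P.η • (‖m‖⁻¹ • m)
    y := u.1
    m := m
    calls := S.calls + u.2 + hyperGradCalls P.Q }

/-- The state of UniBiO after `t` iterations. The initial state is the one after the warm start;
iteration `t = 1, 2, …` starts from the upper variable `x_t = (run … (t-1)).x`. -/
def run (p : ℝ) (P : Params) (F : Ξ → Vec dx → Vec dy → ℝ) (G : Z → Vec dx → Vec dy → ℝ)
    (x₀ : Vec dx) (y₀ : Vec dy) (sy : ℕ × ℕ × ℕ → Z) (sx : ℕ → UpperSample Ξ Z) :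
    ℕ → State dx dy
  | 0 =>
    { x := x₀
      y := (lowerUpdate p P G sy 0 x₀ y₀).1
      m := 0
      calls := (lowerUpdate p P G sy 0 x₀ y₀).2 }
  | t + 1 => step p P F G sy sx (t + 1) (run p P F G x₀ y₀ sy sx t)

variable [MeasurableSpace Ξ] [MeasurableSpace Z]

/-- The law of the lower-level samples: independent with law `Dg`. -/
def lowerLaw (Dg : Measure Z) [IsProbabilityMeasure Dg] : Measure (ℕ × ℕ × ℕ → Z) :=
  Measure.infinitePi fun _ => Dg

/-- The law of one upper-level sample `ξ̄`: independent components with laws `Df` and `Dg`. -/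
def upperSampleLaw (Df : Measure Ξ) (Dg : Measure Z) [IsProbabilityMeasure Dg] :
    Measure (UpperSample Ξ Z) :=
  Df.prod (Dg.prod (Measure.infinitePi fun _ : ℕ × ℕ => Dg))

instance (Df : Measure Ξ) (Dg : Measure Z) [IsProbabilityMeasure Df] [IsProbabilityMeasure Dg] :
    IsProbabilityMeasure (upperSampleLaw Df Dg) := by
  unfold upperSampleLaw; infer_instance

/-- The law of the upper-level samples `ξ̄₁, ξ̄₂, …`: independent and identically distributed. -/
def upperLaw (Df : Measure Ξ) (Dg : Measure Z) [IsProbabilityMeasure Df]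
    [IsProbabilityMeasure Dg] : Measure (ℕ → UpperSample Ξ Z) :=
  Measure.infinitePi fun _ => upperSampleLaw Df Dg

end Algorithm

/-- The argument of polylogarithmic factors, `1 + log(1/(εδ))`. -/
def logFactor (ε δ : ℝ) : ℝ := 1 + Real.log (1 / (ε * δ))

end UniBiO

end

/-!
# Convergence of UniBiO

**The problem.** In the variable `z = [y]^{∘(p-1)}` the Jacobian of the lower-level gradient, the
generalized Hessian, is coercive, and `y*` is continuous by uniform convexity. So the implicit
function theorem (`LowerLevel.hasFDerivAt_lowerSolPow`) makes `[y*]^{∘(p-1)}` differentiable, and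
the chain rule gives `∇Φ(x) = hyperGrad p f g x (y*(x))`, where `hyperGrad` is Lipschitz in both
variables (`norm_hyperGrad_sub_le`, `hasGradientAt_hyperObj`). Uniform convexity makes `y*` Hölder
continuous with exponent `1/(p-1)` (`LowerLevel.lowerSol_holder`); hence `∇Φ` has the modulus of
continuity `gradMod`, and a step of length `η ∼ ε^{3p-3}` changes it by `O(ε³)` only.

**The estimator.** As `Cb` dominates `(C² + σg₂²) / μ`, one random factor
`Id - (1/Cb) d∇_yG/d[y]^{∘(p-1)}` contracts in mean square by a fixed factor. Therefore the
truncated Neumann series has a bounded second moment, uniformly in its length `Q`, and a bias that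
is exponentially small in `Q` (`Oracle.lintegral_hyperGradEst_sub_sq_le`,
`norm_hyperGradMean_sub_le`).

**The lower level.** An epoch that starts within its radius of `y*` ends within the next, smaller
radius, except with probability `exp (-L)`: the noise of an epoch is an exponential
supermartingale (`Oracle.measure_epoch_fail_le`). Between two updates `y*` moves by `O(ε)`. So for
*fixed* upper-level samples a union bound over all epochs shows that the lower variable stays
`O(ε)`-close to `y*(x_t)` for all `t`, up to a small probability
(`Oracle.measure_tracking_fail_le`). The theorem asks for the other order of quantifiers. By
Tonelli's theorem and Markov's inequality (`measure_section_ge_le`), with high probability over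
the lower-level samples the exceptional set of upper-level samples has probability at most `θ`. On
it the distance is at most polynomial in `1/ε`, as all steps are bounded, and `θ` is chosen
polynomially small at a logarithmic cost.

**The upper level.** For fixed lower-level samples the momentum is split into averaged noise,
whose variance is reduced by the factor `1 - β ∼ ε²` (`Oracle.lintegral_momentumNoise_sq_le`), and
a part that follows `∇Φ` up to the averaged drift `gradMod η / (1 - β) = O(ε)` and the bias
(`sum_norm_momentum_sub_noise_le`). The descent inequality for normalized steps
(`sum_norm_gradient_le`) then bounds the average of `‖∇Φ(x_t)‖`.

Conditional expectations appear only in the form `lintegral_update`: the law of an i.i.d. family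
does not change if one coordinate is resampled.
-/

noncomputable section

namespace UniBiO

/-! ### Infinite product measures and noise -/

section ProductMeasure

variable {ι Z : Type*} [DecidableEq ι] [MeasurableSpace Z]

lemma measurable_update_prod (j : ι) :
    Measurable fun q : (ι → Z) × Z => Function.update q.1 j q.2 := by
  refine measurable_pi_lambda _ fun i => ?_
  by_cases h : i = j
  · subst h; simpa using measurable_snd
  · simp only [Function.update_of_ne h]
    exact (measurable_pi_apply i).comp measurable_fst

/-- Resampling one coordinate does not change the law of an i.i.d. family. All conditional
expectations of the argument are taken by integrating out a single coordinate in this way. -/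
lemma measurePreserving_update (μ : Measure Z) [IsProbabilityMeasure μ] (j : ι) :
    MeasurePreserving (fun q : (ι → Z) × Z => Function.update q.1 j q.2)
      ((Measure.infinitePi fun _ : ι => μ).prod μ) (Measure.infinitePi fun _ : ι => μ) := by
  refine ⟨measurable_update_prod j, Measure.eq_infinitePi _ fun s t ht => ?_⟩
  rw [Measure.map_apply (measurable_update_prod j)
    (MeasurableSet.pi s.countable_toSet fun i _ => ht i)]
  by_cases hj : j ∈ s
  · have : (fun q : (ι → Z) × Z => Function.update q.1 j q.2) ⁻¹' (Set.pi s t)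
        = (Set.pi (s.erase j : Finset ι) t) ×ˢ t j := by
      ext q
      simp only [Set.mem_preimage, Set.mem_pi, Set.mem_prod, Finset.mem_coe, Finset.mem_erase]
      constructor
      · intro h
        refine ⟨fun i hi => ?_, ?_⟩
        · simpa [Function.update_of_ne hi.1] using h i hi.2
        · simpa using h j hj
      · rintro ⟨h₁, h₂⟩ i hi
        by_cases hij : i = j
        · subst hij; simpa using h₂
        · simpa [Function.update_of_ne hij] using h₁ i ⟨hij, hi⟩
    rw [this, Measure.prod_prod, Measure.infinitePi_pi _ (fun i _ => ht i), mul_comm,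
      Finset.mul_prod_erase s (fun i => μ (t i)) hj]
  · have : (fun q : (ι → Z) × Z => Function.update q.1 j q.2) ⁻¹' (Set.pi s t)
        = (Set.pi s t) ×ˢ Set.univ := by
      ext q
      simp only [Set.mem_preimage, Set.mem_pi, Set.mem_prod, Finset.mem_coe, Set.mem_univ,
        and_true]
      refine forall₂_congr fun i hi => ?_
      have : i ≠ j := fun h => hj (h ▸ hi)
      simp [Function.update_of_ne this]
    rw [this, Measure.prod_prod, Measure.infinitePi_pi _ (fun i _ => ht i), measure_univ, mul_one]

lemma lintegral_update (μ : Measure Z) [IsProbabilityMeasure μ] (j : ι)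
    {V : (ι → Z) → ENNReal} (hV : Measurable V) :
    ∫⁻ s, V s ∂(Measure.infinitePi fun _ : ι => μ)
      = ∫⁻ s, ∫⁻ z, V (Function.update s j z) ∂μ ∂(Measure.infinitePi fun _ : ι => μ) := by
  rw [← (measurePreserving_update μ j).lintegral_comp hV]
  exact lintegral_prod _ (hV.comp (measurable_update_prod j)).aemeasurable

lemma integral_update (μ : Measure Z) [IsProbabilityMeasure μ] (j : ι) {E : Type*}
    [NormedAddCommGroup E] [NormedSpace ℝ E]
    {V : (ι → Z) → E} (hV : Integrable V (Measure.infinitePi fun _ : ι => μ)) :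
    ∫ s, V s ∂(Measure.infinitePi fun _ : ι => μ)
      = ∫ s, ∫ z, V (Function.update s j z) ∂μ ∂(Measure.infinitePi fun _ : ι => μ) := by
  have h := measurePreserving_update μ j
  have h2 : Integrable (fun q : (ι → Z) × Z => V (Function.update q.1 j q.2))
      ((Measure.infinitePi fun _ : ι => μ).prod μ) := h.integrable_comp_of_integrable hV
  rw [← integral_prod _ h2]
  conv_lhs => rw [← h.map_eq]
  rw [integral_map h.measurable.aemeasurable]
  rw [h.map_eq]; exact hV.aestronglyMeasurable

/-- A supermartingale inequality: `V (i+1)` is obtained from `V i` using one further coordinate. -/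
lemma lintegral_le_pow_of_update (μ : Measure Z) [IsProbabilityMeasure μ] (j : ℕ → ι)
    {V : ℕ → (ι → Z) → ENNReal} (hV : ∀ i, Measurable (V i)) (c : ENNReal)
    (h : ∀ i s, ∫⁻ z, V (i + 1) (Function.update s (j i) z) ∂μ ≤ c * V i s) (n : ℕ) :
    ∫⁻ s, V n s ∂(Measure.infinitePi fun _ : ι => μ)
      ≤ c ^ n * ∫⁻ s, V 0 s ∂(Measure.infinitePi fun _ : ι => μ) := by
  induction n with
  | zero => simp
  | succ n ih =>
    rw [lintegral_update μ (j n) (hV (n + 1))]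
    calc _ ≤ ∫⁻ s, c * V n s ∂(Measure.infinitePi fun _ : ι => μ) := lintegral_mono (h n)
      _ = c * ∫⁻ s, V n s ∂(Measure.infinitePi fun _ : ι => μ) := lintegral_const_mul _ (hV n)
      _ ≤ c * (c ^ n * ∫⁻ s, V 0 s ∂(Measure.infinitePi fun _ : ι => μ)) := by gcongr
      _ = _ := by rw [pow_succ']; ring

end ProductMeasure

section Noise

lemma exp_le_add_exp_sq (x : ℝ) : Real.exp x ≤ x + Real.exp (x ^ 2) := by
  have h2 : x ^ 2 + 1 ≤ Real.exp (x ^ 2) := Real.add_one_le_exp _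
  rcases le_or_gt |x| 1 with h | h
  · have := (abs_le.mp (Real.abs_exp_sub_one_sub_id_le h)).2
    linarith
  · rcases le_or_gt 0 x with h0 | h0
    · rw [abs_of_nonneg h0] at h
      have : Real.exp x ≤ Real.exp (x ^ 2) := Real.exp_le_exp.mpr (by nlinarith)
      linarith
    · rw [abs_of_neg h0] at h
      have : Real.exp x ≤ 1 := Real.exp_le_one_iff.mpr h0.le
      nlinarith

lemma exp_mul_le_of_mem_Icc {θ Y : ℝ} (h0 : 0 ≤ θ) (h1 : θ ≤ 1) :
    Real.exp (θ * Y) ≤ 1 - θ + θ * Real.exp Y := by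
  have := convexOn_exp.2 (Set.mem_univ 0) (Set.mem_univ Y) (sub_nonneg.mpr h1) h0 (by ring)
  simpa using this

variable {Z : Type*} [MeasurableSpace Z] {μ : Measure Z} [IsProbabilityMeasure μ]
variable {E : Type*} [NormedAddCommGroup E] [InnerProductSpace ℝ E]

/-- The exponential moment of one SGD step: the linear term in the noise is centred, and the
squared norm has a light tail. -/
lemma lintegral_exp_noise_le [CompleteSpace E] {N : Z → E} {σ lam γ D : ℝ} (hσ : 0 < σ)
    (hlam : 0 ≤ lam)
    (hγ : 0 ≤ γ) (hint : Integrable N μ) (hmean : ∫ z, N z ∂μ = 0)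
    (htail : ∫⁻ z, ENNReal.ofReal (Real.exp (‖N z‖ ^ 2 / σ ^ 2)) ∂μ
      ≤ ENNReal.ofReal (Real.exp 1))
    {v : E} (hv : ‖v‖ ≤ D) (h₁ : 2 * lam * D * σ ≤ 1) (h₂ : 2 * lam * γ * σ ^ 2 ≤ 1) :
    ∫⁻ z, ENNReal.ofReal (Real.exp (lam * (-inner ℝ (N z) v + γ * ‖N z‖ ^ 2))) ∂μ
      ≤ ENNReal.ofReal (Real.exp (4 * lam ^ 2 * D ^ 2 * σ ^ 2 + 2 * lam * γ * σ ^ 2)) := by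
  have hD : 0 ≤ D := (norm_nonneg v).trans hv
  set θ₁ := 4 * lam ^ 2 * D ^ 2 * σ ^ 2 with hθ₁
  set θ₂ := 2 * lam * γ * σ ^ 2 with hθ₂
  have hθ₁0 : 0 ≤ θ₁ := by positivity
  have hθ₂0 : 0 ≤ θ₂ := by positivity
  have hθ₁1 : θ₁ ≤ 1 := by
    have h0 : 0 ≤ 2 * lam * D * σ := by positivity
    calc θ₁ = (2 * lam * D * σ) ^ 2 := by rw [hθ₁]; ring
      _ ≤ 1 := pow_le_one₀ h0 h₁
  have hmeas : AEStronglyMeasurable (fun z => Real.exp (‖N z‖ ^ 2 / σ ^ 2)) μ := by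
    have hc : Continuous fun w : E => Real.exp (‖w‖ ^ 2 / σ ^ 2) := by fun_prop
    exact hc.comp_aestronglyMeasurable hint.aestronglyMeasurable
  have hexp : Integrable (fun z => Real.exp (‖N z‖ ^ 2 / σ ^ 2)) μ := by
    refine ⟨hmeas, ?_⟩
    rw [hasFiniteIntegral_iff_ofReal (Filter.Eventually.of_forall fun _ => (Real.exp_pos _).le)]
    exact htail.trans_lt ENNReal.ofReal_lt_top
  have hexple : ∫ z, Real.exp (‖N z‖ ^ 2 / σ ^ 2) ∂μ ≤ Real.exp 1 := by
    rw [← ofReal_integral_eq_lintegral_ofReal hexp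
      (Filter.Eventually.of_forall fun _ => (Real.exp_pos _).le)] at htail
    exact (ENNReal.ofReal_le_ofReal_iff (Real.exp_pos _).le).mp htail
  have hinner : Integrable (fun z => inner ℝ (N z) v) μ := hint.inner_const (𝕜 := ℝ) v
  have hinner0 : ∫ z, inner ℝ (N z) v ∂μ = 0 := by
    have := integral_inner (𝕜 := ℝ) hint v
    rw [hmean, inner_zero_right] at this
    rw [← this]
    exact integral_congr_ae (Filter.Eventually.of_forall fun z => real_inner_comm _ _)
  have hpt : ∀ z, Real.exp (lam * (-inner ℝ (N z) v + γ * ‖N z‖ ^ 2))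
      ≤ -lam * inner ℝ (N z) v + (1 + (θ₁ + θ₂) / 2 * (Real.exp (‖N z‖ ^ 2 / σ ^ 2) - 1)) := by
    intro z
    set a := -lam * inner ℝ (N z) v with ha
    set Y := ‖N z‖ ^ 2 / σ ^ 2 with hY
    have hYσ : ‖N z‖ ^ 2 = Y * σ ^ 2 := by rw [hY]; field_simp
    have e1 : Real.exp (a + lam * γ * ‖N z‖ ^ 2)
        ≤ (Real.exp (2 * a) + Real.exp (2 * (lam * γ * ‖N z‖ ^ 2))) / 2 := by
      have h := two_mul_le_add_sq (Real.exp a) (Real.exp (lam * γ * ‖N z‖ ^ 2))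
      rw [Real.exp_add, two_mul a, two_mul (lam * γ * _), Real.exp_add, Real.exp_add]
      nlinarith
    have e2 : Real.exp (2 * a) ≤ 2 * a + (1 - θ₁ + θ₁ * Real.exp Y) := by
      refine (exp_le_add_exp_sq (2 * a)).trans ?_
      have : (2 * a) ^ 2 ≤ θ₁ * Y := by
        have hcs : |inner ℝ (N z) v| ≤ ‖N z‖ * D :=
          (abs_real_inner_le_norm _ _).trans (by gcongr)
        have hsq : (inner ℝ (N z) v) ^ 2 ≤ (‖N z‖ * D) ^ 2 := by
          rw [← sq_abs]; gcongr
        calc (2 * a) ^ 2 = 4 * lam ^ 2 * (inner ℝ (N z) v) ^ 2 := by rw [ha]; ring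
          _ ≤ 4 * lam ^ 2 * (‖N z‖ * D) ^ 2 := by gcongr
          _ = θ₁ * Y := by rw [hθ₁, mul_pow, hYσ]; ring
      have h3 := (Real.exp_le_exp.mpr this).trans (exp_mul_le_of_mem_Icc hθ₁0 hθ₁1)
      linarith
    have e3 : Real.exp (2 * (lam * γ * ‖N z‖ ^ 2)) ≤ 1 - θ₂ + θ₂ * Real.exp Y := by
      have : 2 * (lam * γ * ‖N z‖ ^ 2) = θ₂ * Y := by rw [hθ₂, hYσ]; ring
      rw [this]
      exact exp_mul_le_of_mem_Icc hθ₂0 h₂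
    have e0 : lam * (-inner ℝ (N z) v + γ * ‖N z‖ ^ 2) = a + lam * γ * ‖N z‖ ^ 2 := by
      rw [ha]; ring
    rw [e0]
    linarith
  have hK : Integrable (fun z => (θ₁ + θ₂) / 2 * (Real.exp (‖N z‖ ^ 2 / σ ^ 2) - 1)) μ :=
    (hexp.sub (integrable_const _)).const_mul _
  have hK1 : Integrable (fun z => 1 + (θ₁ + θ₂) / 2 * (Real.exp (‖N z‖ ^ 2 / σ ^ 2) - 1)) μ :=
    (integrable_const _).add hK
  have hInt : Integrable (fun z => -lam * inner ℝ (N z) v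
      + (1 + (θ₁ + θ₂) / 2 * (Real.exp (‖N z‖ ^ 2 / σ ^ 2) - 1))) μ :=
    (hinner.const_mul _).add hK1
  calc _ ≤ ∫⁻ z, ENNReal.ofReal (-lam * inner ℝ (N z) v
      + (1 + (θ₁ + θ₂) / 2 * (Real.exp (‖N z‖ ^ 2 / σ ^ 2) - 1))) ∂μ :=
        lintegral_mono fun z => ENNReal.ofReal_le_ofReal (hpt z)
    _ = ENNReal.ofReal (∫ z, (-lam * inner ℝ (N z) v
      + (1 + (θ₁ + θ₂) / 2 * (Real.exp (‖N z‖ ^ 2 / σ ^ 2) - 1))) ∂μ) := by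
        rw [ofReal_integral_eq_lintegral_ofReal hInt]
        exact Filter.Eventually.of_forall fun z => (Real.exp_pos _).le.trans (hpt z)
    _ ≤ _ := by
        refine ENNReal.ofReal_le_ofReal ?_
        rw [integral_add (hinner.const_mul _) hK1,
          integral_const_mul, hinner0,
          integral_add (integrable_const _) hK,
          integral_const_mul, integral_sub hexp (integrable_const _)]
        simp only [integral_const, probReal_univ, smul_eq_mul, mul_zero, zero_add, one_mul]
        have he : Real.exp 1 ≤ 3 := by linarith [Real.exp_one_lt_d9]
        have h3 := Real.add_one_le_exp (θ₁ + θ₂)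
        have : (θ₁ + θ₂) / 2 * (∫ z, Real.exp (‖N z‖ ^ 2 / σ ^ 2) ∂μ - 1) ≤ (θ₁ + θ₂) / 2 * 2 := by
          gcongr; linarith
        linarith

/-- The second moment of a vector perturbed by centred noise. -/
lemma lintegral_enorm_add_sq_le [CompleteSpace E] {N : Z → E} {σ : ℝ}
    (hint : Integrable N μ) (hmean : ∫ z, N z ∂μ = 0)
    (hvar : ∫⁻ z, ‖N z‖ₑ ^ 2 ∂μ ≤ ENNReal.ofReal (σ ^ 2)) (v : E) :
    ∫⁻ z, ‖v + N z‖ₑ ^ 2 ∂μ ≤ ENNReal.ofReal (‖v‖ ^ 2 + σ ^ 2) := by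
  have hconv : ∀ w : E, ‖w‖ₑ ^ 2 = ENNReal.ofReal (‖w‖ ^ 2) := fun w => by
    rw [← ofReal_norm, ENNReal.ofReal_pow (norm_nonneg _)]
  have hsq : Integrable (fun z => ‖N z‖ ^ 2) μ := by
    refine ⟨hint.aestronglyMeasurable.norm.pow 2, ?_⟩
    rw [hasFiniteIntegral_iff_ofReal (Filter.Eventually.of_forall fun _ => by positivity)]
    simp only [← hconv]
    exact hvar.trans_lt ENNReal.ofReal_lt_top
  have hsqle : ∫ z, ‖N z‖ ^ 2 ∂μ ≤ σ ^ 2 := by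
    simp only [hconv] at hvar
    rw [← ofReal_integral_eq_lintegral_ofReal hsq
      (Filter.Eventually.of_forall fun _ => by positivity)] at hvar
    exact (ENNReal.ofReal_le_ofReal_iff (sq_nonneg _)).mp hvar
  have hinner : Integrable (fun z => inner ℝ v (N z)) μ := hint.const_inner (𝕜 := ℝ) v
  have hinner0 : ∫ z, inner ℝ v (N z) ∂μ = 0 := by
    rw [integral_inner (𝕜 := ℝ) hint v, hmean, inner_zero_right]
  have heq : ∀ z, ‖v + N z‖ ^ 2 = ‖v‖ ^ 2 + 2 * inner ℝ v (N z) + ‖N z‖ ^ 2 := fun z =>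
    norm_add_sq_real _ _
  have hK : Integrable (fun z => ‖v‖ ^ 2 + 2 * inner ℝ v (N z)) μ :=
    (integrable_const _).add (hinner.const_mul _)
  have hI : Integrable (fun z => ‖v + N z‖ ^ 2) μ := by
    simp only [heq]
    exact hK.add hsq
  simp only [hconv]
  rw [← ofReal_integral_eq_lintegral_ofReal hI
      (Filter.Eventually.of_forall fun _ => by positivity)]
  refine ENNReal.ofReal_le_ofReal ?_
  simp only [heq]
  rw [integral_add hK hsq,
    integral_add (integrable_const _) (hinner.const_mul _), integral_const_mul, hinner0]
  simp only [integral_const, probReal_univ, smul_eq_mul]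
  linarith

end Noise

/-! ### Coordinatewise powers and coercive operators -/

section SignPow

variable {n : ℕ}

lemma signPow_apply (ρ : ℝ) (y : Vec n) (i : Fin n) :
    signPow ρ y i = Real.sign (y i) * |y i| ^ ρ := rfl

lemma signPow_signPow {ρ τ : ℝ} (h : τ * ρ = 1) (y : Vec n) :
    signPow ρ (signPow τ y) = y := by
  ext i
  rw [signPow_apply, signPow_apply]
  rcases lt_trichotomy (y i) 0 with hy | hy | hy
  · have hpos : 0 < |y i| ^ τ := Real.rpow_pos_of_pos (abs_pos.mpr hy.ne) _
    rw [Real.sign_of_neg hy, Real.sign_of_neg (by linarith), abs_mul, abs_neg, abs_one, one_mul,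
      abs_of_pos hpos, ← Real.rpow_mul (abs_nonneg _), h, Real.rpow_one, abs_of_neg hy]
    ring
  · simp [hy]
  · have hpos : 0 < |y i| ^ τ := Real.rpow_pos_of_pos (abs_pos.mpr hy.ne') _
    rw [Real.sign_of_pos hy, one_mul, Real.sign_of_pos hpos, one_mul, abs_of_pos hpos,
      ← Real.rpow_mul (abs_nonneg _), h, Real.rpow_one, abs_of_pos hy]

lemma continuous_signPow {ρ : ℝ} (hρ : 0 < ρ) : Continuous (signPow ρ : Vec n → Vec n) := by
  have key : ∀ t : ℝ, Real.sign t * |t| ^ ρ = (max t 0) ^ ρ - (max (-t) 0) ^ ρ := by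
    intro t
    rcases lt_trichotomy t 0 with ht | ht | ht
    · rw [Real.sign_of_neg ht, abs_of_neg ht, max_eq_right ht.le,
        max_eq_left (by linarith : 0 ≤ -t), Real.zero_rpow hρ.ne']
      ring
    · simp [ht]
    · rw [Real.sign_of_pos ht, abs_of_pos ht, max_eq_left ht.le,
        max_eq_right (by linarith : -t ≤ 0), Real.zero_rpow hρ.ne']
      ring
  unfold signPow
  refine (PiLp.continuous_toLp 2 _).comp (continuous_pi fun i => ?_)
  simp only [key]
  have hc : Continuous fun y : Vec n => y i := by fun_prop
  exact ((hc.max continuous_const).rpow_const fun _ => Or.inr hρ.le).sub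
    ((hc.neg.max continuous_const).rpow_const fun _ => Or.inr hρ.le)

end SignPow

section Coercive

variable {E : Type*} [NormedAddCommGroup E] [InnerProductSpace ℝ E]

lemma norm_le_of_coercive {A : E →L[ℝ] E} {μ : ℝ} (h : ∀ v, μ * ‖v‖ ^ 2 ≤ inner ℝ (A v) v)
    (v : E) : μ * ‖v‖ ≤ ‖A v‖ := by
  rcases eq_or_ne v 0 with rfl | hv
  · simp
  · have hpos : 0 < ‖v‖ := norm_pos_iff.mpr hv
    have := (h v).trans (real_inner_le_norm _ _)
    nlinarith

variable [FiniteDimensional ℝ E]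

lemma isInvertible_of_coercive {A : E →L[ℝ] E} {μ : ℝ} (hμ : 0 < μ)
    (h : ∀ v, μ * ‖v‖ ^ 2 ≤ inner ℝ (A v) v) : A.IsInvertible := by
  have hinj : Function.Injective A := by
    rw [injective_iff_map_eq_zero]
    intro v hv
    have := norm_le_of_coercive h v
    rw [hv, norm_zero] at this
    exact norm_le_zero_iff.mp (by nlinarith [norm_nonneg v])
  exact ⟨(LinearEquiv.ofInjectiveEndo A.toLinearMap hinj).toContinuousLinearEquiv, by ext v; rfl⟩

lemma apply_inverse_of_coercive {A : E →L[ℝ] E} {μ : ℝ} (hμ : 0 < μ)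
    (h : ∀ v, μ * ‖v‖ ^ 2 ≤ inner ℝ (A v) v) (v : E) : A (A.inverse v) = v := by
  obtain ⟨e, rfl⟩ := isInvertible_of_coercive hμ h
  simp

lemma norm_inverse_le_of_coercive {A : E →L[ℝ] E} {μ : ℝ} (hμ : 0 < μ)
    (h : ∀ v, μ * ‖v‖ ^ 2 ≤ inner ℝ (A v) v) (v : E) : ‖A.inverse v‖ ≤ ‖v‖ / μ := by
  rw [le_div_iff₀ hμ, mul_comm]
  simpa [apply_inverse_of_coercive hμ h v] using norm_le_of_coercive h (A.inverse v)

lemma coercive_adjoint {A : E →L[ℝ] E} {μ : ℝ}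
    (h : ∀ v, μ * ‖v‖ ^ 2 ≤ inner ℝ (A v) v) (v : E) :
    μ * ‖v‖ ^ 2 ≤ inner ℝ (ContinuousLinearMap.adjoint A v) v := by
  rw [ContinuousLinearMap.adjoint_inner_left, real_inner_comm]
  exact h v

/-- Solutions of coercive linear systems depend on the data in a Lipschitz way. -/
lemma norm_inverse_sub_inverse_le {A₁ A₂ : E →L[ℝ] E} {μ : ℝ} (hμ : 0 < μ)
    (h₁ : ∀ v, μ * ‖v‖ ^ 2 ≤ inner ℝ (A₁ v) v) (h₂ : ∀ v, μ * ‖v‖ ^ 2 ≤ inner ℝ (A₂ v) v)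
    (b₁ b₂ : E) :
    ‖A₁.inverse b₁ - A₂.inverse b₂‖ ≤ (‖b₁ - b₂‖ + ‖A₁ - A₂‖ * (‖b₂‖ / μ)) / μ := by
  rw [le_div_iff₀ hμ, mul_comm]
  refine (norm_le_of_coercive h₁ _).trans ?_
  have : A₁ (A₁.inverse b₁ - A₂.inverse b₂) = (b₁ - b₂) - (A₁ - A₂) (A₂.inverse b₂) := by
    rw [map_sub, apply_inverse_of_coercive hμ h₁, sub_apply,
      apply_inverse_of_coercive hμ h₂]
    abel
  rw [this]
  refine (norm_sub_le _ _).trans (add_le_add_right ?_ _)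
  exact ((A₁ - A₂).le_opNorm _).trans
    (mul_le_mul_of_nonneg_left (norm_inverse_le_of_coercive hμ h₂ b₂) (norm_nonneg _))

end Coercive

lemma jointDist_le {dx dy : ℕ} (x₁ x₂ : Vec dx) (y₁ y₂ : Vec dy) :
    jointDist x₁ x₂ y₁ y₂ ≤ ‖x₁ - x₂‖ + ‖y₁ - y₂‖ := by
  unfold jointDist
  rw [Real.sqrt_le_left (by positivity)]
  nlinarith [norm_nonneg (x₁ - x₂), norm_nonneg (y₁ - y₂)]

/-- A map that is Lipschitz for `jointDist` is continuous. -/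
lemma continuous_of_jointDist {dx dy : ℕ} {E : Type*} [NormedAddCommGroup E]
    {φ : Vec dx → Vec dy → E} {K : ℝ}
    (h : ∀ x₁ x₂ y₁ y₂, ‖φ x₁ y₁ - φ x₂ y₂‖ ≤ K * jointDist x₁ x₂ y₁ y₂) :
    Continuous fun q : Vec dx × Vec dy => φ q.1 q.2 := by
  rw [continuous_iff_continuousAt]
  intro q
  rw [ContinuousAt, tendsto_iff_norm_sub_tendsto_zero]
  have hlim : Filter.Tendsto (fun r : Vec dx × Vec dy => |K| * (‖r.1 - q.1‖ + ‖r.2 - q.2‖))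
      (nhds q) (nhds 0) := by
    have : Continuous fun r : Vec dx × Vec dy => |K| * (‖r.1 - q.1‖ + ‖r.2 - q.2‖) := by
      fun_prop
    simpa using this.tendsto q
  refine squeeze_zero (fun _ => norm_nonneg _) (fun r => ?_) hlim
  refine (h _ _ _ _).trans ?_
  have h0 : 0 ≤ jointDist r.1 q.1 r.2 q.2 := Real.sqrt_nonneg _
  exact mul_le_mul (le_abs_self K) (jointDist_le _ _ _ _) h0 (abs_nonneg K)

/-! ### The lower-level solution -/

section Lower

variable {dx dy : ℕ} {p μ L₀ L₁ lg₁ lg₂ C : ℝ} {g : Vec dx → Vec dy → ℝ}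

/-- The lower-level solution in the variable `z = [y]^{∘(p-1)}`, in which it is
differentiable. -/
def lowerSolPow (p : ℝ) (g : Vec dx → Vec dy → ℝ) (x : Vec dx) : Vec dy :=
  signPow (p - 1) (lowerSol g x)

lemma signPow_inv_signPow (hp : 2 ≤ p) (y : Vec dy) :
    signPow (1 / (p - 1)) (signPow (p - 1) y) = y :=
  signPow_signPow (by field_simp [(by linarith : p - 1 ≠ 0)]) y

lemma signPow_signPow_inv (hp : 2 ≤ p) (z : Vec dy) :
    signPow (p - 1) (signPow (1 / (p - 1)) z) = z :=
  signPow_signPow (by field_simp [(by linarith : p - 1 ≠ 0)]) z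

lemma LowerLevel.continuous (hg : LowerLevel p μ L₀ L₁ lg₁ lg₂ C g) (x : Vec dx) :
    Continuous (g x) := (hg.diff_y x).continuous

lemma LowerLevel.exists_min (hg : LowerLevel p μ L₀ L₁ lg₁ lg₂ C g) (hp : 2 ≤ p) (hμ : 0 < μ)
    (x : Vec dx) : ∃ y, ∀ y', g x y ≤ g x y' := by
  refine (hg.continuous x).exists_forall_le' 0 ?_
  have hev := tendsto_norm_cocompact_atTop (E := Vec dy) |>.eventually_ge_atTop
    (max 1 (p / μ * ‖gradY g x 0‖))
  filter_upwards [hev] with y hy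
  have h1 : 1 ≤ ‖y‖ := (le_max_left _ _).trans hy
  have h2 : p / μ * ‖gradY g x 0‖ ≤ ‖y‖ := (le_max_right _ _).trans hy
  have h := hg.uniformlyConvex x 0 y
  rw [sub_zero] at h
  have h3 : -(‖gradY g x 0‖ * ‖y‖) ≤ inner ℝ (gradY g x 0) y :=
    (abs_le.mp (abs_real_inner_le_norm _ _)).1
  have h4 : ‖y‖ ^ (2 : ℝ) ≤ ‖y‖ ^ p := Real.rpow_le_rpow_of_exponent_le h1 hp
  rw [Real.rpow_two] at h4
  have hp0 : 0 < p := by linarith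
  have h5 : ‖gradY g x 0‖ ≤ μ / p * ‖y‖ := by
    rw [div_mul_eq_mul_div, div_le_iff₀ hμ] at h2
    rw [div_mul_eq_mul_div, le_div_iff₀ hp0]
    linarith
  have h6 : μ / p * ‖y‖ ^ 2 ≤ μ / p * ‖y‖ ^ p := by gcongr
  have h7 : ‖gradY g x 0‖ * ‖y‖ ≤ μ / p * ‖y‖ * ‖y‖ := by gcongr
  nlinarith

lemma LowerLevel.lowerSol_le (hg : LowerLevel p μ L₀ L₁ lg₁ lg₂ C g) (hp : 2 ≤ p) (hμ : 0 < μ)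
    (x : Vec dx) (y : Vec dy) : g x (lowerSol g x) ≤ g x y :=
  Classical.epsilon_spec (hg.exists_min hp hμ x) y

lemma LowerLevel.gradY_lowerSol (hg : LowerLevel p μ L₀ L₁ lg₁ lg₂ C g) (hp : 2 ≤ p) (hμ : 0 < μ)
    (x : Vec dx) : gradY g x (lowerSol g x) = 0 := by
  have hmin : IsLocalMin (g x) (lowerSol g x) :=
    Filter.Eventually.of_forall (hg.lowerSol_le hp hμ x)
  rw [gradY, gradient, hmin.fderiv_eq_zero, map_zero]

/-- Growth away from the minimizer. -/
lemma LowerLevel.growth (hg : LowerLevel p μ L₀ L₁ lg₁ lg₂ C g) (hp : 2 ≤ p) (hμ : 0 < μ)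
    (x : Vec dx) (y : Vec dy) :
    μ / p * ‖y - lowerSol g x‖ ^ p ≤ g x y - g x (lowerSol g x) := by
  have := hg.uniformlyConvex x (lowerSol g x) y
  rw [hg.gradY_lowerSol hp hμ, inner_zero_left] at this
  linarith

lemma LowerLevel.sub_le_inner (hg : LowerLevel p μ L₀ L₁ lg₁ lg₂ C g) (hp : 2 ≤ p) (hμ : 0 < μ)
    (x : Vec dx) (y y' : Vec dy) : g x y - g x y' ≤ inner ℝ (gradY g x y) (y - y') := by
  have h := hg.uniformlyConvex x y y'
  have h2 : 0 ≤ μ / p * ‖y' - y‖ ^ p := by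
    have : 0 < p := by linarith
    positivity
  have h3 : inner ℝ (gradY g x y) (y' - y) = - inner ℝ (gradY g x y) (y - y') := by
    rw [← inner_neg_right, neg_sub]
  linarith

lemma LowerLevel.convexOn (hg : LowerLevel p μ L₀ L₁ lg₁ lg₂ C g) (hp : 2 ≤ p) (hμ : 0 < μ)
    (x : Vec dx) : ConvexOn ℝ Set.univ (g x) := by
  refine ⟨convex_univ, fun y₁ _ y₂ _ a b ha hb hab => ?_⟩
  set w := a • y₁ + b • y₂ with hw
  have h1 := hg.uniformlyConvex x w y₁
  have h2 := hg.uniformlyConvex x w y₂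
  have hp0 : 0 < p := by linarith
  have e1 : 0 ≤ μ / p * ‖y₁ - w‖ ^ p := by positivity
  have e2 : 0 ≤ μ / p * ‖y₂ - w‖ ^ p := by positivity
  have e3 : a * inner ℝ (gradY g x w) (y₁ - w) + b * inner ℝ (gradY g x w) (y₂ - w) = 0 := by
    rw [← inner_smul_right, ← inner_smul_right, ← inner_add_right]
    have : a • (y₁ - w) + b • (y₂ - w) = 0 := by
      have : a • (y₁ - w) + b • (y₂ - w) = (a • y₁ + b • y₂) - (a + b) • w := by module
      rw [this, hab, ← hw]; simp
    rw [this, inner_zero_right]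
  simp only [smul_eq_mul]
  have f1 := mul_le_mul_of_nonneg_left
    (by linarith : g x w + inner ℝ (gradY g x w) (y₁ - w) ≤ g x y₁) ha
  have f2 := mul_le_mul_of_nonneg_left
    (by linarith : g x w + inner ℝ (gradY g x w) (y₂ - w) ≤ g x y₂) hb
  have : a * g x w + b * g x w = g x w := by rw [← add_mul, hab, one_mul]
  nlinarith

/-- The Hölder modulus of continuity of `y*`. -/
def solMod (p μ lg₁ s : ℝ) : ℝ := (p * lg₁ / (2 * μ) * s) ^ (1 / (p - 1))

/-- `y*` is Hölder continuous with exponent `1/(p-1)`, by uniform convexity at both solutions. -/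
lemma LowerLevel.lowerSol_holder (hg : LowerLevel p μ L₀ L₁ lg₁ lg₂ C g) (hp : 2 ≤ p) (hμ : 0 < μ)
    (hlg₁ : 0 ≤ lg₁) (x₁ x₂ : Vec dx) :
    ‖lowerSol g x₁ - lowerSol g x₂‖ ≤ solMod p μ lg₁ ‖x₁ - x₂‖ := by
  set y₁ := lowerSol g x₁ with hy₁
  set y₂ := lowerSol g x₂ with hy₂
  have hp0 : 0 < p := by linarith
  have a1 := hg.uniformlyConvex x₁ y₂ y₁
  have a2 := hg.growth hp hμ x₁ y₂
  rw [← hy₁, norm_sub_rev] at a2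
  have a3 : gradY g x₂ y₂ = 0 := hg.gradY_lowerSol hp hμ x₂
  have a4 := hg.gradY_lipschitz x₁ x₂ y₂
  rw [a3, sub_zero] at a4
  have a5 : -(‖gradY g x₁ y₂‖ * ‖y₁ - y₂‖) ≤ inner ℝ (gradY g x₁ y₂) (y₁ - y₂) :=
    (abs_le.mp (abs_real_inner_le_norm _ _)).1
  set r := ‖y₁ - y₂‖ with hr
  have hr0 : 0 ≤ r := norm_nonneg _
  have a6 : 2 * (μ / p * r ^ p) ≤ lg₁ * ‖x₁ - x₂‖ * r := by
    have := mul_le_mul_of_nonneg_right a4 hr0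
    linarith
  unfold solMod
  have hs : 0 ≤ p * lg₁ / (2 * μ) * ‖x₁ - x₂‖ := by positivity
  rcases hr0.eq_or_lt with h0 | hrpos
  · rw [← h0]; positivity
  · have a7 : r ^ p = r ^ (p - 1) * r := by
      rw [← Real.rpow_add_one hrpos.ne']; ring_nf
    rw [a7] at a6
    have a8 : r ^ (p - 1) ≤ p * lg₁ / (2 * μ) * ‖x₁ - x₂‖ := by
      have a9 : 2 * (μ / p * r ^ (p - 1)) ≤ lg₁ * ‖x₁ - x₂‖ := by
        refine le_of_mul_le_mul_right ?_ hrpos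
        linarith
      calc r ^ (p - 1) = p / (2 * μ) * (2 * (μ / p * r ^ (p - 1))) := by field_simp
        _ ≤ p / (2 * μ) * (lg₁ * ‖x₁ - x₂‖) := by gcongr
        _ = _ := by ring
    calc r = (r ^ (p - 1)) ^ (1 / (p - 1)) := by
          rw [← Real.rpow_mul hr0, mul_one_div_cancel (by linarith : p - 1 ≠ 0), Real.rpow_one]
      _ ≤ _ := Real.rpow_le_rpow (by positivity) a8 (by
          rw [one_div, inv_nonneg]; linarith)

lemma solMod_mono (hp : 2 ≤ p) (hμ : 0 < μ) (hlg₁ : 0 ≤ lg₁) {s t : ℝ} (hs : 0 ≤ s) (h : s ≤ t) :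
    solMod p μ lg₁ s ≤ solMod p μ lg₁ t := by
  unfold solMod
  have hp0 : 0 < p := by linarith
  refine Real.rpow_le_rpow (by positivity) (by gcongr) ?_
  rw [one_div, inv_nonneg]; linarith

lemma solMod_nonneg (hp : 2 ≤ p) (hμ : 0 < μ) (hlg₁ : 0 ≤ lg₁) {s : ℝ} (hs : 0 ≤ s) :
    0 ≤ solMod p μ lg₁ s := by
  unfold solMod
  have hp0 : 0 < p := by linarith
  positivity

lemma LowerLevel.continuous_lowerSol (hg : LowerLevel p μ L₀ L₁ lg₁ lg₂ C g) (hp : 2 ≤ p)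
    (hμ : 0 < μ) (hlg₁ : 0 ≤ lg₁) : Continuous (lowerSol g) := by
  rw [continuous_iff_continuousAt]
  intro x
  rw [ContinuousAt, tendsto_iff_norm_sub_tendsto_zero]
  refine squeeze_zero (fun _ => norm_nonneg _) (fun x' => hg.lowerSol_holder hp hμ hlg₁ x' x) ?_
  have hpos : 0 < 1 / (p - 1) := by rw [one_div, inv_pos]; linarith
  have hc : Continuous fun x' : Vec dx => solMod p μ lg₁ ‖x' - x‖ := by
    unfold solMod
    exact (continuous_const.mul (continuous_id.sub continuous_const).norm).rpow_const
      fun _ => Or.inr hpos.le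
  have := hc.tendsto x
  have h0 : solMod p μ lg₁ ‖x - x‖ = 0 := by
    rw [sub_self, norm_zero, solMod, mul_zero, Real.zero_rpow hpos.ne']
  rwa [h0] at this

/-- Relaxed smoothness bounds the gradient near the minimizer, by Grönwall's inequality. -/
lemma LowerLevel.norm_gradY_le (hg : LowerLevel p μ L₀ L₁ lg₁ lg₂ C g) (hp : 2 ≤ p) (hμ : 0 < μ)
    (hL₀ : 0 ≤ L₀) (hL₁ : 0 ≤ L₁) {r : ℝ} (x : Vec dx) {y : Vec dy}
    (hy : ‖y - lowerSol g x‖ ≤ r) :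
    ‖gradY g x y‖ ≤ gronwallBound 0 (L₁ * r) (L₀ * r) 1 := by
  set y₀ := lowerSol g x with hy₀
  have hr : 0 ≤ r := (norm_nonneg _).trans hy
  have hder : ∀ s : ℝ, HasDerivAt (fun s : ℝ => gradY g x (y₀ + s • (y - y₀)))
      (hessYY g x (y₀ + s • (y - y₀)) (y - y₀)) s := by
    intro s
    have h1 : HasDerivAt (fun s : ℝ => y₀ + s • (y - y₀)) (y - y₀) s := by
      simpa using ((hasDerivAt_id s).smul_const (y - y₀)).const_add y₀
    exact ((hg.diff_yy x).differentiableAt.hasFDerivAt).comp_hasDerivAt s h1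
  have := norm_le_gronwallBound_of_norm_deriv_right_le (a := 0) (b := 1) (δ := 0)
    (K := L₁ * r) (ε := L₀ * r)
    (f := fun s : ℝ => gradY g x (y₀ + s • (y - y₀)))
    (f' := fun s => hessYY g x (y₀ + s • (y - y₀)) (y - y₀))
    (fun s _ => (hder s).continuousAt.continuousWithinAt)
    (fun s _ => (hder s).hasDerivWithinAt)
    (by simp [hy₀, hg.gradY_lowerSol hp hμ])
    (fun s _ => by
      refine (ContinuousLinearMap.le_opNorm _ _).trans ?_
      have h2 := hg.relaxedSmooth x (y₀ + s • (y - y₀))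
      calc _ ≤ (L₀ + L₁ * ‖gradY g x (y₀ + s • (y - y₀))‖) * r := by gcongr
        _ = _ := by ring)
    1 (by simp)
  simpa using this

/-! #### Differentiability in the variable `[y]^{∘(p-1)}` -/

lemma LowerLevel.hasFDerivAt_pow (hg : LowerLevel p μ L₀ L₁ lg₁ lg₂ C g) (hp : 2 ≤ p)
    (x : Vec dx) (z : Vec dy) :
    HasFDerivAt (fun z => gradY g x (signPow (1 / (p - 1)) z))
      (powHess p g x (signPow (1 / (p - 1)) z)) z := by
  rw [powHess, signPow_signPow_inv hp]
  exact (hg.diff_pow x z).hasFDerivAt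

lemma LowerLevel.hasFDerivAt_x (hg : LowerLevel p μ L₀ L₁ lg₁ lg₂ C g)
    (x : Vec dx) (y : Vec dy) :
    HasFDerivAt (fun x => gradY g x y) (ContinuousLinearMap.adjoint (crossXY g x y)) x := by
  rw [crossXY, ContinuousLinearMap.adjoint_adjoint]
  exact (hg.diff_yx y x).hasFDerivAt

lemma LowerLevel.signPow_lowerSolPow (hp : 2 ≤ p) (x : Vec dx) :
    signPow (1 / (p - 1)) (lowerSolPow p g x) = lowerSol g x := signPow_inv_signPow hp _

lemma LowerLevel.continuous_powHess (hg : LowerLevel p μ L₀ L₁ lg₁ lg₂ C g) :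
    Continuous fun q : Vec dx × Vec dy => powHess p g q.1 q.2 :=
  continuous_of_jointDist hg.powHess_lipschitz

lemma LowerLevel.continuous_crossXY (hg : LowerLevel p μ L₀ L₁ lg₁ lg₂ C g) :
    Continuous fun q : Vec dx × Vec dy => crossXY g q.1 q.2 :=
  continuous_of_jointDist hg.crossXY_lipschitz

lemma continuous_prodMap_signPow (hp : 2 ≤ p) :
    Continuous fun q : Vec dx × Vec dy => (q.1, signPow (1 / (p - 1)) q.2) := by
  have hpos : 0 < 1 / (p - 1) := by rw [one_div, inv_pos]; linarith
  exact continuous_fst.prodMk ((continuous_signPow hpos).comp continuous_snd)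

lemma LowerLevel.continuous_lowerSolPow (hg : LowerLevel p μ L₀ L₁ lg₁ lg₂ C g) (hp : 2 ≤ p)
    (hμ : 0 < μ) (hlg₁ : 0 ≤ lg₁) : Continuous (lowerSolPow p g) :=
  (continuous_signPow (by linarith)).comp (hg.continuous_lowerSol hp hμ hlg₁)

/-- The implicit function theorem for the lower-level optimality condition. -/
lemma LowerLevel.hasFDerivAt_lowerSolPow (hg : LowerLevel p μ L₀ L₁ lg₁ lg₂ C g) (hp : 2 ≤ p)
    (hμ : 0 < μ) (hlg₁ : 0 ≤ lg₁) (x : Vec dx) :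
    HasFDerivAt (lowerSolPow p g)
      (-(powHess p g x (lowerSol g x)).inverse ∘L
        ContinuousLinearMap.adjoint (crossXY g x (lowerSol g x))) x := by
  set q := 1 / (p - 1) with hq
  let u : Vec dx × Vec dy := (x, lowerSolPow p g x)
  let h : Vec dx → Vec dy → Vec dy := fun x z => gradY g x (signPow q z)
  let h₁ : Vec dx → Vec dy → Vec dx →L[ℝ] Vec dy :=
    fun x z => ContinuousLinearMap.adjoint (crossXY g x (signPow q z))
  let h₂ : Vec dx → Vec dy → Vec dy →L[ℝ] Vec dy := fun x z => powHess p g x (signPow q z)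
  have df₁ : ∀ᶠ v in nhds u, HasFDerivAt (h · v.2) (h₁ v.1 v.2) v.1 :=
    Filter.Eventually.of_forall fun v => hg.hasFDerivAt_x v.1 (signPow q v.2)
  have df₂ : ∀ᶠ v in nhds u, HasFDerivAt (h v.1 ·) (h₂ v.1 v.2) v.2 :=
    Filter.Eventually.of_forall fun v => hg.hasFDerivAt_pow hp v.1 v.2
  have cf₂ : ContinuousAt ↿h₂ u :=
    (hg.continuous_powHess.comp (continuous_prodMap_signPow hp)).continuousAt
  have cf₁ : ContinuousAt ↿h₁ u := by
    have hadj : Continuous fun A : Vec dy →L[ℝ] Vec dx => ContinuousLinearMap.adjoint A :=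
      (ContinuousLinearMap.adjoint (𝕜 := ℝ) (E := Vec dy) (F := Vec dx)).continuous
    exact (hadj.comp
      (hg.continuous_crossXY.comp (continuous_prodMap_signPow hp))).continuousAt
  have if₂ : (h₂ u.1 u.2).IsInvertible := isInvertible_of_coercive hμ (hg.powHess_ge _ _)
  have hd := (hasStrictFDerivAt_implicitFunctionOfBivariate df₁ df₂ cf₁ cf₂ if₂).hasFDerivAt
  have hev := eventually_apply_eq_iff_implicitFunctionOfBivariate df₁ df₂ cf₁ cf₂ if₂
  have hu : h u.1 u.2 = 0 := by
    change gradY g x (signPow q (lowerSolPow p g x)) = 0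
    rw [LowerLevel.signPow_lowerSolPow hp, hg.gradY_lowerSol hp hμ]
  have htend : Filter.Tendsto (fun x' => (x', lowerSolPow p g x')) (nhds x) (nhds u) :=
    (continuous_id.prodMk (hg.continuous_lowerSolPow hp hμ hlg₁)).tendsto x
  have heq : lowerSolPow p g =ᶠ[nhds x] implicitFunctionOfBivariate df₁ df₂ cf₁ cf₂ if₂ := by
    filter_upwards [htend.eventually hev] with x' hx'
    refine (hx'.mp ?_).symm
    rw [hu]
    change gradY g x' (signPow q (lowerSolPow p g x')) = 0
    rw [LowerLevel.signPow_lowerSolPow hp, hg.gradY_lowerSol hp hμ]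
  have hfin := hd.congr_of_eventuallyEq heq
  have e1 : h₁ u.1 u.2 = ContinuousLinearMap.adjoint (crossXY g x (lowerSol g x)) := by
    change ContinuousLinearMap.adjoint (crossXY g x (signPow q (lowerSolPow p g x))) = _
    rw [LowerLevel.signPow_lowerSolPow hp]
  have e2 : h₂ u.1 u.2 = powHess p g x (lowerSol g x) := by
    change powHess p g x (signPow q (lowerSolPow p g x)) = _
    rw [LowerLevel.signPow_lowerSolPow hp]
  rw [e1, e2] at hfin
  exact hfin

end Lower

/-! ### The hypergradient -/

section Hyper

variable {dx dy : ℕ} {p μ L₀ L₁ lg₁ lg₂ C lf₀ lf₁ Δ : ℝ} {f g : Vec dx → Vec dy → ℝ} {x₀ : Vec dx}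

/-- The expression for the hypergradient with an arbitrary lower variable `y` in place of
`y*(x)`. -/
def hyperGrad (p : ℝ) (f g : Vec dx → Vec dy → ℝ) (x : Vec dx) (y : Vec dy) : Vec dx :=
  gradX f x y - crossXY g x y
    ((ContinuousLinearMap.adjoint (powHess p g x y)).inverse (powGrad p f x y))

/-- A Lipschitz constant of `hyperGrad`. -/
def hyperLip (μ lg₁ lg₂ lf₀ lf₁ : ℝ) : ℝ :=
  lf₁ + (lg₂ * (lf₀ / μ) + lg₁ * ((lf₁ + lg₂ * (lf₀ / μ)) / μ))

lemma hyperLip_nonneg (hμ : 0 < μ) (hlg₁ : 0 ≤ lg₁) (hlg₂ : 0 ≤ lg₂) (hlf₀ : 0 ≤ lf₀)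
    (hlf₁ : 0 ≤ lf₁) : 0 ≤ hyperLip μ lg₁ lg₂ lf₀ lf₁ := by
  unfold hyperLip; positivity

lemma LowerLevel.norm_crossXY_le (hg : LowerLevel p μ L₀ L₁ lg₁ lg₂ C g) (hlg₁ : 0 ≤ lg₁)
    (x : Vec dx) (y : Vec dy) : ‖crossXY g x y‖ ≤ lg₁ := by
  rw [crossXY, LinearIsometryEquiv.norm_map]
  refine norm_fderiv_le_of_lip' ℝ hlg₁ (Filter.Eventually.of_forall fun x' => ?_)
  exact hg.gradY_lipschitz x' x y

lemma norm_hyperGrad_sub_le (hg : LowerLevel p μ L₀ L₁ lg₁ lg₂ C g)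
    (hf : UpperLevel p lf₀ lf₁ Δ f g x₀) (hμ : 0 < μ) (hlg₁ : 0 ≤ lg₁)
    (hlg₂ : 0 ≤ lg₂) (x₁ x₂ : Vec dx) (y₁ y₂ : Vec dy) :
    ‖hyperGrad p f g x₁ y₁ - hyperGrad p f g x₂ y₂‖
      ≤ hyperLip μ lg₁ lg₂ lf₀ lf₁ * jointDist x₁ x₂ y₁ y₂ := by
  set d := jointDist x₁ x₂ y₁ y₂ with hd
  have hd0 : 0 ≤ d := Real.sqrt_nonneg _
  set H₁ := ContinuousLinearMap.adjoint (powHess p g x₁ y₁) with hH₁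
  set H₂ := ContinuousLinearMap.adjoint (powHess p g x₂ y₂) with hH₂
  have c₁ : ∀ v, μ * ‖v‖ ^ 2 ≤ inner ℝ (H₁ v) v := coercive_adjoint (hg.powHess_ge x₁ y₁)
  have c₂ : ∀ v, μ * ‖v‖ ^ 2 ≤ inner ℝ (H₂ v) v := coercive_adjoint (hg.powHess_ge x₂ y₂)
  set b₁ := powGrad p f x₁ y₁ with hb₁
  set b₂ := powGrad p f x₂ y₂ with hb₂
  have hHd : ‖H₁ - H₂‖ ≤ lg₂ * d := by
    rw [hH₁, hH₂, ← map_sub, LinearIsometryEquiv.norm_map]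
    exact hg.powHess_lipschitz _ _ _ _
  have hbd : ‖b₁ - b₂‖ ≤ lf₁ * d := hf.powGrad_lipschitz _ _ _ _
  have hBd : ‖crossXY g x₁ y₁ - crossXY g x₂ y₂‖ ≤ lg₂ * d := hg.crossXY_lipschitz _ _ _ _
  have hb₁n : ‖b₁‖ ≤ lf₀ := hf.powGrad_le _ _
  have hb₂n : ‖b₂‖ ≤ lf₀ := hf.powGrad_le _ _
  have hlf₀ : 0 ≤ lf₀ := (norm_nonneg _).trans hb₁n
  have hw₁ : ‖H₁.inverse b₁‖ ≤ lf₀ / μ :=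
    (norm_inverse_le_of_coercive hμ c₁ b₁).trans (by gcongr)
  have hwd : ‖H₁.inverse b₁ - H₂.inverse b₂‖ ≤ (lf₁ + lg₂ * (lf₀ / μ)) / μ * d := by
    refine (norm_inverse_sub_inverse_le hμ c₁ c₂ b₁ b₂).trans ?_
    calc _ ≤ (lf₁ * d + lg₂ * d * (lf₀ / μ)) / μ := by gcongr
      _ = _ := by ring
  have e : hyperGrad p f g x₁ y₁ - hyperGrad p f g x₂ y₂
      = (gradX f x₁ y₁ - gradX f x₂ y₂)
        - ((crossXY g x₁ y₁ - crossXY g x₂ y₂) (H₁.inverse b₁)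
          + crossXY g x₂ y₂ (H₁.inverse b₁ - H₂.inverse b₂)) := by
    simp only [hyperGrad, ← hH₁, ← hH₂, ← hb₁, ← hb₂, sub_apply, map_sub]
    abel
  rw [e]
  calc _ ≤ ‖gradX f x₁ y₁ - gradX f x₂ y₂‖
        + (‖(crossXY g x₁ y₁ - crossXY g x₂ y₂) (H₁.inverse b₁)‖
          + ‖crossXY g x₂ y₂ (H₁.inverse b₁ - H₂.inverse b₂)‖) :=
        (norm_sub_le _ _).trans (add_le_add_right (norm_add_le _ _) _)
    _ ≤ lf₁ * d + (lg₂ * d * (lf₀ / μ) + lg₁ * ((lf₁ + lg₂ * (lf₀ / μ)) / μ * d)) := by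
        gcongr
        · exact hf.gradX_lipschitz _ _ _ _
        · exact (ContinuousLinearMap.le_opNorm _ _).trans (by gcongr)
        · exact (ContinuousLinearMap.le_opNorm _ _).trans
            (by gcongr; exact hg.norm_crossXY_le hlg₁ _ _)
    _ = _ := by unfold hyperLip; ring

/-- The chain rule for the hyperobjective: `f` is differentiated in the variables
`(x, [y]^{∘(p-1)})`, in which `y*` is differentiable. -/
lemma hasGradientAt_hyperObj (hg : LowerLevel p μ L₀ L₁ lg₁ lg₂ C g)
    (hf : UpperLevel p lf₀ lf₁ Δ f g x₀) (hp : 2 ≤ p) (hμ : 0 < μ) (hlg₁ : 0 ≤ lg₁) (x : Vec dx) :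
    HasGradientAt (hyperObj f g) (hyperGrad p f g x (lowerSol g x)) x := by
  set q := 1 / (p - 1) with hq
  let z := lowerSolPow p g x
  let u : Vec dx × Vec dy := (x, z)
  let h : Vec dx → Vec dy → ℝ := fun x z => f x (signPow q z)
  let h₁ : Vec dx → Vec dy → Vec dx →L[ℝ] ℝ :=
    fun x z => InnerProductSpace.toDual ℝ (Vec dx) (gradX f x (signPow q z))
  let h₂ : Vec dx → Vec dy → Vec dy →L[ℝ] ℝ :=
    fun x z => InnerProductSpace.toDual ℝ (Vec dy) (powGrad p f x (signPow q z))
  have df₁ : ∀ᶠ v in nhds u, HasFDerivAt (h · v.2) (↿h₁ v) v.1 :=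
    Filter.Eventually.of_forall fun v => (hf.diff_x _ v.1).hasGradientAt.hasFDerivAt
  have df₂ : ∀ᶠ v in nhds u, HasFDerivAt (h v.1 ·) (↿h₂ v) v.2 :=
    Filter.Eventually.of_forall fun v => by
      have := (hf.diff_pow v.1 v.2).hasGradientAt.hasFDerivAt
      change HasFDerivAt _ (InnerProductSpace.toDual ℝ (Vec dy) (powGrad p f v.1 (signPow q v.2))) _
      rw [powGrad, signPow_signPow_inv hp]
      exact this
  have cf₁ : ContinuousAt ↿h₁ u :=
    ((InnerProductSpace.toDual ℝ (Vec dx)).continuous.comp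
      ((continuous_of_jointDist hf.gradX_lipschitz).comp
        (continuous_prodMap_signPow hp))).continuousAt
  have cf₂ : ContinuousAt ↿h₂ u :=
    ((InnerProductSpace.toDual ℝ (Vec dy)).continuous.comp
      ((continuous_of_jointDist hf.powGrad_lipschitz).comp
        (continuous_prodMap_signPow hp))).continuousAt
  have hd := (hasStrictFDerivAt_uncurry_coprod df₁ df₂ cf₁ cf₂).hasFDerivAt
  have hz := hg.hasFDerivAt_lowerSolPow hp hμ hlg₁ x
  have hpair : HasFDerivAt (fun x' => (x', lowerSolPow p g x')) _ x := (hasFDerivAt_id x).prodMk hz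
  have hcomp := HasFDerivAt.comp (g := ↿h) x hd hpair
  have hfun : (↿h ∘ fun x' => (x', lowerSolPow p g x')) = hyperObj f g := by
    funext x'
    change f x' (signPow q (lowerSolPow p g x')) = _
    rw [LowerLevel.signPow_lowerSolPow hp, hyperObj]
  rw [hfun] at hcomp
  rw [hasGradientAt_iff_hasFDerivAt]
  refine hcomp.congr_fderiv (ContinuousLinearMap.ext fun v => ?_)
  have ey : signPow q z = lowerSol g x := LowerLevel.signPow_lowerSolPow hp x
  set y := lowerSol g x with hy
  set H := powHess p g x y with hH
  have cH : ∀ v, μ * ‖v‖ ^ 2 ≤ inner ℝ (H v) v := hg.powHess_ge x y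
  set b := powGrad p f x y with hb
  set w := (ContinuousLinearMap.adjoint H).inverse b with hw
  have hbw : b = ContinuousLinearMap.adjoint H w :=
    (apply_inverse_of_coercive hμ (coercive_adjoint cH) b).symm
  have e1 : (↿h₁ u) v = inner ℝ (gradX f x y) v := by
    change (InnerProductSpace.toDual ℝ (Vec dx) (gradX f x (signPow q z))) v = _
    rw [ey, InnerProductSpace.toDual_apply_apply]
  have e2 : ∀ v, (↿h₂ u) v = inner ℝ b v := by
    intro v
    change (InnerProductSpace.toDual ℝ (Vec dy) (powGrad p f x (signPow q z))) v = _
    rw [ey, InnerProductSpace.toDual_apply_apply]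
  have e3 : inner ℝ b (H.inverse (ContinuousLinearMap.adjoint (crossXY g x y) v))
      = inner ℝ (crossXY g x y w) v := by
    rw [hbw, ContinuousLinearMap.adjoint_inner_left, apply_inverse_of_coercive hμ cH,
      ContinuousLinearMap.adjoint_inner_right]
  simp only [InnerProductSpace.toDual_apply_apply, hyperGrad, inner_sub_left,
    ContinuousLinearMap.comp_apply, ContinuousLinearMap.coprod_apply,
    ContinuousLinearMap.prod_apply, neg_apply, e2]
  rw [← e3]
  simp only [ContinuousLinearMap.id_apply, e1, inner_neg_right]
  ring

/-- The modulus of continuity of the hypergradient. -/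
def gradMod (p μ lg₁ lg₂ lf₀ lf₁ s : ℝ) : ℝ :=
  hyperLip μ lg₁ lg₂ lf₀ lf₁ * (s + solMod p μ lg₁ s)

lemma gradient_hyperObj (hg : LowerLevel p μ L₀ L₁ lg₁ lg₂ C g)
    (hf : UpperLevel p lf₀ lf₁ Δ f g x₀) (hp : 2 ≤ p) (hμ : 0 < μ) (hlg₁ : 0 ≤ lg₁) (x : Vec dx) :
    gradient (hyperObj f g) x = hyperGrad p f g x (lowerSol g x) :=
  (hasGradientAt_hyperObj hg hf hp hμ hlg₁ x).gradient

lemma gradMod_mono (hp : 2 ≤ p) (hμ : 0 < μ) (hlg₁ : 0 ≤ lg₁) (hlg₂ : 0 ≤ lg₂) (hlf₀ : 0 ≤ lf₀)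
    (hlf₁ : 0 ≤ lf₁) {s t : ℝ} (hs : 0 ≤ s) (h : s ≤ t) :
    gradMod p μ lg₁ lg₂ lf₀ lf₁ s ≤ gradMod p μ lg₁ lg₂ lf₀ lf₁ t := by
  unfold gradMod
  have := hyperLip_nonneg hμ hlg₁ hlg₂ hlf₀ hlf₁
  have h2 := solMod_mono hp hμ hlg₁ hs h
  gcongr

lemma gradMod_nonneg (hp : 2 ≤ p) (hμ : 0 < μ) (hlg₁ : 0 ≤ lg₁) (hlg₂ : 0 ≤ lg₂) (hlf₀ : 0 ≤ lf₀)
    (hlf₁ : 0 ≤ lf₁) {s : ℝ} (hs : 0 ≤ s) : 0 ≤ gradMod p μ lg₁ lg₂ lf₀ lf₁ s := by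
  unfold gradMod
  have := hyperLip_nonneg hμ hlg₁ hlg₂ hlf₀ hlf₁
  have h2 := solMod_nonneg hp hμ hlg₁ hs
  positivity

lemma norm_gradient_sub_le (hg : LowerLevel p μ L₀ L₁ lg₁ lg₂ C g)
    (hf : UpperLevel p lf₀ lf₁ Δ f g x₀) (hp : 2 ≤ p) (hμ : 0 < μ) (hlg₁ : 0 ≤ lg₁)
    (hlg₂ : 0 ≤ lg₂) (hlf₀ : 0 ≤ lf₀) (hlf₁ : 0 ≤ lf₁) (x₁ x₂ : Vec dx) :
    ‖gradient (hyperObj f g) x₁ - gradient (hyperObj f g) x₂‖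
      ≤ gradMod p μ lg₁ lg₂ lf₀ lf₁ ‖x₁ - x₂‖ := by
  rw [gradient_hyperObj hg hf hp hμ hlg₁, gradient_hyperObj hg hf hp hμ hlg₁]
  refine (norm_hyperGrad_sub_le hg hf hμ hlg₁ hlg₂ _ _ _ _).trans ?_
  have := hyperLip_nonneg hμ hlg₁ hlg₂ hlf₀ hlf₁
  unfold gradMod
  gcongr
  exact (jointDist_le _ _ _ _).trans
    (add_le_add_right (hg.lowerSol_holder hp hμ hlg₁ x₁ x₂) _)

/-- The descent inequality for the hyperobjective. -/
lemma abs_hyperObj_sub_le (hg : LowerLevel p μ L₀ L₁ lg₁ lg₂ C g)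
    (hf : UpperLevel p lf₀ lf₁ Δ f g x₀) (hp : 2 ≤ p) (hμ : 0 < μ) (hlg₁ : 0 ≤ lg₁)
    (hlg₂ : 0 ≤ lg₂) (hlf₀ : 0 ≤ lf₀) (hlf₁ : 0 ≤ lf₁) (x x' : Vec dx) :
    |hyperObj f g x' - hyperObj f g x - inner ℝ (gradient (hyperObj f g) x) (x' - x)|
      ≤ gradMod p μ lg₁ lg₂ lf₀ lf₁ ‖x' - x‖ * ‖x' - x‖ := by
  have key := Convex.norm_image_sub_le_of_norm_hasFDerivWithin_le'
    (𝕜 := ℝ) (f := hyperObj f g) (s := segment ℝ x x') (x := x) (y := x')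
    (C := gradMod p μ lg₁ lg₂ lf₀ lf₁ ‖x' - x‖)
    (φ := InnerProductSpace.toDual ℝ (Vec dx) (gradient (hyperObj f g) x))
    (f' := fun w => InnerProductSpace.toDual ℝ (Vec dx) (gradient (hyperObj f g) w))
    (fun w _ => by
      have := (hasGradientAt_hyperObj hg hf hp hμ hlg₁ w).differentiableAt.hasGradientAt
      exact this.hasFDerivAt.hasFDerivWithinAt)
    (fun w hw => by
      rw [← map_sub, LinearIsometryEquiv.norm_map]
      refine (norm_gradient_sub_le hg hf hp hμ hlg₁ hlg₂ hlf₀ hlf₁ _ _).trans ?_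
      refine gradMod_mono hp hμ hlg₁ hlg₂ hlf₀ hlf₁ (norm_nonneg _) ?_
      obtain ⟨a, b, ha, hb, hab, rfl⟩ := hw
      have : a • x + b • x' - x = b • (x' - x) := by
        have ha' : a = 1 - b := by linarith
        rw [ha']; module
      rw [this, norm_smul, Real.norm_of_nonneg hb]
      nlinarith [norm_nonneg (x' - x)])
    (convex_segment _ _) (left_mem_segment _ _ _) (right_mem_segment _ _ _)
  simpa [InnerProductSpace.toDual_apply_apply] using key

/-- The hypergradient at the initial point is bounded in terms of the initial gap: a unit step
against it cannot decrease `Φ` by more than `Δ`. -/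
lemma norm_gradient_initial_le (hg : LowerLevel p μ L₀ L₁ lg₁ lg₂ C g)
    (hf : UpperLevel p lf₀ lf₁ Δ f g x₀) (hp : 2 ≤ p) (hμ : 0 < μ) (hlg₁ : 0 ≤ lg₁)
    (hlg₂ : 0 ≤ lg₂) (hlf₀ : 0 ≤ lf₀) (hlf₁ : 0 ≤ lf₁) (hΔ : 0 < Δ) :
    ‖gradient (hyperObj f g) x₀‖ ≤ Δ + gradMod p μ lg₁ lg₂ lf₀ lf₁ 1 := by
  set v := gradient (hyperObj f g) x₀ with hv
  have hω := gradMod_nonneg (p := p) (s := 1) hp hμ hlg₁ hlg₂ hlf₀ hlf₁ zero_le_one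
  rcases eq_or_ne v 0 with h0 | h0
  · rw [h0, norm_zero]; positivity
  · have hpos : 0 < ‖v‖ := norm_pos_iff.mpr h0
    have h1 := abs_hyperObj_sub_le hg hf hp hμ hlg₁ hlg₂ hlf₀ hlf₁ x₀ (x₀ - ‖v‖⁻¹ • v)
    have h2 := hf.gap (x₀ - ‖v‖⁻¹ • v)
    have e1 : x₀ - ‖v‖⁻¹ • v - x₀ = -(‖v‖⁻¹ • v) := by abel
    have e2 : ‖-(‖v‖⁻¹ • v)‖ = 1 := by
      rw [norm_neg, norm_smul, norm_inv, norm_norm, inv_mul_cancel₀ hpos.ne']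
    rw [e1, e2, mul_one, ← hv, inner_neg_right, inner_smul_right, real_inner_self_eq_norm_sq] at h1
    have e3 : ‖v‖⁻¹ * ‖v‖ ^ 2 = ‖v‖ := by field_simp
    rw [e3] at h1
    have := (abs_le.mp h1).2
    linarith

end Hyper

/-! ### Products of independent random operators -/

section RandomProducts

variable {n m : ℕ} {Z : Type*}

lemma measurable_clm_apply {Ω : Type*} [MeasurableSpace Ω] {A : Ω → Vec n →L[ℝ] Vec m}
    {v : Ω → Vec n} (hA : Measurable A) (hv : Measurable v) : Measurable fun s => A s (v s) :=
  (isBoundedBilinearMap_apply (𝕜 := ℝ) (E := Vec n) (F := Vec m)).continuous.measurable.comp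
    (hA.prodMk hv)

lemma measurable_clm_mul {Ω : Type*} [MeasurableSpace Ω] {A B : Ω → Vec n →L[ℝ] Vec n}
    (hA : Measurable A) (hB : Measurable B) : Measurable fun s => A s * B s :=
  (continuous_mul (M := Vec n →L[ℝ] Vec n)).measurable.comp (hA.prodMk hB)

/-- The product of `k` independent copies of a random operator, taken from row `q` of the array of
samples as in the Neumann series estimator. -/
def sampleProd (A : Z → Vec n →L[ℝ] Vec n) (q k : ℕ) (ζ : ℕ × ℕ → Z) : Vec n →L[ℝ] Vec n :=
  ((List.range k).map fun j => A (ζ (q, j + 1))).prod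

lemma sampleProd_succ (A : Z → Vec n →L[ℝ] Vec n) (q k : ℕ) (ζ : ℕ × ℕ → Z) :
    sampleProd A q (k + 1) ζ = sampleProd A q k ζ * A (ζ (q, k + 1)) := by
  simp [sampleProd, List.range_succ]

lemma sampleProd_update_succ (A : Z → Vec n →L[ℝ] Vec n) (q k : ℕ) (ζ : ℕ × ℕ → Z) (z : Z) :
    sampleProd A q (k + 1) (Function.update ζ (q, k + 1) z) = sampleProd A q k ζ * A z := by
  rw [sampleProd_succ, Function.update_self]
  congr 1
  unfold sampleProd
  congr 1
  refine List.map_congr_left fun j hj => ?_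
  rw [Function.update_of_ne]
  intro h
  rw [List.mem_range] at hj
  have := congrArg Prod.snd h
  simp only at this
  omega

variable [MeasurableSpace Z]

lemma measurable_sampleProd {Ω : Type*} [MeasurableSpace Ω] {A : Ω → Z → Vec n →L[ℝ] Vec n}
    (hA : Measurable fun r : Ω × Z => A r.1 r.2) (q k : ℕ) :
    Measurable fun r : Ω × (ℕ × ℕ → Z) => sampleProd (A r.1) q k r.2 := by
  induction k with
  | zero => simp [sampleProd]
  | succ k ih =>
    simp only [sampleProd_succ]
    refine measurable_clm_mul ih ?_
    exact hA.comp (measurable_fst.prodMk ((measurable_pi_apply _).comp measurable_snd))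

variable {μ : Measure Z} [IsProbabilityMeasure μ] {A : Z → Vec n →L[ℝ] Vec n}

lemma measurable_sampleProd' (hA : Measurable A) (q k : ℕ) : Measurable (sampleProd A q k) := by
  have h := measurable_sampleProd (Ω := Unit) (A := fun _ => A) (hA.comp measurable_snd) q k
  exact h.comp (measurable_const.prodMk measurable_id : Measurable fun ζ : ℕ × ℕ → Z => ((), ζ))

/-- Mean-square contraction multiplies along independent factors. -/
lemma lintegral_sampleProd_sq_le (hA : Measurable A) {K : ENNReal}
    (hK : ∀ v, ∫⁻ z, ‖A z v‖ₑ ^ 2 ∂μ ≤ K * ‖v‖ₑ ^ 2) (q k : ℕ) (v : Vec n) :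
    ∫⁻ ζ, ‖sampleProd A q k ζ v‖ₑ ^ 2 ∂(Measure.infinitePi fun _ : ℕ × ℕ => μ)
      ≤ K ^ k * ‖v‖ₑ ^ 2 := by
  induction k generalizing v with
  | zero => simp [sampleProd]
  | succ k ih =>
    have hm : ∀ k, Measurable fun ζ => ‖sampleProd A q k ζ v‖ₑ ^ 2 := fun k =>
      (measurable_clm_apply (measurable_sampleProd' hA q k) measurable_const).enorm.pow_const 2
    rw [lintegral_update μ (q, k + 1) (hm _)]
    simp only [sampleProd_update_succ, mul_apply_eq_comp]
    rw [lintegral_lintegral_swap]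
    · calc _ ≤ ∫⁻ z, K ^ k * ‖A z v‖ₑ ^ 2 ∂μ := lintegral_mono fun z => ih (A z v)
        _ = K ^ k * ∫⁻ z, ‖A z v‖ₑ ^ 2 ∂μ :=
          lintegral_const_mul _ ((measurable_clm_apply hA measurable_const).enorm.pow_const 2)
        _ ≤ K ^ k * (K * ‖v‖ₑ ^ 2) := by gcongr; exact hK v
        _ = _ := by rw [pow_succ]; ring
    · refine Measurable.aemeasurable ?_
      refine (Measurable.enorm ?_).pow_const 2
      exact measurable_clm_apply ((measurable_sampleProd' hA q k).comp measurable_fst)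
        (measurable_clm_apply (hA.comp measurable_snd) measurable_const)

lemma integrable_sampleProd (hA : Measurable A) (hint : Integrable A μ) (q k : ℕ) :
    Integrable (sampleProd A q k) (Measure.infinitePi fun _ : ℕ × ℕ => μ) := by
  induction k with
  | zero => exact integrable_const (1 : Vec n →L[ℝ] Vec n)
  | succ k ih =>
    refine ⟨(measurable_sampleProd' hA q (k + 1)).aestronglyMeasurable, ?_⟩
    rw [HasFiniteIntegral, lintegral_update μ (q, k + 1) (measurable_sampleProd' hA q _).enorm]
    simp only [sampleProd_update_succ]
    calc _ ≤ ∫⁻ ζ, ∫⁻ z, ‖sampleProd A q k ζ‖ₑ * ‖A z‖ₑ ∂μ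
          ∂(Measure.infinitePi fun _ : ℕ × ℕ => μ) := by
          gcongr with ζ z
          rw [← ofReal_norm, ← ofReal_norm, ← ofReal_norm, ← ENNReal.ofReal_mul (norm_nonneg _)]
          exact ENNReal.ofReal_le_ofReal (norm_mul_le _ _)
      _ = (∫⁻ ζ, ‖sampleProd A q k ζ‖ₑ ∂(Measure.infinitePi fun _ : ℕ × ℕ => μ))
          * ∫⁻ z, ‖A z‖ₑ ∂μ := by
          simp only [lintegral_const_mul _ hA.enorm]
          rw [lintegral_mul_const _ (measurable_sampleProd' hA q k).enorm]
      _ < ⊤ := ENNReal.mul_lt_top ih.2 hint.2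

lemma integral_sampleProd (hA : Measurable A) (hint : Integrable A μ) (q k : ℕ) :
    ∫ ζ, sampleProd A q k ζ ∂(Measure.infinitePi fun _ : ℕ × ℕ => μ) = (∫ z, A z ∂μ) ^ k := by
  induction k with
  | zero => simp [sampleProd]
  | succ k ih =>
    rw [integral_update μ (q, k + 1) (integrable_sampleProd hA hint q (k + 1))]
    simp only [sampleProd_update_succ]
    have h1 : ∀ P : Vec n →L[ℝ] Vec n, ∫ z, P * A z ∂μ = P * ∫ z, A z ∂μ := fun P =>
      ContinuousLinearMap.integral_comp_comm (ContinuousLinearMap.compL ℝ (Vec n) (Vec n) (Vec n) P)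
        hint
    simp only [h1]
    rw [pow_succ, ← ih]
    exact ContinuousLinearMap.integral_comp_comm
      ((ContinuousLinearMap.compL ℝ (Vec n) (Vec n) (Vec n)).flip (∫ z, A z ∂μ))
      (integrable_sampleProd hA hint q k)

end RandomProducts

/-! ### The product of an independent random matrix, operator and vector -/

section TripleProduct

variable {n m : ℕ} {Ω₁ Ω₂ Ω₃ : Type*} [MeasurableSpace Ω₁] [MeasurableSpace Ω₂]
  [MeasurableSpace Ω₃] {μ₁ : Measure Ω₁} {μ₂ : Measure Ω₂} {μ₃ : Measure Ω₃}
  {b : Ω₁ → Vec n} {B : Ω₂ → Vec n →L[ℝ] Vec m} {N : Ω₃ → Vec n →L[ℝ] Vec n}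

lemma measurable_triple (hb : Measurable b) (hB : Measurable B) (hN : Measurable N) :
    Measurable fun s : Ω₁ × Ω₂ × Ω₃ => B s.2.1 (N s.2.2 (b s.1)) :=
  measurable_clm_apply (hB.comp (measurable_fst.comp measurable_snd))
    (measurable_clm_apply (hN.comp (measurable_snd.comp measurable_snd)) (hb.comp measurable_fst))

lemma integrable_triple (hb : Measurable b) (hB : Measurable B) (hN : Measurable N)
    (ib : Integrable b μ₁) (iB : Integrable B μ₂) (iN : Integrable N μ₃) :
    Integrable (fun s : Ω₁ × Ω₂ × Ω₃ => B s.2.1 (N s.2.2 (b s.1))) (μ₁.prod (μ₂.prod μ₃)) := by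
  refine (ib.norm.mul_prod (iB.norm.mul_prod iN.norm)).mono'
    (measurable_triple hb hB hN).aestronglyMeasurable (Filter.Eventually.of_forall fun s => ?_)
  calc _ ≤ ‖B s.2.1‖ * ‖N s.2.2 (b s.1)‖ := ContinuousLinearMap.le_opNorm _ _
    _ ≤ ‖B s.2.1‖ * (‖N s.2.2‖ * ‖b s.1‖) := by
      gcongr; exact ContinuousLinearMap.le_opNorm _ _
    _ = _ := by ring

lemma lintegral_triple_sq_le [SFinite μ₂] [SFinite μ₃] (hb : Measurable b)
    (hB : Measurable B) (hN : Measurable N)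
    {Kb KB KN : ENNReal} (kb : ∫⁻ z, ‖b z‖ₑ ^ 2 ∂μ₁ ≤ Kb) (kB : ∫⁻ z, ‖B z‖ₑ ^ 2 ∂μ₂ ≤ KB)
    (kN : ∀ v, ∫⁻ z, ‖N z v‖ₑ ^ 2 ∂μ₃ ≤ KN * ‖v‖ₑ ^ 2) :
    ∫⁻ s : Ω₁ × Ω₂ × Ω₃, ‖B s.2.1 (N s.2.2 (b s.1))‖ₑ ^ 2 ∂(μ₁.prod (μ₂.prod μ₃))
      ≤ KB * KN * Kb := by
  rw [lintegral_prod _ ((measurable_triple hb hB hN).enorm.pow_const 2).aemeasurable]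
  have inner : ∀ v : Vec n, ∫⁻ r : Ω₂ × Ω₃, ‖B r.1 (N r.2 v)‖ₑ ^ 2 ∂(μ₂.prod μ₃)
      ≤ KB * KN * ‖v‖ₑ ^ 2 := by
    intro v
    have hm : Measurable fun r : Ω₂ × Ω₃ => B r.1 (N r.2 v) :=
      measurable_clm_apply (hB.comp measurable_fst)
          (measurable_clm_apply (hN.comp measurable_snd) measurable_const)
    rw [lintegral_prod _ (hm.enorm.pow_const 2).aemeasurable]
    have hmN : Measurable fun z => ‖N z v‖ₑ ^ 2 :=
      (measurable_clm_apply hN measurable_const).enorm.pow_const 2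
    calc _ ≤ ∫⁻ a, ∫⁻ z, ‖B a‖ₑ ^ 2 * ‖N z v‖ₑ ^ 2 ∂μ₃ ∂μ₂ := by
          gcongr with a z
          rw [← mul_pow]
          gcongr
          exact ContinuousLinearMap.le_opENorm _ _
      _ = (∫⁻ a, ‖B a‖ₑ ^ 2 ∂μ₂) * ∫⁻ z, ‖N z v‖ₑ ^ 2 ∂μ₃ := by
          simp only [lintegral_const_mul _ hmN]
          rw [lintegral_mul_const _ (hB.enorm.pow_const 2)]
      _ ≤ KB * (KN * ‖v‖ₑ ^ 2) := by gcongr; exact kN v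
      _ = _ := by ring
  calc _ ≤ ∫⁻ a, KB * KN * ‖b a‖ₑ ^ 2 ∂μ₁ := lintegral_mono fun a => inner (b a)
    _ = KB * KN * ∫⁻ a, ‖b a‖ₑ ^ 2 ∂μ₁ := lintegral_const_mul _ (hb.enorm.pow_const 2)
    _ ≤ _ := by gcongr

variable [IsProbabilityMeasure μ₁] [IsProbabilityMeasure μ₂] [IsProbabilityMeasure μ₃]

lemma integral_triple (hb : Measurable b) (hB : Measurable B) (hN : Measurable N)
    (ib : Integrable b μ₁) (iB : Integrable B μ₂) (iN : Integrable N μ₃) :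
    ∫ s : Ω₁ × Ω₂ × Ω₃, B s.2.1 (N s.2.2 (b s.1)) ∂(μ₁.prod (μ₂.prod μ₃))
      = (∫ z, B z ∂μ₂) ((∫ z, N z ∂μ₃) (∫ z, b z ∂μ₁)) := by
  rw [integral_prod _ (integrable_triple hb hB hN ib iB iN)]
  have inner : ∀ v : Vec n, ∫ r : Ω₂ × Ω₃, B r.1 (N r.2 v) ∂(μ₂.prod μ₃)
      = (∫ z, B z ∂μ₂) ((∫ z, N z ∂μ₃) v) := by
    intro v
    have hint : Integrable (fun r : Ω₂ × Ω₃ => B r.1 (N r.2 v)) (μ₂.prod μ₃) := by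
      refine ((iB.norm.mul_prod iN.norm).mul_const ‖v‖).mono'
        (measurable_clm_apply (hB.comp measurable_fst)
          (measurable_clm_apply (hN.comp measurable_snd) measurable_const)).aestronglyMeasurable
        (Filter.Eventually.of_forall fun r => ?_)
      calc _ ≤ ‖B r.1‖ * ‖N r.2 v‖ := ContinuousLinearMap.le_opNorm _ _
        _ ≤ ‖B r.1‖ * (‖N r.2‖ * ‖v‖) := by
          gcongr; exact ContinuousLinearMap.le_opNorm _ _
        _ = _ := by ring
    rw [integral_prod _ hint]
    have iNv : Integrable (fun z => N z v) μ₃ := iN.apply_continuousLinearMap v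
    have h1 : ∀ a, ∫ z, B a (N z v) ∂μ₃ = B a ((∫ z, N z ∂μ₃) v) := by
      intro a
      rw [ContinuousLinearMap.integral_comp_comm (B a) iNv, ContinuousLinearMap.integral_apply iN]
    simp only [h1]
    rw [← ContinuousLinearMap.integral_apply iB]
  simp only [inner]
  rw [← ContinuousLinearMap.integral_comp_comm _ ib, ← ContinuousLinearMap.integral_comp_comm _
    (ContinuousLinearMap.integrable_comp _ ib)]

end TripleProduct

/-! ### The stochastic hypergradient -/

section Estimator

variable {dx dy : ℕ} {p μ L₀ L₁ lg₁ lg₂ C lf₀ lf₁ Δ σf σg₁ σg₂ Cb : ℝ}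
  {f g : Vec dx → Vec dy → ℝ} {x₀ : Vec dx}

/-- A bound for the generalized Hessian that is large enough for the random matrices
`I - (1/Cb) d∇_yG/d[y]^{∘(p-1)}` to contract in mean square. -/
structure HessBound (μ C σg₂ Cb : ℝ) : Prop where
  ge_two_mul : 2 * μ ≤ Cb
  ge_C : C ≤ Cb
  ge_sq : C ^ 2 + σg₂ ^ 2 ≤ μ * Cb

/-- The mean-square contraction factor of `I - (1/Cb) d∇_yG/d[y]^{∘(p-1)}`. -/
def contr (μ Cb : ℝ) : ℝ := 1 - μ / (2 * Cb)

lemma contr_pos (hμ : 0 < μ) (h : HessBound μ C σg₂ Cb) : 0 < contr μ Cb := by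
  have h2 := h.ge_two_mul
  have : 0 < Cb := by linarith
  unfold contr
  rw [sub_pos, div_lt_one (by linarith)]
  linarith

lemma contr_lt_one (hμ : 0 < μ) (h : HessBound μ C σg₂ Cb) : contr μ Cb < 1 := by
  have h2 := h.ge_two_mul
  have : 0 < Cb := by linarith
  unfold contr
  have : 0 < μ / (2 * Cb) := by positivity
  linarith

/-- The geometric series of the contraction factors is bounded independently of its length. -/
lemma sum_contr_le (hμ : 0 < μ) (h : HessBound μ C σg₂ Cb) (Q : ℕ) :
    1 / Cb * ∑ q ∈ Finset.range Q, contr μ Cb ^ q ≤ 2 / μ := by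
  have h0 := contr_pos hμ h
  have h1 := contr_lt_one hμ h
  have h2 := h.ge_two_mul
  have hC : 0 < Cb := by linarith
  have hs : ∑ q ∈ Finset.range Q, contr μ Cb ^ q ≤ (1 - contr μ Cb)⁻¹ := by
    rw [← tsum_geometric_of_lt_one h0.le h1]
    exact (summable_geometric_of_lt_one h0.le h1).sum_le_tsum _ fun i _ => by positivity
  calc _ ≤ 1 / Cb * (1 - contr μ Cb)⁻¹ := by gcongr
    _ = 2 / μ := by unfold contr; rw [sub_sub_cancel]; field_simp

/-- The random matrix `I - (1/Cb) (d∇_yg/d[y]^{∘(p-1)})ᵀ`. -/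
def neumannFactor (p Cb : ℝ) (g : Vec dx → Vec dy → ℝ) (x : Vec dx) (y : Vec dy) :
    Vec dy →L[ℝ] Vec dy :=
  ContinuousLinearMap.id ℝ (Vec dy)
    - (1 / Cb) • ContinuousLinearMap.adjoint (powHess p g x y)

/-- The expectation of the Neumann series estimator. -/
def neumannMean (p Cb : ℝ) (Q : ℕ) (g : Vec dx → Vec dy → ℝ) (x : Vec dx) (y : Vec dy) :
    Vec dy →L[ℝ] Vec dy :=
  (1 / Cb) • ∑ q ∈ Finset.range Q, neumannFactor p Cb g x y ^ q

/-- The expectation of the stochastic hypergradient. -/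
def hyperGradMean (p Cb : ℝ) (Q : ℕ) (f g : Vec dx → Vec dy → ℝ) (x : Vec dx) (y : Vec dy) :
    Vec dx :=
  gradX f x y - crossXY g x y (neumannMean p Cb Q g x y (powGrad p f x y))

lemma norm_neumannFactor_apply_sq_le (hg : LowerLevel p μ L₀ L₁ lg₁ lg₂ C g) (hμ : 0 < μ)
    (h : HessBound μ C σg₂ Cb) (x : Vec dx) (y v : Vec dy) :
    ‖neumannFactor p Cb g x y v‖ ^ 2 + (1 / Cb * σg₂ * ‖v‖) ^ 2 ≤ (contr μ Cb * ‖v‖) ^ 2 := by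
  have h2 := h.ge_two_mul
  have hC : 0 < Cb := by linarith
  set H := ContinuousLinearMap.adjoint (powHess p g x y) with hH
  have e : neumannFactor p Cb g x y v = v - (1 / Cb) • H v := by
    simp [neumannFactor, hH]
  have h3 := coercive_adjoint (hg.powHess_ge x y) v
  rw [← hH] at h3
  have h4 : ‖H v‖ ≤ C * ‖v‖ := by
    refine (H.le_opNorm v).trans ?_
    gcongr
    rw [hH, LinearIsometryEquiv.norm_map]
    exact hg.powHess_le x y
  have h5 : ‖H v‖ ^ 2 ≤ C ^ 2 * ‖v‖ ^ 2 := by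
    rw [← mul_pow]; gcongr
  rw [e, norm_sub_sq_real, inner_smul_right, norm_smul, mul_pow, real_inner_comm]
  rw [Real.norm_of_nonneg (by positivity)]
  have hge := h.ge_sq
  unfold contr
  have e1 : (1 / Cb) * inner ℝ (H v) v ≥ (1 / Cb) * (μ * ‖v‖ ^ 2) := by gcongr
  have e2 : (1 / Cb) ^ 2 * ‖H v‖ ^ 2 ≤ (1 / Cb) ^ 2 * (C ^ 2 * ‖v‖ ^ 2) := by gcongr
  have e3 : (1 / Cb) ^ 2 * ((C ^ 2 + σg₂ ^ 2) * ‖v‖ ^ 2) ≤ (1 / Cb) ^ 2 * (μ * Cb * ‖v‖ ^ 2) := by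
    gcongr
  have e4 : (1 / Cb) ^ 2 * (μ * Cb * ‖v‖ ^ 2) = 1 / Cb * (μ * ‖v‖ ^ 2) := by field_simp
  have e5 : ((1 - μ / (2 * Cb)) * ‖v‖) ^ 2
      = ‖v‖ ^ 2 - 1 / Cb * (μ * ‖v‖ ^ 2) + (μ / (2 * Cb)) ^ 2 * ‖v‖ ^ 2 := by field_simp; ring
  have e6 : 0 ≤ (μ / (2 * Cb)) ^ 2 * ‖v‖ ^ 2 := by positivity
  nlinarith

lemma norm_neumannFactor_apply_le (hg : LowerLevel p μ L₀ L₁ lg₁ lg₂ C g) (hμ : 0 < μ)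
    (h : HessBound μ C σg₂ Cb) (x : Vec dx) (y v : Vec dy) :
    ‖neumannFactor p Cb g x y v‖ ≤ contr μ Cb * ‖v‖ := by
  have h1 := norm_neumannFactor_apply_sq_le hg hμ h x y v
  have h0 := contr_pos hμ h
  refine le_of_sq_le_sq ?_ (by positivity)
  nlinarith [sq_nonneg (1 / Cb * σg₂ * ‖v‖)]

lemma norm_neumannFactor_pow_apply_le (hg : LowerLevel p μ L₀ L₁ lg₁ lg₂ C g) (hμ : 0 < μ)
    (h : HessBound μ C σg₂ Cb) (x : Vec dx) (y v : Vec dy) (q : ℕ) :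
    ‖(neumannFactor p Cb g x y ^ q) v‖ ≤ contr μ Cb ^ q * ‖v‖ := by
  have h0 := contr_pos hμ h
  induction q with
  | zero => simp
  | succ q ih =>
    rw [pow_succ', mul_apply_eq_comp, pow_succ', mul_assoc]
    exact (norm_neumannFactor_apply_le hg hμ h x y _).trans (by gcongr)

lemma norm_neumannMean_apply_le (hg : LowerLevel p μ L₀ L₁ lg₁ lg₂ C g) (hμ : 0 < μ)
    (h : HessBound μ C σg₂ Cb) (x : Vec dx) (y v : Vec dy) (Q : ℕ) :
    ‖neumannMean p Cb Q g x y v‖ ≤ 2 / μ * ‖v‖ := by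
  have h2 := h.ge_two_mul
  have hC : 0 < Cb := by linarith
  have e : neumannMean p Cb Q g x y v
      = (1 / Cb) • ∑ q ∈ Finset.range Q, (neumannFactor p Cb g x y ^ q) v := by
    simp [neumannMean]
  rw [e, norm_smul, Real.norm_of_nonneg (by positivity)]
  calc _ ≤ 1 / Cb * ∑ q ∈ Finset.range Q, contr μ Cb ^ q * ‖v‖ := by
        gcongr
        exact (norm_sum_le _ _).trans
          (Finset.sum_le_sum fun q _ => norm_neumannFactor_pow_apply_le hg hμ h x y v q)
    _ = (1 / Cb * ∑ q ∈ Finset.range Q, contr μ Cb ^ q) * ‖v‖ := by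
        rw [← Finset.sum_mul]; ring
    _ ≤ _ := by gcongr; exact sum_contr_le hμ h Q

/-- Truncating the Neumann series causes a geometrically small bias. -/
lemma norm_hyperGradMean_sub_le (hg : LowerLevel p μ L₀ L₁ lg₁ lg₂ C g)
    (hf : UpperLevel p lf₀ lf₁ Δ f g x₀) (hμ : 0 < μ) (hlg₁ : 0 ≤ lg₁)
    (h : HessBound μ C σg₂ Cb) (Q : ℕ) (x : Vec dx) (y : Vec dy) :
    ‖hyperGradMean p Cb Q f g x y - hyperGrad p f g x y‖
      ≤ lg₁ * (lf₀ / μ) * contr μ Cb ^ Q := by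
  have h2 := h.ge_two_mul
  have hC : 0 < Cb := by linarith
  set H := ContinuousLinearMap.adjoint (powHess p g x y) with hH
  have cH : ∀ v, μ * ‖v‖ ^ 2 ≤ inner ℝ (H v) v := coercive_adjoint (hg.powHess_ge x y)
  set b := powGrad p f x y with hb
  set w := H.inverse b with hw
  set M := neumannFactor p Cb g x y with hM
  have hHw : H w = b := apply_inverse_of_coercive hμ cH b
  have hMH : (1 / Cb) • H = 1 - M := by
    rw [hM, neumannFactor, ← hH, ContinuousLinearMap.one_def]; abel
  have e1 : neumannMean p Cb Q g x y b = w - (M ^ Q) w := by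
    have : neumannMean p Cb Q g x y * H = 1 - M ^ Q := by
      have e0 : neumannMean p Cb Q g x y * H
          = (∑ q ∈ Finset.range Q, M ^ q) * ((1 / Cb) • H) := by
        ext v
        simp [neumannMean, hM]
      rw [e0, hMH, geom_sum_mul_neg]
    rw [← hHw, ← mul_apply_eq_comp, this]
    simp
  have e2 : hyperGradMean p Cb Q f g x y - hyperGrad p f g x y
      = crossXY g x y ((M ^ Q) w) := by
    simp only [hyperGradMean, hyperGrad, ← hH, ← hb, ← hw, e1, map_sub]
    abel
  have h0 := contr_pos hμ h
  have hb₀ : ‖b‖ ≤ lf₀ := hf.powGrad_le _ _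
  have hwn : ‖w‖ ≤ lf₀ / μ := (norm_inverse_le_of_coercive hμ cH b).trans (by gcongr)
  rw [e2]
  calc _ ≤ ‖crossXY g x y‖ * ‖(M ^ Q) w‖ := ContinuousLinearMap.le_opNorm _ _
    _ ≤ lg₁ * (contr μ Cb ^ Q * (lf₀ / μ)) := by
      gcongr
      · exact hg.norm_crossXY_le hlg₁ x y
      · exact (norm_neumannFactor_pow_apply_le hg hμ h x y w Q).trans (by gcongr)
    _ = _ := by ring

variable {Ξ Z : Type*} [MeasurableSpace Ξ] [MeasurableSpace Z]
  {F : Ξ → Vec dx → Vec dy → ℝ} {G : Z → Vec dx → Vec dy → ℝ} {Df : Measure Ξ} {Dg : Measure Z}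

lemma neumann_eq {Z : Type*} {G : Z → Vec dx → Vec dy → ℝ} (Q : ℕ) (x : Vec dx) (y : Vec dy)
    (ζ : ℕ × ℕ → Z) :
    neumann p Cb Q G x y ζ = (1 / Cb) • ∑ q ∈ Finset.range Q,
      sampleProd (fun z => neumannFactor p Cb (G z) x y) q q ζ := rfl

lemma Oracle.measurable_neumannFactor (hO : Oracle p σf σg₁ σg₂ f g F G Df Dg) :
    Measurable fun r : (Vec dx × Vec dy) × Z => neumannFactor p Cb (G r.2) r.1.1 r.1.2 := by
  unfold neumannFactor
  have h1 : Measurable fun r : (Vec dx × Vec dy) × Z => powHess p (G r.2) r.1.1 r.1.2 :=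
    hO.powHess_meas.comp (measurable_snd.prodMk
      ((measurable_fst.comp measurable_fst).prodMk (measurable_snd.comp measurable_fst)))
  have hc : Continuous fun A : Vec dy →L[ℝ] Vec dy =>
      ContinuousLinearMap.id ℝ (Vec dy) - (1 / Cb) • ContinuousLinearMap.adjoint A := by
    have := (ContinuousLinearMap.adjoint (𝕜 := ℝ) (E := Vec dy) (F := Vec dy)).continuous
    fun_prop
  exact hc.measurable.comp h1

lemma Oracle.measurable_neumann (hO : Oracle p σf σg₁ σg₂ f g F G Df Dg) (Q : ℕ) :
    Measurable fun r : (Vec dx × Vec dy) × (ℕ × ℕ → Z) => neumann p Cb Q G r.1.1 r.1.2 r.2 := by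
  simp only [neumann_eq]
  have h1 : ∀ q, Measurable fun r : (Vec dx × Vec dy) × (ℕ × ℕ → Z) =>
      sampleProd (fun z => neumannFactor p Cb (G z) r.1.1 r.1.2) q q r.2 := fun q =>
    measurable_sampleProd (A := fun (w : Vec dx × Vec dy) z => neumannFactor p Cb (G z) w.1 w.2)
      hO.measurable_neumannFactor q q
  have h2 : Measurable fun r : (Vec dx × Vec dy) × (ℕ × ℕ → Z) => ∑ q ∈ Finset.range Q,
      sampleProd (fun z => neumannFactor p Cb (G z) r.1.1 r.1.2) q q r.2 :=
    Finset.measurable_fun_sum _ fun q _ => h1 q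
  exact (continuous_const_smul (1 / Cb : ℝ)).measurable.comp h2

lemma Oracle.measurable_hyperGradEst (hO : Oracle p σf σg₁ σg₂ f g F G Df Dg) (Q : ℕ) :
    Measurable fun r : (Vec dx × Vec dy) × UpperSample Ξ Z =>
      hyperGradEst p Cb Q F G r.1.1 r.1.2 r.2 := by
  unfold hyperGradEst
  have hx : Measurable fun r : (Vec dx × Vec dy) × UpperSample Ξ Z => r.1.1 :=
    measurable_fst.comp measurable_fst
  have hy : Measurable fun r : (Vec dx × Vec dy) × UpperSample Ξ Z => r.1.2 :=
    measurable_snd.comp measurable_fst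
  have h1 : Measurable fun r : (Vec dx × Vec dy) × UpperSample Ξ Z => r.2.1 :=
    measurable_fst.comp measurable_snd
  have h2 : Measurable fun r : (Vec dx × Vec dy) × UpperSample Ξ Z => r.2.2.1 :=
    measurable_fst.comp (measurable_snd.comp measurable_snd)
  have h3 : Measurable fun r : (Vec dx × Vec dy) × UpperSample Ξ Z => r.2.2.2 :=
    measurable_snd.comp (measurable_snd.comp measurable_snd)
  have m1 := hO.gradX_meas.comp (h1.prodMk (hx.prodMk hy))
  have m2 := hO.powGrad_meas.comp (h1.prodMk (hx.prodMk hy))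
  have m3 := hO.crossXY_meas.comp (h2.prodMk (hx.prodMk hy))
  have m4 := (hO.measurable_neumann (Cb := Cb) Q).comp ((hx.prodMk hy).prodMk h3)
  simp only [Function.comp_def] at m1 m2 m3 m4
  exact m1.sub (measurable_clm_apply m3 (measurable_clm_apply m4 m2))

lemma Oracle.integrable_adjoint (hO : Oracle p σf σg₁ σg₂ f g F G Df Dg)
    (x : Vec dx) (y : Vec dy) :
    Integrable (fun z => (1 / Cb) • ContinuousLinearMap.adjoint (powHess p (G z) x y)) Dg ∧
    ∫ z, (1 / Cb) • ContinuousLinearMap.adjoint (powHess p (G z) x y) ∂Dg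
      = (1 / Cb) • ContinuousLinearMap.adjoint (powHess p g x y) := by
  let adj : (Vec dy →L[ℝ] Vec dy) →L[ℝ] (Vec dy →L[ℝ] Vec dy) :=
    (1 / Cb) • (ContinuousLinearMap.adjoint (𝕜 := ℝ) (E := Vec dy)
      (F := Vec dy)).toContinuousLinearEquiv.toContinuousLinearMap
  refine ⟨adj.integrable_comp (hO.powHess_integrable x y), ?_⟩
  rw [← hO.powHess_mean x y]
  exact adj.integral_comp_comm (hO.powHess_integrable x y)

lemma enorm_add_sq_le {E : Type*} [NormedAddCommGroup E] (a b : E) :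
    ‖a + b‖ₑ ^ 2 ≤ 2 * ‖a‖ₑ ^ 2 + 2 * ‖b‖ₑ ^ 2 := by
  have h : ‖a + b‖ ^ 2 ≤ 2 * ‖a‖ ^ 2 + 2 * ‖b‖ ^ 2 := by
    have := norm_add_le a b
    nlinarith [sq_nonneg (‖a‖ - ‖b‖), norm_nonneg (a + b), norm_nonneg a, norm_nonneg b]
  have e : ∀ a : E, ‖a‖ₑ ^ 2 = ENNReal.ofReal (‖a‖ ^ 2) := fun a => by
    rw [← ofReal_norm, ENNReal.ofReal_pow (norm_nonneg _)]
  have e2 : (2 : ENNReal) = ENNReal.ofReal 2 := by simp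
  rw [e, e, e, e2, ← ENNReal.ofReal_mul (by norm_num), ← ENNReal.ofReal_mul (by norm_num),
    ← ENNReal.ofReal_add (by positivity) (by positivity)]
  exact ENNReal.ofReal_le_ofReal h

lemma enorm_sub_sq_le {E : Type*} [NormedAddCommGroup E] (a b : E) :
    ‖a - b‖ₑ ^ 2 ≤ 2 * ‖a‖ₑ ^ 2 + 2 * ‖b‖ₑ ^ 2 := by
  have := enorm_add_sq_le a (-b)
  rwa [enorm_neg, ← sub_eq_add_neg] at this

lemma enorm_sq_eq_ofReal {E : Type*} [NormedAddCommGroup E] (a : E) :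
    ‖a‖ₑ ^ 2 = ENNReal.ofReal (‖a‖ ^ 2) := by
  rw [← ofReal_norm, ENNReal.ofReal_pow (norm_nonneg _)]

lemma Oracle.measurable_neumannFactor_sample (hO : Oracle p σf σg₁ σg₂ f g F G Df Dg)
    (x : Vec dx) (y : Vec dy) : Measurable fun z => neumannFactor p Cb (G z) x y :=
  hO.measurable_neumannFactor.comp (g := fun r : (Vec dx × Vec dy) × Z =>
    neumannFactor p Cb (G r.2) r.1.1 r.1.2) (f := fun z => ((x, y), z))
    (measurable_const.prodMk measurable_id)

variable [IsProbabilityMeasure Dg]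

lemma Oracle.integrable_neumannFactor (hO : Oracle p σf σg₁ σg₂ f g F G Df Dg)
    (x : Vec dx) (y : Vec dy) : Integrable (fun z => neumannFactor p Cb (G z) x y) Dg :=
  (integrable_const _).sub (hO.integrable_adjoint x y).1

lemma Oracle.integral_neumannFactor (hO : Oracle p σf σg₁ σg₂ f g F G Df Dg)
    (x : Vec dx) (y : Vec dy) :
    ∫ z, neumannFactor p Cb (G z) x y ∂Dg = neumannFactor p Cb g x y := by
  unfold neumannFactor
  rw [integral_sub (integrable_const _) (hO.integrable_adjoint x y).1,
    (hO.integrable_adjoint x y).2]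
  simp

/-- One factor of the Neumann series contracts in mean square: this is where `Cb` has to be
large compared with the variance of the generalized Hessian. -/
lemma Oracle.lintegral_neumannFactor_sq_le (hO : Oracle p σf σg₁ σg₂ f g F G Df Dg)
    (hg : LowerLevel p μ L₀ L₁ lg₁ lg₂ C g) (hμ : 0 < μ) (h : HessBound μ C σg₂ Cb)
    (x : Vec dx) (y v : Vec dy) :
    ∫⁻ z, ‖neumannFactor p Cb (G z) x y v‖ₑ ^ 2 ∂Dg
      ≤ ENNReal.ofReal (contr μ Cb ^ 2) * ‖v‖ₑ ^ 2 := by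
  have h2 := h.ge_two_mul
  have hC : 0 < Cb := by linarith
  set M := neumannFactor p Cb g x y with hM
  let N : Z → Vec dy := fun z => neumannFactor p Cb (G z) x y v - M v
  have hiA : Integrable (fun z => neumannFactor p Cb (G z) x y v) Dg :=
    (hO.integrable_neumannFactor x y).apply_continuousLinearMap v
  have hN : Integrable N Dg := hiA.sub (integrable_const _)
  have hN0 : ∫ z, N z ∂Dg = 0 := by
    rw [integral_sub hiA (integrable_const _),
      ← ContinuousLinearMap.integral_apply (hO.integrable_neumannFactor x y),
      hO.integral_neumannFactor]
    simp [hM]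
  have hNv : ∫⁻ z, ‖N z‖ₑ ^ 2 ∂Dg ≤ ENNReal.ofReal ((1 / Cb * σg₂ * ‖v‖) ^ 2) := by
    calc _ ≤ ∫⁻ z, ENNReal.ofReal ((1 / Cb * ‖v‖) ^ 2)
          * ‖powHess p (G z) x y - powHess p g x y‖ₑ ^ 2 ∂Dg := by
          refine lintegral_mono fun z => ?_
          rw [enorm_sq_eq_ofReal, enorm_sq_eq_ofReal, ← ENNReal.ofReal_mul (by positivity)]
          refine ENNReal.ofReal_le_ofReal ?_
          rw [← mul_pow]
          gcongr
          have : N z = -((1 / Cb) • ContinuousLinearMap.adjoint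
              (powHess p (G z) x y - powHess p g x y) v) := by
            simp only [N, hM, neumannFactor, map_sub, sub_apply, smul_apply, smul_sub]
            abel
          rw [this, norm_neg, norm_smul, Real.norm_of_nonneg (by positivity), mul_assoc,
            mul_comm ‖v‖]
          gcongr
          refine (ContinuousLinearMap.le_opNorm _ _).trans_eq ?_
          rw [LinearIsometryEquiv.norm_map]
      _ = ENNReal.ofReal ((1 / Cb * ‖v‖) ^ 2)
          * ∫⁻ z, ‖powHess p (G z) x y - powHess p g x y‖ₑ ^ 2 ∂Dg :=
          lintegral_const_mul' _ _ ENNReal.ofReal_ne_top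
      _ ≤ ENNReal.ofReal ((1 / Cb * ‖v‖) ^ 2) * ENNReal.ofReal (σg₂ ^ 2) := by
          gcongr; exact hO.powHess_var x y
      _ = _ := by
          rw [← ENNReal.ofReal_mul (by positivity)]; congr 1; ring
  have := lintegral_enorm_add_sq_le hN hN0 hNv (M v)
  simp only [N, add_sub_cancel] at this
  refine this.trans ?_
  rw [enorm_sq_eq_ofReal, ← ENNReal.ofReal_mul (by positivity), ← mul_pow]
  exact ENNReal.ofReal_le_ofReal (norm_neumannFactor_apply_sq_le hg hμ h x y v)

end Estimator

section Estimator

variable {dx dy : ℕ} {p μ L₀ L₁ lg₁ lg₂ C lf₀ lf₁ Δ σf σg₁ σg₂ Cb : ℝ}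
  {f g : Vec dx → Vec dy → ℝ} {x₀ : Vec dx}
variable {Ξ Z : Type*} [MeasurableSpace Ξ] [MeasurableSpace Z]
  {F : Ξ → Vec dx → Vec dy → ℝ} {G : Z → Vec dx → Vec dy → ℝ} {Df : Measure Ξ} {Dg : Measure Z}
variable [IsProbabilityMeasure Dg]

lemma Oracle.integrable_neumann (hO : Oracle p σf σg₁ σg₂ f g F G Df Dg) (Q : ℕ)
    (x : Vec dx) (y : Vec dy) :
    Integrable (neumann p Cb Q G x y) (Measure.infinitePi fun _ : ℕ × ℕ => Dg) := by
  have h := integrable_finsetSum (Finset.range Q)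
    (f := fun q => sampleProd (fun z => neumannFactor p Cb (G z) x y) q q)
    fun q _ => integrable_sampleProd (hO.measurable_neumannFactor_sample (Cb := Cb) x y)
      (hO.integrable_neumannFactor x y) q q
  have e : neumann p Cb Q G x y = (1 / Cb) • fun ζ => ∑ q ∈ Finset.range Q,
      sampleProd (fun z => neumannFactor p Cb (G z) x y) q q ζ :=
    funext fun ζ => by rw [neumann_eq, Pi.smul_apply]
  rw [e]
  exact h.smul (1 / Cb)

lemma Oracle.integral_neumann (hO : Oracle p σf σg₁ σg₂ f g F G Df Dg) (Q : ℕ)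
    (x : Vec dx) (y : Vec dy) :
    ∫ ζ, neumann p Cb Q G x y ζ ∂(Measure.infinitePi fun _ : ℕ × ℕ => Dg)
      = neumannMean p Cb Q g x y := by
  simp only [neumann_eq]
  rw [integral_smul, integral_finsetSum _ fun q _ =>
    integrable_sampleProd (hO.measurable_neumannFactor_sample x y)
    (hO.integrable_neumannFactor x y) q q]
  simp only [integral_sampleProd (hO.measurable_neumannFactor_sample x y)
    (hO.integrable_neumannFactor x y), hO.integral_neumannFactor]
  rfl

/-- The second moment of the Neumann series estimator is bounded independently of its length. -/
lemma Oracle.lintegral_neumann_sq_le (hO : Oracle p σf σg₁ σg₂ f g F G Df Dg)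
    (hg : LowerLevel p μ L₀ L₁ lg₁ lg₂ C g) (hμ : 0 < μ) (h : HessBound μ C σg₂ Cb)
    (Q : ℕ) (x : Vec dx) (y v : Vec dy) :
    ∫⁻ ζ, ‖neumann p Cb Q G x y ζ v‖ₑ ^ 2 ∂(Measure.infinitePi fun _ : ℕ × ℕ => Dg)
      ≤ ENNReal.ofReal ((2 / μ) ^ 2) * ‖v‖ₑ ^ 2 := by
  have h2 := h.ge_two_mul
  have hC : 0 < Cb := by linarith
  set s := contr μ Cb with hs
  have s0 : 0 < s := contr_pos hμ h
  set a : ℕ → (ℕ × ℕ → Z) → Vec dy :=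
    fun q ζ => sampleProd (fun z => neumannFactor p Cb (G z) x y) q q ζ v with ha
  set S := ∑ q ∈ Finset.range Q, s ^ q with hS
  have hS0 : 0 ≤ S := Finset.sum_nonneg fun _ _ => by positivity
  have hSle : 1 / Cb * S ≤ 2 / μ := sum_contr_le hμ h Q
  have hm : ∀ q, Measurable fun ζ => ‖a q ζ‖ₑ ^ 2 := fun q =>
    (measurable_clm_apply (measurable_sampleProd' (hO.measurable_neumannFactor_sample x y) q q)
      measurable_const).enorm.pow_const 2
  have hq : ∀ q, ∫⁻ ζ, ‖a q ζ‖ₑ ^ 2 ∂(Measure.infinitePi fun _ : ℕ × ℕ => Dg)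
      ≤ ENNReal.ofReal (s ^ (2 * q)) * ‖v‖ₑ ^ 2 := by
    intro q
    have := lintegral_sampleProd_sq_le (μ := Dg) (hO.measurable_neumannFactor_sample x y)
      (fun v => hO.lintegral_neumannFactor_sq_le hg hμ h x y v) q q v
    rwa [← ENNReal.ofReal_pow (by positivity), ← pow_mul] at this
  -- Cauchy–Schwarz with the weights `s ^ q`
  have hpt : ∀ ζ, ‖neumann p Cb Q G x y ζ v‖ₑ ^ 2
      ≤ ENNReal.ofReal ((1 / Cb) ^ 2 * S)
        * ∑ q ∈ Finset.range Q, ENNReal.ofReal ((s ^ q)⁻¹) * ‖a q ζ‖ₑ ^ 2 := by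
    intro ζ
    have e : neumann p Cb Q G x y ζ v = (1 / Cb) • ∑ q ∈ Finset.range Q, a q ζ := by
      simp [neumann_eq, ha]
    have h1 : ‖neumann p Cb Q G x y ζ v‖ ^ 2
        ≤ (1 / Cb) ^ 2 * S * ∑ q ∈ Finset.range Q, (s ^ q)⁻¹ * ‖a q ζ‖ ^ 2 := by
      rw [e, norm_smul, mul_pow, Real.norm_of_nonneg (by positivity), mul_assoc]
      gcongr
      have h3 := Finset.sum_sq_le_sum_mul_sum_of_sq_le_mul (Finset.range Q)
        (r := fun q => ‖a q ζ‖) (f := fun q => s ^ q) (g := fun q => (s ^ q)⁻¹ * ‖a q ζ‖ ^ 2)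
        (fun q _ => by positivity) (fun q _ => by positivity)
        (fun q _ => (by field_simp : _ = _).le)
      refine le_trans ?_ h3
      gcongr
      exact norm_sum_le _ _
    simp only [enorm_sq_eq_ofReal]
    have e3 : ∀ q, ENNReal.ofReal ((s ^ q)⁻¹) * ENNReal.ofReal (‖a q ζ‖ ^ 2)
        = ENNReal.ofReal ((s ^ q)⁻¹ * ‖a q ζ‖ ^ 2) := fun q =>
      (ENNReal.ofReal_mul (by positivity)).symm
    simp only [e3]
    rw [← ENNReal.ofReal_sum_of_nonneg (fun q _ => by positivity),
      ← ENNReal.ofReal_mul (by positivity)]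
    exact ENNReal.ofReal_le_ofReal h1
  calc _ ≤ ∫⁻ ζ, ENNReal.ofReal ((1 / Cb) ^ 2 * S)
        * ∑ q ∈ Finset.range Q, ENNReal.ofReal ((s ^ q)⁻¹) * ‖a q ζ‖ₑ ^ 2
          ∂(Measure.infinitePi fun _ : ℕ × ℕ => Dg) := lintegral_mono hpt
    _ = ENNReal.ofReal ((1 / Cb) ^ 2 * S) * ∑ q ∈ Finset.range Q, ENNReal.ofReal ((s ^ q)⁻¹)
        * ∫⁻ ζ, ‖a q ζ‖ₑ ^ 2 ∂(Measure.infinitePi fun _ : ℕ × ℕ => Dg) := by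
        rw [lintegral_const_mul' _ _ ENNReal.ofReal_ne_top,
          lintegral_finsetSum _ fun q _ => (hm q).const_mul _]
        congr 1
        exact Finset.sum_congr rfl fun q _ => lintegral_const_mul _ (hm q)
    _ ≤ ENNReal.ofReal ((1 / Cb) ^ 2 * S) * ∑ q ∈ Finset.range Q, ENNReal.ofReal ((s ^ q)⁻¹)
        * (ENNReal.ofReal (s ^ (2 * q)) * ‖v‖ₑ ^ 2) := by
        gcongr with q _; exact hq q
    _ = ENNReal.ofReal ((1 / Cb * S) ^ 2) * ‖v‖ₑ ^ 2 := by
        have e4 : ∀ q, ENNReal.ofReal ((s ^ q)⁻¹) * (ENNReal.ofReal (s ^ (2 * q)) * ‖v‖ₑ ^ 2)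
            = ENNReal.ofReal (s ^ q) * ‖v‖ₑ ^ 2 := by
          intro q
          rw [← mul_assoc, ← ENNReal.ofReal_mul (by positivity)]
          congr 2
          rw [two_mul, pow_add]; field_simp
        simp only [e4]
        rw [← Finset.sum_mul, ← ENNReal.ofReal_sum_of_nonneg (fun q _ => by positivity), ← hS,
          ← mul_assoc, ← ENNReal.ofReal_mul (by positivity)]
        congr 2; ring
    _ ≤ _ := by gcongr

variable [IsProbabilityMeasure Df]

/-- A bound for the standard deviation of the stochastic hypergradient. -/
def hyperStd (μ lg₁ lf₀ σf σg₂ : ℝ) : ℝ :=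
  Real.sqrt (2 * σf ^ 2 + (8 * (lg₁ ^ 2 + σg₂ ^ 2) * (2 / μ) ^ 2 * (lf₀ ^ 2 + σf ^ 2)
    + 4 * (lg₁ * (2 / μ * lf₀)) ^ 2))

lemma Oracle.integrable_hyperGradEst (hO : Oracle p σf σg₁ σg₂ f g F G Df Dg)
    (Q : ℕ) (x : Vec dx) (y : Vec dy) :
    Integrable (hyperGradEst p Cb Q F G x y) (upperSampleLaw Df Dg) ∧
    ∫ s, hyperGradEst p Cb Q F G x y s ∂(upperSampleLaw Df Dg) = hyperGradMean p Cb Q f g x y := by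
  have mΞ : Measurable fun ξ : Ξ => (ξ, x, y) := measurable_id.prodMk measurable_const
  have mZ : Measurable fun ζ : Z => (ζ, x, y) := measurable_id.prodMk measurable_const
  have mN : Measurable fun ζ : ℕ × ℕ → Z => ((x, y), ζ) := measurable_const.prodMk measurable_id
  have hb := hO.powGrad_meas.comp mΞ
  have hB := hO.crossXY_meas.comp mZ
  have hN := (hO.measurable_neumann (Cb := Cb) Q).comp mN
  simp only [Function.comp_def] at hb hB hN
  have i1 : Integrable (fun s : UpperSample Ξ Z => gradX (F s.1) x y) (upperSampleLaw Df Dg) :=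
    (hO.gradX_integrable x y).comp_fst _
  have i2 := integrable_triple hb hB hN (hO.powGrad_integrable x y) (hO.crossXY_integrable x y)
    (hO.integrable_neumann (Cb := Cb) Q x y)
  refine ⟨i1.sub i2, ?_⟩
  unfold hyperGradEst
  rw [integral_sub i1 i2]
  unfold upperSampleLaw
  rw [integral_triple hb hB hN (hO.powGrad_integrable x y) (hO.crossXY_integrable x y)
    (hO.integrable_neumann (Cb := Cb) Q x y), hO.crossXY_mean, hO.integral_neumann, hO.powGrad_mean]
  have e : ∫ s : UpperSample Ξ Z, gradX (F s.1) x y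
      ∂(Df.prod (Dg.prod (Measure.infinitePi fun _ : ℕ × ℕ => Dg))) = gradX f x y := by
    rw [← hO.gradX_mean x y]
    have := integral_fun_fst (μ := Df)
      (ν := Dg.prod (Measure.infinitePi fun _ : ℕ × ℕ => Dg)) (fun ξ => gradX (F ξ) x y)
    simpa using this
  rw [e]
  rfl

/-- The variance of the stochastic hypergradient is bounded uniformly in the length `Q` of the
Neumann series. -/
lemma Oracle.lintegral_hyperGradEst_sub_sq_le (hO : Oracle p σf σg₁ σg₂ f g F G Df Dg)
    (hg : LowerLevel p μ L₀ L₁ lg₁ lg₂ C g) (hf : UpperLevel p lf₀ lf₁ Δ f g x₀) (hμ : 0 < μ)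
    (hlg₁ : 0 ≤ lg₁) (h : HessBound μ C σg₂ Cb) (Q : ℕ) (x : Vec dx) (y : Vec dy) :
    ∫⁻ s, ‖hyperGradEst p Cb Q F G x y s - hyperGradMean p Cb Q f g x y‖ₑ ^ 2
        ∂(upperSampleLaw Df Dg)
      ≤ ENNReal.ofReal (hyperStd μ lg₁ lf₀ σf σg₂ ^ 2) := by
  have mΞ : Measurable fun ξ : Ξ => (ξ, x, y) := measurable_id.prodMk measurable_const
  have mZ : Measurable fun ζ : Z => (ζ, x, y) := measurable_id.prodMk measurable_const
  have mN : Measurable fun ζ : ℕ × ℕ → Z => ((x, y), ζ) := measurable_const.prodMk measurable_id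
  have hb := hO.powGrad_meas.comp mΞ
  have hB := hO.crossXY_meas.comp mZ
  have hN := (hO.measurable_neumann (Cb := Cb) Q).comp mN
  simp only [Function.comp_def] at hb hB hN
  have ha := hO.gradX_meas.comp mΞ
  simp only [Function.comp_def] at ha
  have e2 : (2 : ENNReal) = ENNReal.ofReal 2 := by simp
  have kb : ∫⁻ ξ, ‖powGrad p (F ξ) x y‖ₑ ^ 2 ∂Df ≤ ENNReal.ofReal (lf₀ ^ 2 + σf ^ 2) := by
    have hN0 : ∫ ξ, (powGrad p (F ξ) x y - powGrad p f x y) ∂Df = 0 := by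
      rw [integral_sub (hO.powGrad_integrable x y) (integrable_const _), hO.powGrad_mean]
      simp
    have := lintegral_enorm_add_sq_le
      ((hO.powGrad_integrable x y).sub (integrable_const (powGrad p f x y))) hN0
      (hO.powGrad_var x y) (powGrad p f x y)
    simp only [Pi.sub_apply, add_sub_cancel] at this
    refine this.trans (ENNReal.ofReal_le_ofReal ?_)
    have := hf.powGrad_le x y
    gcongr
  have kB : ∫⁻ ζ, ‖crossXY (G ζ) x y‖ₑ ^ 2 ∂Dg ≤ ENNReal.ofReal (2 * (lg₁ ^ 2 + σg₂ ^ 2)) := by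
    calc _ ≤ ∫⁻ ζ, (2 * ‖crossXY (G ζ) x y - crossXY g x y‖ₑ ^ 2
          + 2 * ‖crossXY g x y‖ₑ ^ 2) ∂Dg := by
          refine lintegral_mono fun ζ => ?_
          have := enorm_add_sq_le (crossXY (G ζ) x y - crossXY g x y) (crossXY g x y)
          rwa [sub_add_cancel] at this
      _ = 2 * ∫⁻ ζ, ‖crossXY (G ζ) x y - crossXY g x y‖ₑ ^ 2 ∂Dg + 2 * ‖crossXY g x y‖ₑ ^ 2 := by
          rw [lintegral_add_right _ measurable_const, lintegral_const_mul' _ _ (by simp)]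
          simp
      _ ≤ 2 * ENNReal.ofReal (σg₂ ^ 2) + 2 * ENNReal.ofReal (lg₁ ^ 2) := by
          gcongr
          · exact hO.crossXY_var x y
          · rw [enorm_sq_eq_ofReal]
            refine ENNReal.ofReal_le_ofReal ?_
            have := hg.norm_crossXY_le hlg₁ x y
            gcongr
      _ = _ := by
          rw [e2, ← ENNReal.ofReal_mul (by norm_num), ← ENNReal.ofReal_mul (by norm_num),
            ← ENNReal.ofReal_add (by positivity) (by positivity)]
          congr 1; ring
  have k3 := lintegral_triple_sq_le (μ₁ := Df) (μ₂ := Dg) hb hB hN kb kB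
    (fun v => hO.lintegral_neumann_sq_le hg hμ h Q x y v)
  set w₀ := crossXY g x y (neumannMean p Cb Q g x y (powGrad p f x y)) with hw₀
  have hw₀n : ‖w₀‖ ≤ lg₁ * (2 / μ * lf₀) := by
    refine (ContinuousLinearMap.le_opNorm _ _).trans ?_
    gcongr
    · exact hg.norm_crossXY_le hlg₁ x y
    · exact (norm_neumannMean_apply_le hg hμ h x y _ Q).trans (by gcongr; exact hf.powGrad_le x y)
  have hvar : ∫⁻ s : UpperSample Ξ Z, ‖gradX (F s.1) x y - gradX f x y‖ₑ ^ 2 ∂(upperSampleLaw Df Dg)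
      ≤ ENNReal.ofReal (σf ^ 2) := by
    refine le_trans (le_of_eq ?_) (hO.gradX_var x y)
    unfold upperSampleLaw
    have hm : Measurable fun ξ => ‖gradX (F ξ) x y - gradX f x y‖ₑ ^ 2 :=
      (ha.sub measurable_const).enorm.pow_const 2
    have hm' : Measurable fun s : UpperSample Ξ Z => ‖gradX (F s.1) x y - gradX f x y‖ₑ ^ 2 :=
      hm.comp measurable_fst
    rw [lintegral_prod _ hm'.aemeasurable]
    simp
  have hmT := measurable_triple hb hB hN
  calc _ ≤ ∫⁻ s : UpperSample Ξ Z, (2 * ‖gradX (F s.1) x y - gradX f x y‖ₑ ^ 2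
        + (4 * ‖crossXY (G s.2.1) x y (neumann p Cb Q G x y s.2.2 (powGrad p (F s.1) x y))‖ₑ ^ 2
          + 4 * ‖w₀‖ₑ ^ 2)) ∂(upperSampleLaw Df Dg) := by
        refine lintegral_mono fun s => ?_
        set w := crossXY (G s.2.1) x y (neumann p Cb Q G x y s.2.2 (powGrad p (F s.1) x y))
        have e : hyperGradEst p Cb Q F G x y s - hyperGradMean p Cb Q f g x y
            = (gradX (F s.1) x y - gradX f x y) - (w - w₀) := by
          simp only [hyperGradEst, hyperGradMean, w, hw₀]; abel
        rw [e]
        refine (enorm_sub_sq_le _ _).trans ?_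
        have := enorm_sub_sq_le w w₀
        calc _ ≤ 2 * ‖gradX (F s.1) x y - gradX f x y‖ₑ ^ 2
              + 2 * (2 * ‖w‖ₑ ^ 2 + 2 * ‖w₀‖ₑ ^ 2) := by gcongr
          _ = _ := by ring
    _ = 2 * ∫⁻ s : UpperSample Ξ Z, ‖gradX (F s.1) x y - gradX f x y‖ₑ ^ 2 ∂(upperSampleLaw Df Dg)
        + (4 * ∫⁻ s : UpperSample Ξ Z, ‖crossXY (G s.2.1) x y (neumann p Cb Q G x y s.2.2
            (powGrad p (F s.1) x y))‖ₑ ^ 2 ∂(upperSampleLaw Df Dg) + 4 * ‖w₀‖ₑ ^ 2) := by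
        have hm4 : Measurable fun s : UpperSample Ξ Z => 4 * ‖crossXY (G s.2.1) x y
            (neumann p Cb Q G x y s.2.2 (powGrad p (F s.1) x y))‖ₑ ^ 2 + 4 * ‖w₀‖ₑ ^ 2 :=
          ((hmT.enorm.pow_const 2).const_mul 4).add measurable_const
        rw [lintegral_add_right _ hm4,
          lintegral_add_right _ measurable_const, lintegral_const_mul' _ _ (by simp),
          lintegral_const_mul' _ _ (by simp)]
        simp
    _ ≤ 2 * ENNReal.ofReal (σf ^ 2)
        + (4 * (ENNReal.ofReal (2 * (lg₁ ^ 2 + σg₂ ^ 2)) * ENNReal.ofReal ((2 / μ) ^ 2)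
          * ENNReal.ofReal (lf₀ ^ 2 + σf ^ 2))
          + 4 * ENNReal.ofReal ((lg₁ * (2 / μ * lf₀)) ^ 2)) := by
        gcongr
        · exact k3
        · rw [enorm_sq_eq_ofReal]
          exact ENNReal.ofReal_le_ofReal (by gcongr)
    _ = _ := by
        have e4 : (4 : ENNReal) = ENNReal.ofReal 4 := by simp
        rw [hyperStd, Real.sq_sqrt (by positivity), e2, e4]
        rw [← ENNReal.ofReal_mul (by norm_num), ← ENNReal.ofReal_mul (by positivity),
          ← ENNReal.ofReal_mul (by positivity), ← ENNReal.ofReal_mul (by norm_num),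
          ← ENNReal.ofReal_mul (by norm_num), ← ENNReal.ofReal_add (by positivity) (by positivity),
          ← ENNReal.ofReal_add (by positivity) (by positivity)]
        congr 1; ring

end Estimator

/-! ### Projected SGD on a ball -/

section BallSGD

variable {d : ℕ} {Z : Type*}

lemma norm_ballProj_sub_le {c : Vec d} {D : ℝ} (hD : 0 ≤ D) (v : Vec d) :
    ‖ballProj c D v - c‖ ≤ D := by
  unfold ballProj
  split_ifs with h
  · exact h
  · push Not at h
    have hpos : 0 < ‖v - c‖ := hD.trans_lt h
    rw [add_sub_cancel_left, norm_smul, Real.norm_of_nonneg (by positivity),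
      div_mul_cancel₀ _ hpos.ne']

/-- Projecting onto a ball does not increase the distance to the points of the ball. -/
lemma norm_ballProj_sub_le_of_mem {c u : Vec d} {D : ℝ} (hu : ‖u - c‖ ≤ D) (v : Vec d) :
    ‖ballProj c D v - u‖ ≤ ‖v - u‖ := by
  have hD : 0 ≤ D := (norm_nonneg _).trans hu
  unfold ballProj
  split_ifs with h
  · exact le_rfl
  · push Not at h
    set a := v - c with ha
    set b := u - c with hb
    have hpos : 0 < ‖a‖ := hD.trans_lt h
    set t := D / ‖a‖ with ht
    have ht0 : 0 ≤ t := by positivity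
    have ht1 : t ≤ 1 := (div_le_one hpos).mpr h.le
    have htD : t * ‖a‖ = D := div_mul_cancel₀ _ hpos.ne'
    have e1 : c + t • a - u = t • a - b := by rw [hb]; abel
    have e2 : v - u = a - b := by rw [ha, hb]; abel
    rw [e1, e2]
    refine le_of_sq_le_sq ?_ (norm_nonneg _)
    rw [norm_sub_sq_real (t • a) b, norm_sub_sq_real a b, inner_smul_left, norm_smul, mul_pow,
      Real.norm_of_nonneg ht0]
    have h1 : inner ℝ a b ≤ ‖a‖ * D := (real_inner_le_norm a b).trans (by gcongr)
    have h2 : inner ℝ a b ≤ t * ‖a‖ ^ 2 := by rw [← htD] at h1; linarith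
    simp only [conj_trivial]
    nlinarith [mul_le_mul_of_nonneg_left h2 (sub_nonneg.mpr ht1),
      mul_nonneg (sub_nonneg.mpr ht1) (mul_nonneg (sub_nonneg.mpr ht1) (sq_nonneg ‖a‖))]

lemma measurable_ballProj (D : ℝ) : Measurable fun q : Vec d × Vec d => ballProj q.1 D q.2 := by
  unfold ballProj
  refine Measurable.ite ?_ measurable_snd ?_
  · exact measurableSet_le (measurable_snd.sub measurable_fst).norm measurable_const
  · exact measurable_fst.add
      (((measurable_snd.sub measurable_fst).norm.const_div D).smul
        (measurable_snd.sub measurable_fst))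

lemma norm_ballSGD_sub_le (grad : Vec d → Z → Vec d) (c : Vec d) {D : ℝ} (hD : 0 ≤ D) (γ : ℝ)
    (s : ℕ → Z) (i : ℕ) : ‖ballSGD grad c D γ s i - c‖ ≤ D := by
  cases i with
  | zero => simpa [ballSGD] using hD
  | succ i => exact norm_ballProj_sub_le hD _

lemma ballSGD_congr (grad : Vec d → Z → Vec d) (c : Vec d) (D γ : ℝ) {s s' : ℕ → Z} {n : ℕ}
    (h : ∀ i < n, s i = s' i) : ballSGD grad c D γ s n = ballSGD grad c D γ s' n := by
  induction n with
  | zero => rfl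
  | succ n ih =>
    rw [ballSGD, ballSGD, ih fun i hi => h i (by omega), h n (by omega)]

/-- The regret bound of projected SGD. -/
lemma ballSGD_regret (grad : Vec d → Z → Vec d) (c u : Vec d) {D γ : ℝ} (hu : ‖c - u‖ ≤ D)
    (s : ℕ → Z) (n : ℕ) :
    ‖ballSGD grad c D γ s n - u‖ ^ 2 + 2 * γ * ∑ i ∈ Finset.range n,
        inner ℝ (grad (ballSGD grad c D γ s i) (s i)) (ballSGD grad c D γ s i - u)
      ≤ D ^ 2 + γ ^ 2 * ∑ i ∈ Finset.range n, ‖grad (ballSGD grad c D γ s i) (s i)‖ ^ 2 := by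
  induction n with
  | zero => simp only [Finset.range_zero, Finset.sum_empty, mul_zero, add_zero, ballSGD]; gcongr
  | succ n ih =>
    rw [Finset.sum_range_succ, Finset.sum_range_succ]
    set w := ballSGD grad c D γ s n with hw
    set q := grad w (s n) with hq
    have h1 : ‖ballSGD grad c D γ s (n + 1) - u‖ ≤ ‖w - γ • q - u‖ :=
      norm_ballProj_sub_le_of_mem (by rwa [norm_sub_rev]) _
    have h2 : ‖w - γ • q - u‖ ^ 2 = ‖w - u‖ ^ 2 - 2 * γ * inner ℝ q (w - u) + γ ^ 2 * ‖q‖ ^ 2 := by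
      have : w - γ • q - u = (w - u) - γ • q := by abel
      rw [this, norm_sub_sq_real, inner_smul_right, norm_smul, mul_pow, Real.norm_eq_abs, sq_abs,
        real_inner_comm]
      ring
    have h3 : ‖ballSGD grad c D γ s (n + 1) - u‖ ^ 2 ≤ ‖w - γ • q - u‖ ^ 2 := by gcongr
    linarith

end BallSGD

section EpochLengths

variable {p : ℝ} {T₁ : ℕ}

lemma le_epochLen (k : ℕ) : (T₁ : ℝ) * 2 ^ (2 * (p - 1) / p * (k : ℝ)) ≤ epochLen p T₁ k :=
  Nat.le_ceil _

lemma epochLen_pos (hT : 1 ≤ T₁) (k : ℕ) : 0 < epochLen p T₁ k := by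
  unfold epochLen
  rw [Nat.ceil_pos]
  have : (0 : ℝ) < T₁ := by exact_mod_cast hT
  positivity

/-- A budget of exactly `m` epochs is used up by `m` epochs. -/
lemma numEpochs_sum (hT : 1 ≤ T₁) (m : ℕ) :
    numEpochs p T₁ (∑ k ∈ Finset.range m, epochLen p T₁ k) = m := by
  set S : ℕ → ℕ := fun m => ∑ k ∈ Finset.range m, epochLen p T₁ k with hS
  have hmono : StrictMono S := strictMono_nat_of_lt_succ fun m => by
    simp only [hS, Finset.sum_range_succ]
    exact Nat.lt_add_of_pos_right (epochLen_pos hT m)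
  change Nat.findGreatest (fun k => S k ≤ S m) (S m) = m
  refine le_antisymm ?_ ?_
  · have h := Nat.findGreatest_spec (P := fun k => S k ≤ S m) (Nat.zero_le (S m))
      (by simp [hS])
    exact hmono.le_iff_le.mp h
  · exact Nat.le_findGreatest (hmono.id_le m) le_rfl

/-- The budget of `m` epochs is dominated by the last epoch. -/
lemma sum_epochLen_le (hp : 2 ≤ p) (hT : 1 ≤ T₁) (m : ℕ) :
    ((∑ k ∈ Finset.range m, epochLen p T₁ k : ℕ) : ℝ)
      ≤ 2 * T₁ * 2 ^ (2 * (p - 1) / p * (m : ℝ)) := by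
  set τ := 2 * (p - 1) / p with hτ
  have hp0 : 0 < p := by linarith
  have hτ1 : 1 ≤ τ := by rw [hτ, le_div_iff₀ hp0]; linarith
  have hT' : (1 : ℝ) ≤ T₁ := by exact_mod_cast hT
  have hpow : ∀ k : ℕ, (1 : ℝ) ≤ 2 ^ (τ * (k : ℝ)) := fun k =>
    Real.one_le_rpow (by norm_num) (by positivity)
  induction m with
  | zero => simp
  | succ m ih =>
    rw [Finset.sum_range_succ, Nat.cast_add]
    have h1 : (epochLen p T₁ m : ℝ) ≤ 2 * T₁ * 2 ^ (τ * (m : ℝ)) := by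
      have h2 : (epochLen p T₁ m : ℝ) < T₁ * 2 ^ (τ * (m : ℝ)) + 1 :=
        Nat.ceil_lt_add_one (by positivity)
      have h3 : (1 : ℝ) ≤ T₁ * 2 ^ (τ * (m : ℝ)) := one_le_mul_of_one_le_of_one_le hT' (hpow m)
      linarith
    have h4 : (2 : ℝ) * 2 ^ (τ * (m : ℝ)) ≤ 2 ^ (τ * ((m + 1 : ℕ) : ℝ)) := by
      have : τ * ((m + 1 : ℕ) : ℝ) = τ * m + τ := by push_cast; ring
      rw [this, Real.rpow_add (by norm_num), mul_comm]
      gcongr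
      calc (2 : ℝ) = 2 ^ (1 : ℝ) := by simp
        _ ≤ 2 ^ τ := Real.rpow_le_rpow_of_exponent_le (by norm_num) hτ1
    have h5 : 2 * (T₁ : ℝ) * (2 * 2 ^ (τ * (m : ℝ))) ≤ 2 * T₁ * 2 ^ (τ * ((m + 1 : ℕ) : ℝ)) := by
      gcongr
    linarith

end EpochLengths

/-! ### One epoch of Epoch-SGD -/

section Epoch

variable {dx dy : ℕ} {p μ L₀ L₁ lg₁ lg₂ C : ℝ} {g : Vec dx → Vec dy → ℝ} {Z : Type*}
  {G : Z → Vec dx → Vec dy → ℝ}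

/-- The contribution of the gradient noise in step `i` of projected SGD to the regret. -/
def noiseTerm (g : Vec dx → Vec dy → ℝ) (G : Z → Vec dx → Vec dy → ℝ) (γ : ℝ) (x : Vec dx)
    (u : Vec dy) (ζ : Z) : ℝ :=
  -inner ℝ (gradY (G ζ) x u - gradY g x u) (u - lowerSol g x)
    + γ * ‖gradY (G ζ) x u - gradY g x u‖ ^ 2

/-- The suboptimality of the averaged iterate of projected SGD, up to the noise. -/
lemma LowerLevel.avg_ballSGD_le (hg : LowerLevel p μ L₀ L₁ lg₁ lg₂ C g) (hp : 2 ≤ p) (hμ : 0 < μ)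
    {D γ Gd : ℝ} (hγ : 0 < γ) (x : Vec dx) {w : Vec dy}
    (hw : ‖w - lowerSol g x‖ ≤ D)
    (hGd : ∀ u, ‖u - lowerSol g x‖ ≤ 2 * D → ‖gradY g x u‖ ≤ Gd) (s : ℕ → Z) {n : ℕ} (hn : 0 < n) :
    let u := ballSGD (fun w ζ => gradY (G ζ) x w) w D γ s
    n * (μ / p * ‖(1 / (n : ℝ)) • ∑ i ∈ Finset.range n, u i - lowerSol g x‖ ^ p)
      ≤ D ^ 2 / (2 * γ) + γ * n * Gd ^ 2
        + ∑ i ∈ Finset.range n, noiseTerm g G γ x (u i) (s i) := by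
  intro u
  set ys := lowerSol g x with hys
  have hD : 0 ≤ D := (norm_nonneg _).trans hw
  have hn' : (0 : ℝ) < n := by exact_mod_cast hn
  have hreg := ballSGD_regret (fun w ζ => gradY (G ζ) x w) w ys (γ := γ) hw s n
  change ‖u n - ys‖ ^ 2 + 2 * γ * ∑ i ∈ Finset.range n, inner ℝ (gradY (G (s i)) x (u i)) (u i - ys)
    ≤ D ^ 2 + γ ^ 2 * ∑ i ∈ Finset.range n, ‖gradY (G (s i)) x (u i)‖ ^ 2 at hreg
  have hstep : ∀ i ∈ Finset.range n, g x (u i) - g x ys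
      ≤ inner ℝ (gradY (G (s i)) x (u i)) (u i - ys)
        - γ / 2 * ‖gradY (G (s i)) x (u i)‖ ^ 2 + (γ * Gd ^ 2 + noiseTerm g G γ x (u i) (s i)) := by
    intro i _
    have h1 := hg.sub_le_inner hp hμ x (u i) ys
    have h2 : ‖u i - ys‖ ≤ 2 * D := by
      have h3 : ‖u i - w‖ ≤ D := norm_ballSGD_sub_le _ w hD γ s i
      calc ‖u i - ys‖ = ‖(u i - w) + (w - ys)‖ := by congr 1; abel
        _ ≤ 2 * D := (norm_add_le _ _).trans (by linarith)
    have h4 : ‖gradY g x (u i)‖ ^ 2 ≤ Gd ^ 2 := by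
      have := hGd _ h2
      gcongr
    set N := gradY (G (s i)) x (u i) - gradY g x (u i) with hN
    have h5 : gradY (G (s i)) x (u i) = gradY g x (u i) + N := by rw [hN]; abel
    have h6 : ‖gradY (G (s i)) x (u i)‖ ^ 2 ≤ 2 * ‖gradY g x (u i)‖ ^ 2 + 2 * ‖N‖ ^ 2 := by
      rw [h5]
      have := norm_add_le (gradY g x (u i)) N
      nlinarith [sq_nonneg (‖gradY g x (u i)‖ - ‖N‖), norm_nonneg (gradY g x (u i) + N),
        norm_nonneg N, norm_nonneg (gradY g x (u i))]
    have h7 : inner ℝ (gradY (G (s i)) x (u i)) (u i - ys)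
        = inner ℝ (gradY g x (u i)) (u i - ys) + inner ℝ N (u i - ys) := by
      rw [h5, inner_add_left]
    unfold noiseTerm
    rw [← hN, ← hys, h7]
    nlinarith [mul_le_mul_of_nonneg_left h6 hγ.le, mul_le_mul_of_nonneg_left h4 hγ.le]
  have hsum := Finset.sum_le_sum hstep
  simp only [Finset.sum_sub_distrib, Finset.sum_add_distrib, Finset.sum_const, Finset.card_range,
    nsmul_eq_mul, ← Finset.mul_sum] at hsum
  -- Jensen's inequality for the averaged iterate
  have hjensen : n * g x ((1 / (n : ℝ)) • ∑ i ∈ Finset.range n, u i)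
      ≤ ∑ i ∈ Finset.range n, g x (u i) := by
    have h := (hg.convexOn hp hμ x).map_sum_le (t := Finset.range n) (w := fun _ => 1 / (n : ℝ))
      (p := u) (fun _ _ => by positivity) (by simp [hn'.ne']) (fun _ _ => Set.mem_univ _)
    rw [← Finset.smul_sum, ← Finset.smul_sum, smul_eq_mul] at h
    calc _ ≤ n * (1 / (n : ℝ) * ∑ i ∈ Finset.range n, g x (u i)) := by gcongr
      _ = _ := by field_simp
  have hgrow := hg.growth hp hμ x ((1 / (n : ℝ)) • ∑ i ∈ Finset.range n, u i)
  rw [← hys] at hgrow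
  have h8 : ∑ i ∈ Finset.range n, inner ℝ (gradY (G (s i)) x (u i)) (u i - ys)
      - γ / 2 * ∑ i ∈ Finset.range n, ‖gradY (G (s i)) x (u i)‖ ^ 2 ≤ D ^ 2 / (2 * γ) := by
    rw [le_div_iff₀ (by positivity)]
    nlinarith [sq_nonneg ‖u n - ys‖]
  calc _ ≤ n * (g x ((1 / (n : ℝ)) • ∑ i ∈ Finset.range n, u i) - g x ys) := by gcongr
    _ ≤ ∑ i ∈ Finset.range n, g x (u i) - n * g x ys := by linarith
    _ ≤ _ := by linarith

end Epoch

section Concentration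

variable {dx dy : ℕ} {p μ L₀ L₁ lg₁ lg₂ C σf σg₁ σg₂ : ℝ} {f g : Vec dx → Vec dy → ℝ}
  {Ξ Z : Type*} [MeasurableSpace Ξ] [MeasurableSpace Z]
  {F : Ξ → Vec dx → Vec dy → ℝ} {G : Z → Vec dx → Vec dy → ℝ} {Df : Measure Ξ} {Dg : Measure Z}

lemma LowerLevel.continuous_gradY (hg : LowerLevel p μ L₀ L₁ lg₁ lg₂ C g) :
    Continuous fun q : Vec dx × Vec dy => gradY g q.1 q.2 := by
  rw [continuous_iff_continuousAt]
  intro q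
  rw [ContinuousAt, tendsto_iff_norm_sub_tendsto_zero]
  have hlim : Filter.Tendsto (fun r : Vec dx × Vec dy =>
      lg₁ * ‖r.1 - q.1‖ + ‖gradY g q.1 r.2 - gradY g q.1 q.2‖) (nhds q) (nhds 0) := by
    have h1 : Continuous fun y => gradY g q.1 y := (hg.diff_yy q.1).continuous
    have : Continuous fun r : Vec dx × Vec dy =>
        lg₁ * ‖r.1 - q.1‖ + ‖gradY g q.1 r.2 - gradY g q.1 q.2‖ := by fun_prop
    simpa using this.tendsto q
  refine squeeze_zero (fun _ => norm_nonneg _) (fun r => ?_) hlim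
  have e : gradY g r.1 r.2 - gradY g q.1 q.2
      = (gradY g r.1 r.2 - gradY g q.1 r.2) + (gradY g q.1 r.2 - gradY g q.1 q.2) := by abel
  rw [e]
  exact (norm_add_le _ _).trans (add_le_add_left (hg.gradY_lipschitz _ _ _) _)

lemma Oracle.measurable_ballSGD (hO : Oracle p σf σg₁ σg₂ f g F G Df Dg) {Ω : Type*}
    [MeasurableSpace Ω] {x : Ω → Vec dx} {w : Ω → Vec dy} {ζ : Ω → ℕ → Z} (hx : Measurable x)
    (hw : Measurable w) (hζ : ∀ i, Measurable fun s => ζ s i) (D γ : ℝ) (i : ℕ) :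
    Measurable fun s => ballSGD (fun w ζ => gradY (G ζ) (x s) w) (w s) D γ (ζ s) i := by
  induction i with
  | zero => exact hw
  | succ i ih =>
    have h1 := hO.gradY_meas.comp ((hζ i).prodMk (hx.prodMk ih))
    have h2 := (measurable_ballProj D).comp (hw.prodMk (ih.sub (h1.const_smul γ)))
    exact h2

variable [IsProbabilityMeasure Dg]

/-- Concentration for projected SGD whose starting point and objective depend on samples other than
its own, i.e. other than those with index `(t, k, ·)`. -/
lemma Oracle.measure_noise_ge_le (hO : Oracle p σf σg₁ σg₂ f g F G Df Dg)
    (hg : LowerLevel p μ L₀ L₁ lg₁ lg₂ C g) (hp : 2 ≤ p) (hμ : 0 < μ) (hlg₁ : 0 ≤ lg₁)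
    (hσ : 0 < σg₁) (t k : ℕ) {x : (ℕ × ℕ × ℕ → Z) → Vec dx} {w : (ℕ × ℕ × ℕ → Z) → Vec dy}
    (hx : Measurable x) (hw : Measurable w)
    (hxu : ∀ s i z, x (Function.update s (t, k, i) z) = x s)
    (hwu : ∀ s i z, w (Function.update s (t, k, i) z) = w s)
    {D γ lam : ℝ} (hD : 0 ≤ D) (hγ : 0 ≤ γ) (hlam : 0 ≤ lam)
    (h₁ : 2 * lam * (2 * D) * σg₁ ≤ 1) (h₂ : 2 * lam * γ * σg₁ ^ 2 ≤ 1) (n : ℕ) (a : ℝ) :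
    lowerLaw Dg {s | ‖w s - lowerSol g (x s)‖ ≤ D ∧
        a ≤ ∑ i ∈ Finset.range n, noiseTerm g G γ (x s) (ballSGD (fun w ζ => gradY (G ζ) (x s) w)
          (w s) D γ (fun j => s (t, k, j)) i) (s (t, k, i))}
      ≤ ENNReal.ofReal (Real.exp (-(lam * a)
        + n * (4 * lam ^ 2 * (2 * D) ^ 2 * σg₁ ^ 2 + 2 * lam * γ * σg₁ ^ 2))) := by
  classical
  set c := 4 * lam ^ 2 * (2 * D) ^ 2 * σg₁ ^ 2 + 2 * lam * γ * σg₁ ^ 2 with hc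
  let U : ℕ → (ℕ × ℕ × ℕ → Z) → Vec dy := fun i s =>
    ballSGD (fun w ζ => gradY (G ζ) (x s) w) (w s) D γ (fun j => s (t, k, j)) i
  let X : ℕ → (ℕ × ℕ × ℕ → Z) → ℝ := fun i s => noiseTerm g G γ (x s) (U i s) (s (t, k, i))
  let A : Set (ℕ × ℕ × ℕ → Z) := {s | ‖w s - lowerSol g (x s)‖ ≤ D}
  -- Restricted to starting points within `D` of the solution, all iterates stay within `2 * D`,
  -- so that the moment bound for the noise applies to every factor.
  let V : ℕ → (ℕ × ℕ × ℕ → Z) → ENNReal := fun n => A.indicator fun s =>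
    ENNReal.ofReal (Real.exp (lam * ∑ i ∈ Finset.range n, X i s))
  have hys : Measurable fun s => lowerSol g (x s) :=
    (hg.continuous_lowerSol hp hμ hlg₁).measurable.comp hx
  have hA : MeasurableSet A := measurableSet_le (hw.sub hys).norm measurable_const
  have hU : ∀ i, Measurable (U i) := fun i =>
    hO.measurable_ballSGD hx hw (fun j => measurable_pi_apply (t, k, j)) D γ i
  have hX : ∀ i, Measurable (X i) := by
    intro i
    have h1 := hO.gradY_meas.comp ((measurable_pi_apply (t, k, i)).prodMk (hx.prodMk (hU i)))
    have h2 := hg.continuous_gradY.measurable.comp (hx.prodMk (hU i))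
    have h3 := h1.sub h2
    exact ((h3.inner ((hU i).sub hys)).neg).add ((h3.norm.pow_const 2).const_mul γ)
  have hV : ∀ i, Measurable (V i) := fun i =>
    ((((Finset.measurable_fun_sum (Finset.range i) fun j _ => hX j).const_mul
      lam).exp).ennreal_ofReal).indicator
      hA
  have hUu : ∀ s i z j, j ≤ i → U j (Function.update s (t, k, i) z) = U j s := by
    intro s i z j hj
    simp only [U, hxu, hwu]
    refine ballSGD_congr _ _ _ _ fun l hl => ?_
    rw [Function.update_of_ne]
    intro h
    have : l = i := by simpa using h
    omega
  have hXu : ∀ s i z j, j < i → X j (Function.update s (t, k, i) z) = X j s := by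
    intro s i z j hj
    simp only [X, hxu, hUu s i z j hj.le]
    rw [Function.update_of_ne]
    intro h
    have : j = i := by simpa using h
    omega
  have hAu : ∀ s i z, (Function.update s (t, k, i) z ∈ A ↔ s ∈ A) := by
    intro s i z
    simp only [A, Set.mem_ofPred_eq, hxu, hwu]
  have hstep : ∀ i s, ∫⁻ z, V (i + 1) (Function.update s (t, k, i) z) ∂Dg
      ≤ ENNReal.ofReal (Real.exp c) * V i s := by
    intro i s
    by_cases hs : s ∈ A
    · have e : ∀ z, V (i + 1) (Function.update s (t, k, i) z) = V i s
          * ENNReal.ofReal (Real.exp (lam * noiseTerm g G γ (x s) (U i s) z)) := by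
        intro z
        simp only [V]
        rw [Set.indicator_of_mem ((hAu s i z).mpr hs), Set.indicator_of_mem hs,
          Finset.sum_range_succ, mul_add, Real.exp_add, ENNReal.ofReal_mul (Real.exp_pos _).le]
        congr 4
        · exact Finset.sum_congr rfl fun j hj => hXu s i z j (Finset.mem_range.mp hj)
        · simp only [X, hxu, hUu s i z i le_rfl, Function.update_self]
      simp only [e]
      rw [lintegral_const_mul' _ _ (by simp [V, Set.indicator_of_mem hs]), mul_comm]
      gcongr
      have hdist : ‖U i s - lowerSol g (x s)‖ ≤ 2 * D := by
        have h3 : ‖U i s - w s‖ ≤ D := norm_ballSGD_sub_le _ (w s) hD γ _ i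
        have h4 : ‖w s - lowerSol g (x s)‖ ≤ D := hs
        calc _ = ‖(U i s - w s) + (w s - lowerSol g (x s))‖ := by congr 1; abel
          _ ≤ 2 * D := (norm_add_le _ _).trans (by linarith)
      refine lintegral_exp_noise_le hσ hlam hγ
        ((hO.gradY_integrable (x s) (U i s)).sub (integrable_const _)) ?_
        (hO.gradY_lightTail (x s) (U i s)) hdist h₁ h₂
      simp only [Pi.sub_apply]
      rw [integral_sub (hO.gradY_integrable _ _) (integrable_const _), hO.gradY_mean]
      simp
    · have : ∀ z, V (i + 1) (Function.update s (t, k, i) z) = 0 := fun z =>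
        Set.indicator_of_notMem (fun h => hs ((hAu s i z).mp h)) _
      simp [this]
  have hsuper := lintegral_le_pow_of_update Dg (fun i => (t, k, i)) hV _ hstep n
  have hV0 : ∫⁻ s, V 0 s ∂(Measure.infinitePi fun _ : ℕ × ℕ × ℕ => Dg) ≤ 1 := by
    calc _ ≤ ∫⁻ s, 1 ∂(Measure.infinitePi fun _ : ℕ × ℕ × ℕ => Dg) := by
          refine lintegral_mono fun s => ?_
          refine (Set.indicator_le_self _ _ s).trans ?_
          simp
      _ = 1 := by simp
  set e₀ := ENNReal.ofReal (Real.exp (lam * a)) with he₀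
  have hmark := mul_meas_ge_le_lintegral (μ := Measure.infinitePi fun _ : ℕ × ℕ × ℕ => Dg) (hV n) e₀
  have hsub : {s | ‖w s - lowerSol g (x s)‖ ≤ D ∧ a ≤ ∑ i ∈ Finset.range n, X i s}
      ⊆ {s | e₀ ≤ V n s} := by
    rintro s ⟨h1, h2⟩
    have h1' : s ∈ A := h1
    simp only [Set.mem_ofPred_eq, V, Set.indicator_of_mem h1', he₀]
    exact ENNReal.ofReal_le_ofReal (Real.exp_le_exp.mpr (by gcongr))
  have hfin : e₀ * lowerLaw Dg {s | e₀ ≤ V n s} ≤ ENNReal.ofReal (Real.exp (n * c)) := by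
    refine hmark.trans (hsuper.trans ?_)
    calc _ ≤ ENNReal.ofReal (Real.exp c) ^ n * 1 := by gcongr
      _ = _ := by rw [mul_one, ← ENNReal.ofReal_pow (Real.exp_pos _).le, ← Real.exp_nat_mul]
  refine (measure_mono hsub).trans ?_
  have he₀0 : e₀ ≠ 0 := by simp [he₀, Real.exp_pos]
  have e1 : ENNReal.ofReal (Real.exp (-(lam * a) + n * c))
      = e₀⁻¹ * ENNReal.ofReal (Real.exp (n * c)) := by
    rw [Real.exp_add, ENNReal.ofReal_mul (Real.exp_pos _).le, Real.exp_neg,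
      ENNReal.ofReal_inv_of_pos (Real.exp_pos _)]
  rw [e1]
  calc _ = e₀⁻¹ * (e₀ * lowerLaw Dg {s | e₀ ≤ V n s}) := by
        rw [← mul_assoc, ENNReal.inv_mul_cancel he₀0 ENNReal.ofReal_ne_top, one_mul]
    _ ≤ _ := by gcongr

/-- The relations between the parameters of Epoch-SGD that make every epoch succeed with
probability at least `1 - exp (-L)`. Here `v` is the share of the error budget given to each of the
five error terms, and `Gd` bounds the lower-level gradient at distance `2R` from the solution. -/
structure EpochParams (p μ σg₁ Gd R α v L : ℝ) (K₁ : ℕ) : Prop where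
  R_pos : 0 < R
  α_pos : 0 < α
  v_pos : 0 < v
  L_pos : 0 < L
  budget : 10 * p * v ≤ μ * R ^ p
  step_grad : α * Gd ^ 2 ≤ v
  step_noise : 2 * α * σg₁ ^ 2 ≤ v
  len_init : R ^ 2 / (2 * α * v) ≤ K₁
  len_noise : 16 * L * R ^ 2 * σg₁ ^ 2 / v ^ 2 ≤ K₁
  len_mgf : 4 * L * R * σg₁ / v ≤ K₁
  len_log : L ≤ K₁

lemma two_rpow_div_nat (p : ℝ) (hp : 2 ≤ p) (R : ℝ) (hR : 0 < R) (k : ℕ) :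
    (R / 2 ^ ((k : ℝ) / p)) ^ p = R ^ p / 2 ^ k := by
  rw [Real.div_rpow hR.le (by positivity), ← Real.rpow_mul (by norm_num),
    div_mul_cancel₀ _ (by linarith : p ≠ 0), Real.rpow_natCast]

/-- An epoch that starts within its radius of the solution ends within the radius of the next
epoch, outside an event of probability `exp (-L)`. -/
lemma Oracle.measure_epoch_fail_le (hO : Oracle p σf σg₁ σg₂ f g F G Df Dg)
    (hg : LowerLevel p μ L₀ L₁ lg₁ lg₂ C g) (hp : 2 ≤ p) (hμ : 0 < μ) (hlg₁ : 0 ≤ lg₁)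
    (hσ : 0 < σg₁) {Gd R α v L : ℝ} {K₁ : ℕ} (hP : EpochParams p μ σg₁ Gd R α v L K₁)
    (hGd : ∀ x u, ‖u - lowerSol g x‖ ≤ 2 * R → ‖gradY g x u‖ ≤ Gd) (t k : ℕ)
    {x : (ℕ × ℕ × ℕ → Z) → Vec dx} {w : (ℕ × ℕ × ℕ → Z) → Vec dy}
    (hx : Measurable x) (hw : Measurable w)
    (hxu : ∀ s i z, x (Function.update s (t, k, i) z) = x s)
    (hwu : ∀ s i z, w (Function.update s (t, k, i) z) = w s) :
    lowerLaw Dg {s | ‖w s - lowerSol g (x s)‖ ≤ R / 2 ^ ((k : ℝ) / p) ∧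
        R / 2 ^ (((k + 1 : ℕ) : ℝ) / p) < ‖(1 / (epochLen p K₁ k : ℝ)) •
          ∑ i ∈ Finset.range (epochLen p K₁ k), ballSGD (fun w ζ => gradY (G ζ) (x s) w) (w s)
            (R / 2 ^ ((k : ℝ) / p)) (α / 2 ^ k) (fun j => s (t, k, j)) i - lowerSol g (x s)‖}
      ≤ ENNReal.ofReal (Real.exp (-L)) := by
  obtain ⟨hR, hα, hv, hL, hbud, hsg, hsn, hl1, hl2, hl3, hl4⟩ := hP
  have hp0 : 0 < p := by linarith
  have hK₁ : (0 : ℝ) < K₁ := hL.trans_le hl4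
  have hK₁' : 1 ≤ K₁ := by exact_mod_cast hK₁
  set N := epochLen p K₁ k with hN
  set n : ℝ := (N : ℝ) with hn
  have hNpos : 0 < N := epochLen_pos hK₁' k
  have hn0 : 0 < n := by rw [hn]; exact_mod_cast hNpos
  set T : ℝ := 2 ^ k with hT
  set e : ℝ := 2 ^ ((k : ℝ) / p) with he
  have hT0 : 0 < T := by positivity
  have hT1 : 1 ≤ T := one_le_pow₀ (by norm_num)
  have he0 : 0 < e := by positivity
  have he1 : 1 ≤ e := Real.one_le_rpow (by norm_num) (by positivity)
  have heT : e ≤ T := by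
    rw [he, hT, ← Real.rpow_natCast]
    refine Real.rpow_le_rpow_of_exponent_le (by norm_num) ?_
    exact div_le_self (by positivity) (by linarith)
  have hlen : K₁ * T ^ 2 ≤ n * e ^ 2 := by
    have h := le_epochLen (p := p) (T₁ := K₁) k
    have e1 : (2 : ℝ) ^ (2 * (p - 1) / p * (k : ℝ)) = T ^ 2 / e ^ 2 := by
      rw [hT, he, ← Real.rpow_natCast, ← Real.rpow_natCast, ← Real.rpow_natCast,
        ← Real.rpow_mul (by norm_num), ← Real.rpow_mul (by norm_num), ← Real.rpow_sub (by norm_num)]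
      congr 1
      push_cast
      field_simp
    rw [e1, ← hN, ← hn, ← mul_div_assoc, div_le_iff₀ (by positivity)] at h
    exact h
  have hlen2 : K₁ * T ≤ n * e := by
    have : K₁ * T * e ≤ n * e * e := by
      calc K₁ * T * e ≤ K₁ * T * T := by gcongr
        _ ≤ n * e * e := by linarith
    exact le_of_mul_le_mul_right this he0
  have hlen3 : K₁ ≤ n := by
    have : K₁ * T ^ 2 ≤ n * T ^ 2 := hlen.trans (by gcongr)
    exact le_of_mul_le_mul_right this (by positivity)
  set D := R / e with hD
  set γ := α / T with hγ
  have hD0 : 0 < D := by positivity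
  have hγ0 : 0 < γ := by positivity
  -- With this choice `L / lam` is the share `n * v / T` that the noise of the epoch may take.
  set lam := L * T / (n * v) with hlam
  have hlam0 : 0 < lam := by positivity
  set a := L / lam + n * (16 * lam * D ^ 2 * σg₁ ^ 2 + 2 * γ * σg₁ ^ 2) with ha
  -- the conditions on `lam`
  have c1 : 2 * lam * (2 * D) * σg₁ ≤ 1 := by
    have h3 : 4 * L * R * σg₁ * T ≤ v * (n * e) := by
      rw [div_le_iff₀ hv] at hl3
      calc 4 * L * R * σg₁ * T ≤ (K₁ * v) * T := by gcongr
        _ = v * (K₁ * T) := by ring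
        _ ≤ v * (n * e) := by gcongr
    have : 2 * lam * (2 * D) * σg₁ = 4 * L * R * σg₁ * T / (v * (n * e)) := by
      rw [hlam, hD]; field_simp; ring
    rw [this]
    exact (div_le_one (by positivity)).mpr h3
  have c2 : 2 * lam * γ * σg₁ ^ 2 ≤ 1 := by
    have : 2 * lam * γ * σg₁ ^ 2 = (L / n) * (2 * α * σg₁ ^ 2 / v) := by
      rw [hlam, hγ]; field_simp
    rw [this]
    have h1 : L / n ≤ 1 := (div_le_one hn0).mpr (hl4.trans hlen3)
    have h2 : 2 * α * σg₁ ^ 2 / v ≤ 1 := (div_le_one hv).mpr hsn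
    exact mul_le_one₀ h1 (by positivity) h2
  -- the five error terms
  have b1 : D ^ 2 / (2 * γ) ≤ n * v / T := by
    have : D ^ 2 / (2 * γ) = R ^ 2 / (2 * α * v) * T ^ 2 / e ^ 2 * (v / T) := by
      rw [hD, hγ]; field_simp
    rw [this]
    have h1 : R ^ 2 / (2 * α * v) * T ^ 2 / e ^ 2 ≤ n := by
      rw [div_le_iff₀ (by positivity)]
      exact (mul_le_mul_of_nonneg_right hl1 (by positivity)).trans hlen
    calc _ ≤ n * (v / T) := by gcongr
      _ = _ := by ring
  have b2 : γ * n * Gd ^ 2 ≤ n * v / T := by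
    have : γ * n * Gd ^ 2 = n * (α * Gd ^ 2) / T := by rw [hγ]; ring
    rw [this]; gcongr
  have b3 : L / lam = n * v / T := by rw [hlam]; field_simp
  have b4 : n * (16 * lam * D ^ 2 * σg₁ ^ 2) ≤ n * v / T := by
    have : n * (16 * lam * D ^ 2 * σg₁ ^ 2)
        = 16 * L * R ^ 2 * σg₁ ^ 2 / v ^ 2 * T ^ 2 / e ^ 2 * (v / T) := by
      rw [hlam, hD]; field_simp
    rw [this]
    have h1 : 16 * L * R ^ 2 * σg₁ ^ 2 / v ^ 2 * T ^ 2 / e ^ 2 ≤ n := by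
      rw [div_le_iff₀ (by positivity)]
      exact (mul_le_mul_of_nonneg_right hl2 (by positivity)).trans hlen
    calc _ ≤ n * (v / T) := by gcongr
      _ = _ := by ring
  have b5 : n * (2 * γ * σg₁ ^ 2) ≤ n * v / T := by
    have : n * (2 * γ * σg₁ ^ 2) = n * (2 * α * σg₁ ^ 2) / T := by rw [hγ]; ring
    rw [this]; gcongr
  have hprob := hO.measure_noise_ge_le hg hp hμ hlg₁ hσ t k hx hw hxu hwu hD0.le hγ0.le hlam0.le
    c1 c2 N a
  refine (measure_mono ?_).trans (hprob.trans_eq ?_)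
  · rintro s ⟨h1, h2⟩
    refine ⟨h1, ?_⟩
    by_contra hlt
    push Not at hlt
    have hDR : D ≤ R := div_le_self hR.le he1
    have havg := hg.avg_ballSGD_le (G := G) hp hμ hγ0 (x s) h1
      (fun u hu => hGd (x s) u (hu.trans (by linarith))) (fun j => s (t, k, j)) hNpos
    simp only at havg
    set r := ‖(1 / (N : ℝ)) • ∑ i ∈ Finset.range N, ballSGD (fun w ζ => gradY (G ζ) (x s) w) (w s)
            D γ (fun j => s (t, k, j)) i - lowerSol g (x s)‖ with hr
    have hrp : R ^ p / 2 ^ (k + 1) < r ^ p := by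
      rw [← two_rpow_div_nat p hp R hR (k + 1)]
      exact Real.rpow_lt_rpow (by positivity) h2 hp0
    have h3 : n * (μ / p * r ^ p) < 5 * (n * v / T) := by
      rw [← hn] at havg
      refine havg.trans_lt ?_
      linarith
    have h4 : 5 * (n * v / T) ≤ n * (μ / p * (R ^ p / 2 ^ (k + 1))) := by
      have e2 : n * (μ / p * (R ^ p / 2 ^ (k + 1))) = n / (2 * p * T) * (μ * R ^ p) := by
        rw [hT, pow_succ]; field_simp
      have e3 : 5 * (n * v / T) = n / (2 * p * T) * (10 * p * v) := by field_simp; norm_num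
      rw [e2, e3]; gcongr
    have h5 : n * (μ / p * (R ^ p / 2 ^ (k + 1))) < n * (μ / p * r ^ p) := by gcongr
    linarith
  · congr 2
    rw [ha, mul_add, mul_div_cancel₀ _ hlam0.ne', ← hn]
    ring

end Concentration

/-! ### The iterates of UniBiO -/

section EpochPoint

variable {d : ℕ} {Z : Type*}

lemma epochPoint_congr (p : ℝ) (grad : Vec d → Z → Vec d) (γ₁ : ℝ) (T₁ : ℕ) (D₁ : ℝ) (w : Vec d)
    {s s' : ℕ → ℕ → Z} {n : ℕ} (h : ∀ k < n, ∀ i, s k i = s' k i) :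
    epochPoint p grad γ₁ T₁ D₁ w s n = epochPoint p grad γ₁ T₁ D₁ w s' n := by
  induction n with
  | zero => rfl
  | succ n ih =>
    rw [epochPoint, epochPoint, ih fun k hk => h k (by omega),
      show s n = s' n from funext (h n (by omega))]

lemma norm_epochPoint_succ_sub_le {p : ℝ} (hp : 0 < p) (grad : Vec d → Z → Vec d) (γ₁ : ℝ) {T₁ : ℕ}
    (hT : 1 ≤ T₁) {D₁ : ℝ} (hD : 0 ≤ D₁) (w : Vec d) (s : ℕ → ℕ → Z) (k : ℕ) :
    ‖epochPoint p grad γ₁ T₁ D₁ w s (k + 1) - epochPoint p grad γ₁ T₁ D₁ w s k‖ ≤ D₁ := by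
  set c := epochPoint p grad γ₁ T₁ D₁ w s k with hc
  set n := epochLen p T₁ k with hn
  have hn0 : (0 : ℝ) < n := by exact_mod_cast epochLen_pos hT k
  have hpow : (1 : ℝ) ≤ 2 ^ ((k : ℝ) / p) := Real.one_le_rpow (by norm_num) (by positivity)
  have hD' : D₁ / 2 ^ ((k : ℝ) / p) ≤ D₁ := div_le_self hD hpow
  have e : epochPoint p grad γ₁ T₁ D₁ w s (k + 1) - c = (1 / (n : ℝ)) • ∑ i ∈ Finset.range n,
      (ballSGD grad c (D₁ / 2 ^ ((k : ℝ) / p)) (γ₁ / 2 ^ k) (s k) i - c) := by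
    rw [Finset.sum_sub_distrib, smul_sub, Finset.sum_const, Finset.card_range,
      ← Nat.cast_smul_eq_nsmul ℝ,
      smul_smul, one_div_mul_cancel hn0.ne', one_smul, epochPoint]
  rw [e, norm_smul, Real.norm_of_nonneg (by positivity), div_mul_eq_mul_div, one_mul,
    div_le_iff₀ hn0]
  calc _ ≤ ∑ i ∈ Finset.range n, D₁ := (norm_sum_le _ _).trans (Finset.sum_le_sum fun i _ =>
        (norm_ballSGD_sub_le _ _ (by positivity) _ _ _).trans hD')
    _ = _ := by rw [Finset.sum_const, Finset.card_range, nsmul_eq_mul, mul_comm]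

lemma norm_epochPoint_sub_le {p : ℝ} (hp : 0 < p) (grad : Vec d → Z → Vec d) (γ₁ : ℝ) {T₁ : ℕ}
    (hT : 1 ≤ T₁) {D₁ : ℝ} (hD : 0 ≤ D₁) (w : Vec d) (s : ℕ → ℕ → Z) (k : ℕ) :
    ‖epochPoint p grad γ₁ T₁ D₁ w s k - w‖ ≤ k * D₁ := by
  induction k with
  | zero => simp [epochPoint]
  | succ k ih =>
    have h := norm_epochPoint_succ_sub_le hp grad γ₁ hT hD w s k
    calc _ = ‖(epochPoint p grad γ₁ T₁ D₁ w s (k + 1) - epochPoint p grad γ₁ T₁ D₁ w s k)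
          + (epochPoint p grad γ₁ T₁ D₁ w s k - w)‖ := by congr 1; abel
      _ ≤ D₁ + k * D₁ := (norm_add_le _ _).trans (add_le_add h ih)
      _ = _ := by push_cast; ring

end EpochPoint

/-- The Epoch-SGD parameters do not depend on the iteration, and the budget is that of exactly `m`
epochs. -/
structure Schedule (p : ℝ) (P : Params) (α R : ℝ) (K₁ m : ℕ) : Prop where
  α_eq : ∀ t, P.α t = α
  R_eq : ∀ t, P.R t = R
  K₁_eq : ∀ t, P.K₁ t = K₁
  K_eq : ∀ t, P.K t = ∑ k ∈ Finset.range m, epochLen p K₁ k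
  one_le : 1 ≤ K₁

section Run

variable {dx dy : ℕ} {Ξ Z : Type*} {p α R : ℝ} {K₁ m : ℕ} {P : Params}
  {F : Ξ → Vec dx → Vec dy → ℝ} {G : Z → Vec dx → Vec dy → ℝ} {x₀ : Vec dx} {y₀ : Vec dy}

/-- The lower variable at the start of epoch `k` of the call of Epoch-SGD in iteration `t`. -/
def epochStart (p α R : ℝ) (K₁ : ℕ) (G : Z → Vec dx → Vec dy → ℝ) (sy : ℕ × ℕ × ℕ → Z) (t : ℕ)
    (x : Vec dx) (y : Vec dy) (k : ℕ) : Vec dy :=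
  epochPoint p (fun w ζ => gradY (G ζ) x w) α K₁ R y (fun k i => sy (t, k, i)) k

lemma Schedule.lowerUpdate_eq (hS : Schedule p P α R K₁ m) (sy : ℕ × ℕ × ℕ → Z) (t : ℕ)
    (x : Vec dx) (y : Vec dy) : lowerUpdate p P G sy t x y
      = (epochStart p α R K₁ G sy t x y m, ∑ k ∈ Finset.range m, epochLen p K₁ k) := by
  simp only [lowerUpdate, epochSGD, hS.α_eq, hS.R_eq, hS.K₁_eq, hS.K_eq, numEpochs_sum hS.one_le]
  rfl

lemma lowerUpdate_congr {sy sy' : ℕ × ℕ × ℕ → Z} {t : ℕ} (h : ∀ k i, sy (t, k, i) = sy' (t, k, i))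
    (x : Vec dx) (y : Vec dy) : lowerUpdate p P G sy t x y = lowerUpdate p P G sy' t x y := by
  unfold lowerUpdate
  rw [show (fun k i => sy (t, k, i)) = fun k i => sy' (t, k, i) from
    funext fun k => funext fun i => h k i]

/-- The state after `n` iterations depends on the samples of the first `n` iterations only. -/
lemma run_congr {sy sy' : ℕ × ℕ × ℕ → Z} {sx sx' : ℕ → UpperSample Ξ Z} {n : ℕ}
    (hy : ∀ t ≤ n, ∀ k i, sy (t, k, i) = sy' (t, k, i)) (hx : ∀ t ≤ n, sx t = sx' t) :
    run p P F G x₀ y₀ sy sx n = run p P F G x₀ y₀ sy' sx' n := by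
  induction n with
  | zero => simp only [run]; rw [lowerUpdate_congr (hy 0 le_rfl)]
  | succ n ih =>
    rw [run, run, ih (fun t ht => hy t (by omega)) (fun t ht => hx t (by omega))]
    simp only [step]
    rw [lowerUpdate_congr (hy (n + 1) le_rfl), hx (n + 1) le_rfl]

lemma run_zero_x (sy : ℕ × ℕ × ℕ → Z) (sx : ℕ → UpperSample Ξ Z) :
    (run p P F G x₀ y₀ sy sx 0).x = x₀ := rfl

lemma run_zero_y (hS : Schedule p P α R K₁ m) (sy : ℕ × ℕ × ℕ → Z) (sx : ℕ → UpperSample Ξ Z) :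
    (run p P F G x₀ y₀ sy sx 0).y = epochStart p α R K₁ G sy 0 x₀ y₀ m := by
  simp only [run, hS.lowerUpdate_eq]

lemma run_succ_y_of_dvd (hS : Schedule p P α R K₁ m) (sy : ℕ × ℕ × ℕ → Z)
    (sx : ℕ → UpperSample Ξ Z) {n : ℕ} (h : P.I ∣ n + 1) :
    (run p P F G x₀ y₀ sy sx (n + 1)).y = epochStart p α R K₁ G sy (n + 1)
      (run p P F G x₀ y₀ sy sx n).x (run p P F G x₀ y₀ sy sx n).y m := by
  rw [run]
  simp only [step, if_pos h, hS.lowerUpdate_eq]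

lemma run_succ_y_of_not_dvd (sy : ℕ × ℕ × ℕ → Z)
    (sx : ℕ → UpperSample Ξ Z) {n : ℕ} (h : ¬ P.I ∣ n + 1) :
    (run p P F G x₀ y₀ sy sx (n + 1)).y = (run p P F G x₀ y₀ sy sx n).y := by
  rw [run]
  simp only [step, if_neg h]

lemma run_succ_m (sy : ℕ × ℕ × ℕ → Z) (sx : ℕ → UpperSample Ξ Z) (n : ℕ) :
    (run p P F G x₀ y₀ sy sx (n + 1)).m = P.β • (run p P F G x₀ y₀ sy sx n).m
      + (1 - P.β) • hyperGradEst p P.C P.Q F G (run p P F G x₀ y₀ sy sx n).x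
        (run p P F G x₀ y₀ sy sx (n + 1)).y (sx (n + 1)) := by
  rw [run]; rfl

lemma run_succ_x (sy : ℕ × ℕ × ℕ → Z) (sx : ℕ → UpperSample Ξ Z) (n : ℕ) :
    (run p P F G x₀ y₀ sy sx (n + 1)).x = (run p P F G x₀ y₀ sy sx n).x
      - P.η • (‖(run p P F G x₀ y₀ sy sx (n + 1)).m‖⁻¹ • (run p P F G x₀ y₀ sy sx (n + 1)).m) := by
  rw [run]; rfl

/-- The lower variable used in iteration `n + 1` does not depend on the upper-level sample of that
iteration. -/
lemma run_succ_y_congr {sy : ℕ × ℕ × ℕ → Z} {sx sx' : ℕ → UpperSample Ξ Z} {n : ℕ}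
    (hx : ∀ t ≤ n, sx t = sx' t) :
    (run p P F G x₀ y₀ sy sx (n + 1)).y = (run p P F G x₀ y₀ sy sx' (n + 1)).y := by
  have h := run_congr (p := p) (P := P) (F := F) (G := G) (x₀ := x₀) (y₀ := y₀)
    (sy := sy) (sy' := sy) (fun _ _ _ _ => rfl) hx
  rw [run, run, h]
  rfl

lemma norm_run_succ_x_sub_le (hη : 0 ≤ P.η) (sy : ℕ × ℕ × ℕ → Z) (sx : ℕ → UpperSample Ξ Z)
    (n : ℕ) :
    ‖(run p P F G x₀ y₀ sy sx (n + 1)).x - (run p P F G x₀ y₀ sy sx n).x‖ ≤ P.η := by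
  rw [run_succ_x, sub_sub_cancel_left, norm_neg, norm_smul, norm_smul, norm_inv, norm_norm,
    Real.norm_of_nonneg hη]
  set a := ‖(run p P F G x₀ y₀ sy sx (n + 1)).m‖
  have : a⁻¹ * a ≤ 1 := inv_mul_le_one
  nlinarith

lemma norm_run_x_sub_le (hη : 0 ≤ P.η) (sy : ℕ × ℕ × ℕ → Z) (sx : ℕ → UpperSample Ξ Z)
    {j n : ℕ} (h : j ≤ n) :
    ‖(run p P F G x₀ y₀ sy sx n).x - (run p P F G x₀ y₀ sy sx j).x‖ ≤ ((n - j : ℕ) : ℝ) * P.η := by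
  induction n, h using Nat.le_induction with
  | base => simp
  | succ n hjn ih =>
    have h1 := norm_run_succ_x_sub_le (p := p) (P := P) (F := F) (G := G) (x₀ := x₀) (y₀ := y₀)
      hη sy sx n
    have e : ((n + 1 - j : ℕ) : ℝ) = ((n - j : ℕ) : ℝ) + 1 := by
      rw [Nat.succ_sub hjn]; push_cast; ring
    rw [e]
    calc _ = ‖((run p P F G x₀ y₀ sy sx (n + 1)).x - (run p P F G x₀ y₀ sy sx n).x)
          + ((run p P F G x₀ y₀ sy sx n).x - (run p P F G x₀ y₀ sy sx j).x)‖ := by congr 1; abel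
      _ ≤ P.η + ((n - j : ℕ) : ℝ) * P.η := (norm_add_le _ _).trans (add_le_add h1 ih)
      _ = _ := by ring

/-- A deterministic bound for the lower variable. -/
lemma Schedule.norm_run_y_sub_le (hS : Schedule p P α R K₁ m) (hp : 0 < p) (hR : 0 ≤ R)
    (sy : ℕ × ℕ × ℕ → Z) (sx : ℕ → UpperSample Ξ Z) (n : ℕ) :
    ‖(run p P F G x₀ y₀ sy sx n).y - y₀‖ ≤ (n + 1) * (m * R) := by
  have hstep : ∀ t (x : Vec dx) (y : Vec dy), ‖epochStart p α R K₁ G sy t x y m - y‖ ≤ m * R :=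
    fun t x y => norm_epochPoint_sub_le hp _ _ hS.one_le hR _ _ _
  induction n with
  | zero =>
    rw [run_zero_y hS]
    simpa using hstep 0 x₀ y₀
  | succ n ih =>
    have h : ‖(run p P F G x₀ y₀ sy sx (n + 1)).y - (run p P F G x₀ y₀ sy sx n).y‖ ≤ m * R := by
      by_cases hd : P.I ∣ n + 1
      · rw [run_succ_y_of_dvd hS _ _ hd]; exact hstep _ _ _
      · rw [run_succ_y_of_not_dvd _ _ hd, sub_self, norm_zero]; positivity
    calc _ = ‖((run p P F G x₀ y₀ sy sx (n + 1)).y - (run p P F G x₀ y₀ sy sx n).y)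
          + ((run p P F G x₀ y₀ sy sx n).y - y₀)‖ := by congr 1; abel
      _ ≤ m * R + (n + 1) * (m * R) := (norm_add_le _ _).trans (add_le_add h ih)
      _ = _ := by push_cast; ring

end Run

section Measurability

variable {dx dy : ℕ} {p μ σf σg₁ σg₂ α R : ℝ} {K₁ m : ℕ} {P : Params}
  {f g : Vec dx → Vec dy → ℝ}
  {Ξ Z : Type*} [MeasurableSpace Ξ] [MeasurableSpace Z]
  {F : Ξ → Vec dx → Vec dy → ℝ} {G : Z → Vec dx → Vec dy → ℝ} {Df : Measure Ξ} {Dg : Measure Z}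
  {x₀ : Vec dx} {y₀ : Vec dy}

lemma Oracle.measurable_epochStart (hO : Oracle p σf σg₁ σg₂ f g F G Df Dg) {Ω : Type*}
    [MeasurableSpace Ω] {sy : Ω → ℕ × ℕ × ℕ → Z} {x : Ω → Vec dx} {y : Ω → Vec dy}
    (hs : Measurable sy) (hx : Measurable x) (hy : Measurable y) (t k : ℕ) :
    Measurable fun r => epochStart p α R K₁ G (sy r) t (x r) (y r) k := by
  induction k with
  | zero => exact hy
  | succ k ih =>
    have h1 : ∀ i, Measurable fun r => ballSGD (fun w ζ => gradY (G ζ) (x r) w)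
        (epochStart p α R K₁ G (sy r) t (x r) (y r) k) (R / 2 ^ ((k : ℝ) / p)) (α / 2 ^ k)
        (fun i => sy r (t, k, i)) i := fun i =>
      hO.measurable_ballSGD hx ih (fun i => (measurable_pi_apply (t, k, i)).comp hs) _ _ i
    have h2 := (Finset.measurable_fun_sum (Finset.range (epochLen p K₁ k)) fun i _ =>
      h1 i).const_smul (1 / (epochLen p K₁ k : ℝ))
    exact h2

/-- The iterates are measurable functions of all samples. -/
lemma Oracle.measurable_run (hO : Oracle p σf σg₁ σg₂ f g F G Df Dg) (hS : Schedule p P α R K₁ m)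
    (n : ℕ) :
    Measurable (fun r : (ℕ × ℕ × ℕ → Z) × (ℕ → UpperSample Ξ Z) =>
      (run p P F G x₀ y₀ r.1 r.2 n).x) ∧
    Measurable (fun r : (ℕ × ℕ × ℕ → Z) × (ℕ → UpperSample Ξ Z) =>
      (run p P F G x₀ y₀ r.1 r.2 n).y) ∧
    Measurable (fun r : (ℕ × ℕ × ℕ → Z) × (ℕ → UpperSample Ξ Z) =>
      (run p P F G x₀ y₀ r.1 r.2 n).m) := by
  induction n with
  | zero =>
    refine ⟨measurable_const, ?_, measurable_const⟩
    simp only [run_zero_y hS]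
    exact hO.measurable_epochStart measurable_fst measurable_const measurable_const 0 m
  | succ n ih =>
    obtain ⟨ix, iy, im⟩ := ih
    have hy : Measurable (fun r : (ℕ × ℕ × ℕ → Z) × (ℕ → UpperSample Ξ Z) =>
        (run p P F G x₀ y₀ r.1 r.2 (n + 1)).y) := by
      by_cases hd : P.I ∣ n + 1
      · simp only [run_succ_y_of_dvd hS _ _ hd]
        exact hO.measurable_epochStart measurable_fst ix iy (n + 1) m
      · simp only [run_succ_y_of_not_dvd _ _ hd]
        exact iy
    have hm : Measurable (fun r : (ℕ × ℕ × ℕ → Z) × (ℕ → UpperSample Ξ Z) =>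
        (run p P F G x₀ y₀ r.1 r.2 (n + 1)).m) := by
      simp only [run_succ_m]
      have h1 := (hO.measurable_hyperGradEst (Cb := P.C) P.Q).comp ((ix.prodMk hy).prodMk
        ((measurable_pi_apply (n + 1)).comp measurable_snd))
      simp only [Function.comp_def] at h1
      exact (im.const_smul P.β).add (h1.const_smul (1 - P.β))
    refine ⟨?_, hy, hm⟩
    simp only [run_succ_x]
    exact ix.sub ((hm.norm.inv.smul hm).const_smul P.η)

end Measurability

/-! ### Tracking of the lower-level solution -/

section Tracking

variable {dx dy : ℕ} {Ξ Z : Type*} {p μ L₀ L₁ lg₁ lg₂ C σf σg₁ σg₂ α R : ℝ} {K₁ m : ℕ}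
  {P : Params} {f g : Vec dx → Vec dy → ℝ}
  {F : Ξ → Vec dx → Vec dy → ℝ} {G : Z → Vec dx → Vec dy → ℝ} {x₀ : Vec dx} {y₀ : Vec dy}

/-- The lower variable at which the lower-level update of iteration `t` starts; the upper variable
is `(run … (t - 1)).x`, also for the warm start `t = 0`, where `0 - 1 = 0`. -/
def lowerInit (p : ℝ) (P : Params) (F : Ξ → Vec dx → Vec dy → ℝ) (G : Z → Vec dx → Vec dy → ℝ)
    (x₀ : Vec dx) (y₀ : Vec dy) (sy : ℕ × ℕ × ℕ → Z) (sx : ℕ → UpperSample Ξ Z) (t : ℕ) : Vec dy :=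
  if t = 0 then y₀ else (run p P F G x₀ y₀ sy sx (t - 1)).y

/-- The event that epoch `k` of the lower-level update of iteration `t` starts close enough to the
lower-level solution, but does not reduce the distance as planned. -/
def epochFail (p α R : ℝ) (K₁ : ℕ) (P : Params) (g : Vec dx → Vec dy → ℝ)
    (F : Ξ → Vec dx → Vec dy → ℝ) (G : Z → Vec dx → Vec dy → ℝ)
    (x₀ : Vec dx) (y₀ : Vec dy) (sx : ℕ → UpperSample Ξ Z) (t k : ℕ) : Set (ℕ × ℕ × ℕ → Z) :=
  {sy | ‖epochStart p α R K₁ G sy t (run p P F G x₀ y₀ sy sx (t - 1)).x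
        (lowerInit p P F G x₀ y₀ sy sx t) k - lowerSol g (run p P F G x₀ y₀ sy sx (t - 1)).x‖
        ≤ R / 2 ^ ((k : ℝ) / p) ∧
      R / 2 ^ (((k + 1 : ℕ) : ℝ) / p) <
        ‖epochStart p α R K₁ G sy t (run p P F G x₀ y₀ sy sx (t - 1)).x
          (lowerInit p P F G x₀ y₀ sy sx t) (k + 1)
          - lowerSol g (run p P F G x₀ y₀ sy sx (t - 1)).x‖}

lemma epochStart_succ (p α R : ℝ) (K₁ : ℕ) (G : Z → Vec dx → Vec dy → ℝ) (sy : ℕ × ℕ × ℕ → Z)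
    (t : ℕ) (x : Vec dx) (y : Vec dy) (k : ℕ) :
    epochStart p α R K₁ G sy t x y (k + 1) = (1 / (epochLen p K₁ k : ℝ)) •
      ∑ i ∈ Finset.range (epochLen p K₁ k), ballSGD (fun w ζ => gradY (G ζ) x w)
        (epochStart p α R K₁ G sy t x y k) (R / 2 ^ ((k : ℝ) / p)) (α / 2 ^ k)
        (fun i => sy (t, k, i)) i := rfl

lemma norm_epochStart_sub_le_of_notMem_epochFail {sy : ℕ × ℕ × ℕ → Z} {sx : ℕ → UpperSample Ξ Z}
    {t : ℕ} (h0 : ‖lowerInit p P F G x₀ y₀ sy sx t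
      - lowerSol g (run p P F G x₀ y₀ sy sx (t - 1)).x‖ ≤ R) :
    ∀ n, (∀ k < n, sy ∉ epochFail p α R K₁ P g F G x₀ y₀ sx t k) →
    ‖epochStart p α R K₁ G sy t (run p P F G x₀ y₀ sy sx (t - 1)).x
        (lowerInit p P F G x₀ y₀ sy sx t) n - lowerSol g (run p P F G x₀ y₀ sy sx (t - 1)).x‖
      ≤ R / 2 ^ ((n : ℝ) / p)
  | 0, _ => by simpa [epochStart, epochPoint] using h0
  | n + 1, h => by
    have ih := norm_epochStart_sub_le_of_notMem_epochFail h0 n fun k hk => h k (by omega)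
    by_contra hc
    exact h n (by omega) ⟨ih, not_le.mp hc⟩

/-- Without failing epochs the lower variable stays close to the solution: it is accurate after
each update, and between updates the solution moves by at most `solMod (I η)`. -/
lemma norm_run_y_sub_lowerSol_le (hg : LowerLevel p μ L₀ L₁ lg₁ lg₂ C g) (hp : 2 ≤ p) (hμ : 0 < μ)
    (hlg₁ : 0 ≤ lg₁) (hS : Schedule p P α R K₁ m) (hI : 1 ≤ P.I) (hη : 0 ≤ P.η)
    (h0 : ‖y₀ - lowerSol g x₀‖ ≤ R)
    (hR : R / 2 ^ ((m : ℝ) / p) + solMod p μ lg₁ (P.I * P.η) ≤ R)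
    {sy : ℕ × ℕ × ℕ → Z} {sx : ℕ → UpperSample Ξ Z} {N : ℕ}
    (hgood : ∀ t ≤ N, ∀ k < m, sy ∉ epochFail p α R K₁ P g F G x₀ y₀ sx t k) {n : ℕ}
    (hn : n < N) :
    ‖(run p P F G x₀ y₀ sy sx (n + 1)).y - lowerSol g (run p P F G x₀ y₀ sy sx n).x‖
      ≤ R / 2 ^ ((m : ℝ) / p) + solMod p μ lg₁ (P.I * P.η) := by
  set ρ := R / 2 ^ ((m : ℝ) / p) with hρ
  have htri : ∀ (y : Vec dy) (n j : ℕ), j ≤ n → n - j ≤ P.I →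
      ‖y - lowerSol g (run p P F G x₀ y₀ sy sx j).x‖ ≤ ρ →
      ‖y - lowerSol g (run p P F G x₀ y₀ sy sx n).x‖ ≤ ρ + solMod p μ lg₁ (P.I * P.η) := by
    intro y n j hj hnj hy
    have h1 := norm_run_x_sub_le (p := p) (P := P) (F := F) (G := G) (x₀ := x₀) (y₀ := y₀)
      hη sy sx hj
    have h2 : ((n - j : ℕ) : ℝ) * P.η ≤ P.I * P.η := by gcongr
    have h3 := hg.lowerSol_holder hp hμ hlg₁ (run p P F G x₀ y₀ sy sx j).x
      (run p P F G x₀ y₀ sy sx n).x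
    rw [norm_sub_rev (run p P F G x₀ y₀ sy sx j).x] at h3
    have h4 := solMod_mono hp hμ hlg₁ (norm_nonneg _) (h1.trans h2)
    calc _ = ‖(y - lowerSol g (run p P F G x₀ y₀ sy sx j).x)
          + (lowerSol g (run p P F G x₀ y₀ sy sx j).x
            - lowerSol g (run p P F G x₀ y₀ sy sx n).x)‖ := by congr 1; abel
      _ ≤ _ := (norm_add_le _ _).trans (add_le_add hy (h3.trans h4))
  have hdiv : ∀ n, n / P.I * P.I ≤ n ∧ n < n / P.I * P.I + P.I := fun n => by
    have h1 := Nat.div_add_mod n P.I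
    have h2 := Nat.mod_lt n (show 0 < P.I by omega)
    rw [mul_comm] at h1
    omega
  have key : ∀ n ≤ N, ‖(run p P F G x₀ y₀ sy sx n).y
      - lowerSol g (run p P F G x₀ y₀ sy sx (n / P.I * P.I - 1)).x‖ ≤ ρ := by
    intro n
    induction n with
    | zero =>
      intro _
      have h := norm_epochStart_sub_le_of_notMem_epochFail (p := p) (α := α) (R := R) (K₁ := K₁)
        (P := P) (g := g) (F := F) (G := G) (x₀ := x₀) (y₀ := y₀) (sy := sy) (sx := sx) (t := 0)
        (by simpa [lowerInit, run_zero_x] using h0) m (hgood 0 (by omega))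
      rw [Nat.zero_div, Nat.zero_mul, Nat.zero_sub, run_zero_y hS]
      simpa [lowerInit, run_zero_x] using h
    | succ n ih =>
      intro hn
      have ih := ih (by omega)
      have hd := hdiv n
      by_cases hdvd : P.I ∣ n + 1
      · have hinit : lowerInit p P F G x₀ y₀ sy sx (n + 1) = (run p P F G x₀ y₀ sy sx n).y := by
          simp [lowerInit]
        have h := norm_epochStart_sub_le_of_notMem_epochFail (p := p) (α := α) (R := R) (K₁ := K₁)
          (P := P) (g := g) (F := F) (G := G) (x₀ := x₀) (y₀ := y₀) (sy := sy) (sx := sx)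
          (t := n + 1) (by
            rw [hinit]
            exact (htri _ n _ (by omega) (by omega) ih).trans hR) m (hgood (n + 1) hn)
        rw [Nat.div_mul_cancel hdvd, run_succ_y_of_dvd hS sy sx hdvd]
        rw [hinit] at h
        exact h
      · rw [Nat.succ_div_of_not_dvd hdvd, run_succ_y_of_not_dvd sy sx hdvd]
        exact ih
  have hd := hdiv (n + 1)
  exact htri _ n _ (by omega) (by omega) (key (n + 1) hn)

variable [MeasurableSpace Ξ] [MeasurableSpace Z] {Df : Measure Ξ} {Dg : Measure Z}
  [IsProbabilityMeasure Dg]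

lemma Oracle.measure_epochFail_le (hO : Oracle p σf σg₁ σg₂ f g F G Df Dg)
    (hg : LowerLevel p μ L₀ L₁ lg₁ lg₂ C g) (hp : 2 ≤ p) (hμ : 0 < μ) (hlg₁ : 0 ≤ lg₁)
    (hσ : 0 < σg₁) {Gd v L : ℝ} (hP : EpochParams p μ σg₁ Gd R α v L K₁)
    (hGd : ∀ x u, ‖u - lowerSol g x‖ ≤ 2 * R → ‖gradY g x u‖ ≤ Gd)
    (hS : Schedule p P α R K₁ m) (sx : ℕ → UpperSample Ξ Z) (t k : ℕ) :
    lowerLaw Dg (epochFail p α R K₁ P g F G x₀ y₀ sx t k) ≤ ENNReal.ofReal (Real.exp (-L)) := by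
  have hrun : ∀ n, Measurable (fun sy => (run p P F G x₀ y₀ sy sx n).x) ∧
      Measurable (fun sy => (run p P F G x₀ y₀ sy sx n).y) := fun n => by
    obtain ⟨h1, h2, -⟩ := hO.measurable_run (x₀ := x₀) (y₀ := y₀) hS n
    exact ⟨h1.comp (measurable_id.prodMk measurable_const),
      h2.comp (measurable_id.prodMk measurable_const)⟩
  have hinit : Measurable fun sy => lowerInit p P F G x₀ y₀ sy sx t := by
    unfold lowerInit
    split_ifs
    · exact measurable_const
    · exact (hrun (t - 1)).2
  have hxu : ∀ s i z, (run p P F G x₀ y₀ (Function.update s (t, k, i) z) sx (t - 1)).x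
      = (run p P F G x₀ y₀ s sx (t - 1)).x := by
    intro s i z
    rcases Nat.eq_zero_or_pos t with rfl | ht
    · rw [Nat.zero_sub, run_zero_x, run_zero_x]
    · rw [run_congr (sy' := s) (sx' := sx) (fun t' ht' k' i' => ?_) fun _ _ => rfl]
      rw [Function.update_of_ne]
      intro h
      have := congrArg Prod.fst h
      simp only at this
      omega
  have hyu : ∀ s i z, lowerInit p P F G x₀ y₀ (Function.update s (t, k, i) z) sx t
      = lowerInit p P F G x₀ y₀ s sx t := by
    intro s i z
    unfold lowerInit
    split_ifs with ht
    · rfl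
    · rw [run_congr (sy' := s) (sx' := sx) (fun t' ht' k' i' => ?_) fun _ _ => rfl]
      rw [Function.update_of_ne]
      intro h
      have := congrArg Prod.fst h
      simp only at this
      omega
  have hwu : ∀ s i z, epochStart p α R K₁ G (Function.update s (t, k, i) z) t
        (run p P F G x₀ y₀ (Function.update s (t, k, i) z) sx (t - 1)).x
        (lowerInit p P F G x₀ y₀ (Function.update s (t, k, i) z) sx t) k
      = epochStart p α R K₁ G s t (run p P F G x₀ y₀ s sx (t - 1)).x
        (lowerInit p P F G x₀ y₀ s sx t) k := by
    intro s i z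
    rw [hxu, hyu]
    refine epochPoint_congr _ _ _ _ _ _ fun k' hk' i' => ?_
    rw [Function.update_of_ne]
    intro h
    have := congrArg (fun q => q.2.1) h
    simp only at this
    omega
  have h := hO.measure_epoch_fail_le hg hp hμ hlg₁ hσ hP hGd t k (hrun (t - 1)).1
    (hO.measurable_epochStart measurable_id (hrun (t - 1)).1 hinit t k) hxu hwu
  simp only [id] at h
  unfold epochFail
  simp only [epochStart_succ]
  exact h

/-- For fixed upper-level samples, the lower variable is accurate in all iterations with high
probability. -/
lemma Oracle.measure_tracking_fail_le (hO : Oracle p σf σg₁ σg₂ f g F G Df Dg)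
    (hg : LowerLevel p μ L₀ L₁ lg₁ lg₂ C g) (hp : 2 ≤ p) (hμ : 0 < μ) (hlg₁ : 0 ≤ lg₁)
    (hσ : 0 < σg₁) {Gd v L : ℝ} (hP : EpochParams p μ σg₁ Gd R α v L K₁)
    (hGd : ∀ x u, ‖u - lowerSol g x‖ ≤ 2 * R → ‖gradY g x u‖ ≤ Gd)
    (hS : Schedule p P α R K₁ m) (hI : 1 ≤ P.I) (hη : 0 ≤ P.η)
    (h0 : ‖y₀ - lowerSol g x₀‖ ≤ R)
    (hR : R / 2 ^ ((m : ℝ) / p) + solMod p μ lg₁ (P.I * P.η) ≤ R)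
    (sx : ℕ → UpperSample Ξ Z) (N : ℕ) :
    lowerLaw Dg {sy | ∃ n < N, R / 2 ^ ((m : ℝ) / p) + solMod p μ lg₁ (P.I * P.η)
        < ‖(run p P F G x₀ y₀ sy sx (n + 1)).y - lowerSol g (run p P F G x₀ y₀ sy sx n).x‖}
      ≤ ENNReal.ofReal (((N : ℝ) + 1) * m * Real.exp (-L)) := by
  have hsub : {sy | ∃ n < N, R / 2 ^ ((m : ℝ) / p) + solMod p μ lg₁ (P.I * P.η)
        < ‖(run p P F G x₀ y₀ sy sx (n + 1)).y - lowerSol g (run p P F G x₀ y₀ sy sx n).x‖}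
      ⊆ ⋃ q ∈ Finset.range (N + 1) ×ˢ Finset.range m,
        epochFail p α R K₁ P g F G x₀ y₀ sx q.1 q.2 := by
    rintro sy ⟨n, hn, hlt⟩
    by_contra hc
    refine absurd (norm_run_y_sub_lowerSol_le hg hp hμ hlg₁ hS hI hη h0 hR
      (sy := sy) (sx := sx) (N := N) (fun t ht k hk hmem => hc ?_) hn) (not_le.mpr hlt)
    exact Set.mem_biUnion (x := (t, k)) (by simp; omega) hmem
  refine (measure_mono hsub).trans ((measure_biUnion_finset_le _ _).trans ?_)
  refine (Finset.sum_le_sum fun q _ => hO.measure_epochFail_le hg hp hμ hlg₁ hσ hP hGd hS sx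
    q.1 q.2).trans ?_
  rw [Finset.sum_const, Finset.card_product, Finset.card_range, Finset.card_range, nsmul_eq_mul,
    ENNReal.ofReal_mul (by positivity), ← ENNReal.ofReal_natCast]
  push_cast
  exact le_rfl

end Tracking

/-! ### Normalized momentum -/

section Deterministic

variable {dx dy : ℕ} {p μ L₀ L₁ lg₁ lg₂ C lf₀ lf₁ Δ : ℝ} {f g : Vec dx → Vec dy → ℝ}
  {Ξ Z : Type*} {P : Params} {F : Ξ → Vec dx → Vec dy → ℝ} {G : Z → Vec dx → Vec dy → ℝ}
  {x₀ : Vec dx} {y₀ : Vec dy}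

/-- A normalized step decreases a function up to twice the error `m - v` of the direction. -/
lemma le_inner_normalize {E : Type*} [NormedAddCommGroup E] [InnerProductSpace ℝ E] (v m : E) :
    ‖v‖ - 2 * ‖m - v‖ ≤ inner ℝ v (‖m‖⁻¹ • m) := by
  rcases eq_or_ne m 0 with rfl | hm
  · simp only [smul_zero, inner_zero_right, zero_sub, norm_neg]
    linarith [norm_nonneg v]
  · have hm0 : 0 < ‖m‖ := norm_pos_iff.mpr hm
    set w := ‖m‖⁻¹ • m with hw
    have hw1 : ‖w‖ = 1 := by rw [hw, norm_smul, norm_inv, norm_norm, inv_mul_cancel₀ hm0.ne']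
    have h1 : inner ℝ m w = ‖m‖ := by
      rw [hw, real_inner_smul_right, real_inner_self_eq_norm_sq]
      field_simp
    have h2 : inner ℝ (m - v) w ≤ ‖m - v‖ := by
      have := real_inner_le_norm (m - v) w
      rwa [hw1, mul_one] at this
    rw [inner_sub_left, h1] at h2
    have h3 : ‖v‖ ≤ ‖m‖ + ‖m - v‖ := by
      have := norm_sub_le m (m - v)
      rwa [sub_sub_cancel] at this
    linarith

/-- The descent inequality, summed over the iterations. -/
lemma sum_norm_gradient_le (hg : LowerLevel p μ L₀ L₁ lg₁ lg₂ C g)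
    (hf : UpperLevel p lf₀ lf₁ Δ f g x₀) (hp : 2 ≤ p) (hμ : 0 < μ) (hlg₁ : 0 ≤ lg₁)
    (hlg₂ : 0 ≤ lg₂) (hlf₀ : 0 ≤ lf₀) (hlf₁ : 0 ≤ lf₁) (hη : 0 < P.η)
    (sy : ℕ × ℕ × ℕ → Z) (sx : ℕ → UpperSample Ξ Z) (T : ℕ) :
    ∑ n ∈ Finset.range T, ‖gradient (hyperObj f g) (run p P F G x₀ y₀ sy sx n).x‖
      ≤ Δ / P.η + T * gradMod p μ lg₁ lg₂ lf₀ lf₁ P.η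
        + 2 * ∑ n ∈ Finset.range T, ‖(run p P F G x₀ y₀ sy sx (n + 1)).m
          - gradient (hyperObj f g) (run p P F G x₀ y₀ sy sx n).x‖ := by
  set X := fun n => (run p P F G x₀ y₀ sy sx n).x with hX
  set M := fun n => (run p P F G x₀ y₀ sy sx n).m with hM
  set Ω := gradMod p μ lg₁ lg₂ lf₀ lf₁ P.η with hΩ
  have hΩ0 : 0 ≤ Ω := gradMod_nonneg hp hμ hlg₁ hlg₂ hlf₀ hlf₁ hη.le
  have hstep : ∀ n, ‖gradient (hyperObj f g) (X n)‖
      ≤ (hyperObj f g (X n) - hyperObj f g (X (n + 1))) / P.η + Ω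
        + 2 * ‖M (n + 1) - gradient (hyperObj f g) (X n)‖ := by
    intro n
    have hd : X (n + 1) - X n = -(P.η • (‖M (n + 1)‖⁻¹ • M (n + 1))) := by
      simp only [hX, hM, run_succ_x, sub_sub_cancel_left]
    have hn : ‖X (n + 1) - X n‖ ≤ P.η := norm_run_succ_x_sub_le hη.le sy sx n
    have h1 := (le_abs_self _).trans
      (abs_hyperObj_sub_le hg hf hp hμ hlg₁ hlg₂ hlf₀ hlf₁ (X n) (X (n + 1)))
    have h2 : gradMod p μ lg₁ lg₂ lf₀ lf₁ ‖X (n + 1) - X n‖ * ‖X (n + 1) - X n‖ ≤ Ω * P.η := by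
      have := gradMod_mono hp hμ hlg₁ hlg₂ hlf₀ hlf₁ (norm_nonneg _) hn
      gcongr
    rw [hd, inner_neg_right, real_inner_smul_right] at h1
    rw [hd] at h2
    have h3 := mul_le_mul_of_nonneg_left
      (le_inner_normalize (gradient (hyperObj f g) (X n)) (M (n + 1))) hη.le
    have h4 : P.η * ‖gradient (hyperObj f g) (X n)‖
        ≤ (hyperObj f g (X n) - hyperObj f g (X (n + 1)))
          + P.η * (Ω + 2 * ‖M (n + 1) - gradient (hyperObj f g) (X n)‖) := by linarith
    rw [add_assoc, ← sub_le_iff_le_add, le_div_iff₀ hη]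
    linarith
  refine (Finset.sum_le_sum fun n _ => hstep n).trans ?_
  rw [Finset.sum_add_distrib, Finset.sum_add_distrib, ← Finset.sum_div, Finset.sum_range_sub',
    Finset.sum_const, Finset.card_range, nsmul_eq_mul, ← Finset.mul_sum]
  have := hf.gap (X T)
  have h0 : X 0 = x₀ := rfl
  rw [h0]
  gcongr

/-- The part of the momentum that is due to the noise of the stochastic hypergradients. -/
def momentumNoise (p : ℝ) (P : Params) (f g : Vec dx → Vec dy → ℝ)
    (F : Ξ → Vec dx → Vec dy → ℝ) (G : Z → Vec dx → Vec dy → ℝ)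
    (x₀ : Vec dx) (y₀ : Vec dy) (sy : ℕ × ℕ × ℕ → Z) (sx : ℕ → UpperSample Ξ Z) : ℕ → Vec dx
  | 0 => 0
  | n + 1 => P.β • momentumNoise p P f g F G x₀ y₀ sy sx n
      + (1 - P.β) • (hyperGradEst p P.C P.Q F G (run p P F G x₀ y₀ sy sx n).x
          (run p P F G x₀ y₀ sy sx (n + 1)).y (sx (n + 1))
        - hyperGradMean p P.C P.Q f g (run p P F G x₀ y₀ sy sx n).x
          (run p P F G x₀ y₀ sy sx (n + 1)).y)

lemma momentumNoise_congr {sy : ℕ × ℕ × ℕ → Z} {sx sx' : ℕ → UpperSample Ξ Z} {n : ℕ}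
    (hx : ∀ t ≤ n, sx t = sx' t) :
    momentumNoise p P f g F G x₀ y₀ sy sx n = momentumNoise p P f g F G x₀ y₀ sy sx' n := by
  induction n with
  | zero => rfl
  | succ n ih =>
    rw [momentumNoise, momentumNoise, ih fun t ht => hx t (by omega), hx (n + 1) le_rfl,
      run_congr (sy := sy) (sy' := sy) (fun _ _ _ _ => rfl) (fun t (ht : t ≤ n) => hx t (by omega)),
      run_succ_y_congr (fun t (ht : t ≤ n) => hx t (by omega))]

/-- The momentum without its noise tracks the hypergradient: the initial error is forgotten, and
the drift of the hypergradient and the bias of the estimator are averaged. -/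
lemma sum_norm_momentum_sub_noise_le (hg : LowerLevel p μ L₀ L₁ lg₁ lg₂ C g)
    (hf : UpperLevel p lf₀ lf₁ Δ f g x₀) (hp : 2 ≤ p) (hμ : 0 < μ) (hlg₁ : 0 ≤ lg₁)
    (hlg₂ : 0 ≤ lg₂) (hlf₀ : 0 ≤ lf₀) (hlf₁ : 0 ≤ lf₁) (hη : 0 ≤ P.η) (hβ0 : 0 ≤ P.β)
    (hβ1 : P.β ≤ 1) {σg₂ : ℝ} (hCb : HessBound μ C σg₂ P.C)
    (sy : ℕ × ℕ × ℕ → Z) (sx : ℕ → UpperSample Ξ Z) (T : ℕ) :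
    (1 - P.β) * ∑ n ∈ Finset.range T, ‖(run p P F G x₀ y₀ sy sx (n + 1)).m
          - momentumNoise p P f g F G x₀ y₀ sy sx (n + 1)
          - gradient (hyperObj f g) (run p P F G x₀ y₀ sy sx n).x‖
      ≤ ‖gradient (hyperObj f g) x₀‖ + T * gradMod p μ lg₁ lg₂ lf₀ lf₁ P.η
        + (1 - P.β) * ∑ n ∈ Finset.range T, (lg₁ * (lf₀ / μ) * contr μ P.C ^ P.Q
          + hyperLip μ lg₁ lg₂ lf₀ lf₁ * ‖(run p P F G x₀ y₀ sy sx (n + 1)).y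
            - lowerSol g (run p P F G x₀ y₀ sy sx n).x‖) := by
  set X := fun n => (run p P F G x₀ y₀ sy sx n).x with hX
  set Y := fun n => (run p P F G x₀ y₀ sy sx n).y with hY
  set D := fun n => (run p P F G x₀ y₀ sy sx n).m - momentumNoise p P f g F G x₀ y₀ sy sx n with hD
  set Ω := gradMod p μ lg₁ lg₂ lf₀ lf₁ P.η with hΩ
  set a := fun n => ‖D n - gradient (hyperObj f g) (X (n - 1))‖ with ha
  set b := fun n => lg₁ * (lf₀ / μ) * contr μ P.C ^ P.Q
    + hyperLip μ lg₁ lg₂ lf₀ lf₁ * ‖Y (n + 1) - lowerSol g (X n)‖ with hb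
  have hΩ0 : 0 ≤ Ω := gradMod_nonneg hp hμ hlg₁ hlg₂ hlf₀ hlf₁ hη
  have hmean : ∀ n, ‖hyperGradMean p P.C P.Q f g (X n) (Y (n + 1))
      - gradient (hyperObj f g) (X n)‖ ≤ b n := by
    intro n
    rw [gradient_hyperObj hg hf hp hμ hlg₁]
    have h1 := norm_hyperGradMean_sub_le hg hf hμ hlg₁ hCb P.Q (X n) (Y (n + 1))
    have h2 := norm_hyperGrad_sub_le hg hf hμ hlg₁ hlg₂ (X n) (X n) (Y (n + 1)) (lowerSol g (X n))
    have h3 : jointDist (X n) (X n) (Y (n + 1)) (lowerSol g (X n))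
        = ‖Y (n + 1) - lowerSol g (X n)‖ := by
      rw [jointDist, sub_self, norm_zero, zero_pow two_ne_zero, zero_add,
        Real.sqrt_sq (norm_nonneg _)]
    rw [h3] at h2
    have h4 := (norm_add_le _ _).trans (add_le_add h1 h2)
    rwa [sub_add_sub_cancel] at h4
  have hDs : ∀ n, D (n + 1) = P.β • D n
      + (1 - P.β) • hyperGradMean p P.C P.Q f g (X n) (Y (n + 1)) := by
    intro n
    simp only [hD, hX, hY, run_succ_m, momentumNoise, smul_sub]
    abel
  have hrec : ∀ n, a (n + 1) ≤ P.β * a n + Ω + (1 - P.β) * b n := by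
    intro n
    have hmove : ‖gradient (hyperObj f g) (X (n - 1)) - gradient (hyperObj f g) (X n)‖ ≤ Ω := by
      refine (norm_gradient_sub_le hg hf hp hμ hlg₁ hlg₂ hlf₀ hlf₁ _ _).trans
        (gradMod_mono hp hμ hlg₁ hlg₂ hlf₀ hlf₁ (norm_nonneg _) ?_)
      rcases Nat.eq_zero_or_pos n with rfl | hn
      · simpa using hη
      · rw [norm_sub_rev]
        have := norm_run_succ_x_sub_le (p := p) (P := P) (F := F) (G := G) (x₀ := x₀) (y₀ := y₀)
          hη sy sx (n - 1)
        rwa [Nat.sub_add_cancel hn] at this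
    have e : D (n + 1) - gradient (hyperObj f g) (X n)
        = P.β • (D n - gradient (hyperObj f g) (X (n - 1)))
          + P.β • (gradient (hyperObj f g) (X (n - 1)) - gradient (hyperObj f g) (X n))
          + (1 - P.β) • (hyperGradMean p P.C P.Q f g (X n) (Y (n + 1))
            - gradient (hyperObj f g) (X n)) := by
      rw [hDs]; module
    have h1 : 0 ≤ 1 - P.β := by linarith
    simp only [ha, Nat.add_sub_cancel]
    rw [e]
    refine (norm_add₃_le).trans ?_
    rw [norm_smul, norm_smul, norm_smul, Real.norm_of_nonneg hβ0, Real.norm_of_nonneg h1]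
    gcongr
    · calc _ ≤ 1 * Ω := by gcongr
        _ = Ω := one_mul _
    · exact hmean n
  have ha0 : a 0 = ‖gradient (hyperObj f g) x₀‖ := by
    have h0 : D 0 = 0 := by simp [hD, run, momentumNoise]
    have h1 : X 0 = x₀ := rfl
    simp only [ha, h0, Nat.zero_sub, h1, zero_sub, norm_neg]
  have hsum : ∑ n ∈ Finset.range T, a (n + 1)
      ≤ P.β * ∑ n ∈ Finset.range T, a n + T * Ω + (1 - P.β) * ∑ n ∈ Finset.range T, b n := by
    refine (Finset.sum_le_sum fun n _ => hrec n).trans_eq ?_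
    rw [Finset.sum_add_distrib, Finset.sum_add_distrib, Finset.mul_sum, Finset.mul_sum,
      Finset.sum_const, Finset.card_range, nsmul_eq_mul]
  have hshift : ∑ n ∈ Finset.range T, a n ≤ a 0 + ∑ n ∈ Finset.range T, a (n + 1) := by
    rw [add_comm, ← Finset.sum_range_succ', Finset.sum_range_succ]
    exact le_add_of_nonneg_right (norm_nonneg _)
  have h5 : P.β * ∑ n ∈ Finset.range T, a n ≤ a 0 + P.β * ∑ n ∈ Finset.range T, a (n + 1) := by
    have h6 := mul_le_mul_of_nonneg_left hshift hβ0
    have h7 : P.β * a 0 ≤ 1 * a 0 := mul_le_mul_of_nonneg_right hβ1 (norm_nonneg _)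
    linarith
  have hgoal : ∑ n ∈ Finset.range T, ‖(run p P F G x₀ y₀ sy sx (n + 1)).m
      - momentumNoise p P f g F G x₀ y₀ sy sx (n + 1)
      - gradient (hyperObj f g) (run p P F G x₀ y₀ sy sx n).x‖
      = ∑ n ∈ Finset.range T, a (n + 1) := rfl
  rw [hgoal, ← ha0]
  linarith

end Deterministic

section Expectation

variable {dx dy : ℕ} {p μ L₀ L₁ lg₁ lg₂ C lf₀ lf₁ Δ σf σg₁ σg₂ α R : ℝ} {K₁ m : ℕ}
  {f g : Vec dx → Vec dy → ℝ} {Ξ Z : Type*} [MeasurableSpace Ξ] [MeasurableSpace Z]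
  {F : Ξ → Vec dx → Vec dy → ℝ} {G : Z → Vec dx → Vec dy → ℝ} {Df : Measure Ξ} {Dg : Measure Z}
  {P : Params} {x₀ : Vec dx} {y₀ : Vec dy}

lemma Oracle.measurable_run_of_lower (hO : Oracle p σf σg₁ σg₂ f g F G Df Dg)
    (hS : Schedule p P α R K₁ m) (sy : ℕ × ℕ × ℕ → Z) (n : ℕ) :
    Measurable (fun sx => (run p P F G x₀ y₀ sy sx n).x) ∧
    Measurable (fun sx => (run p P F G x₀ y₀ sy sx n).y) := by
  obtain ⟨h1, h2, -⟩ := hO.measurable_run (x₀ := x₀) (y₀ := y₀) hS n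
  exact ⟨h1.comp (measurable_const.prodMk measurable_id),
    h2.comp (measurable_const.prodMk measurable_id)⟩

variable [IsProbabilityMeasure Df] [IsProbabilityMeasure Dg]

lemma Oracle.measurable_hyperGradMean (hO : Oracle p σf σg₁ σg₂ f g F G Df Dg) (Cb : ℝ) (Q : ℕ) :
    Measurable fun r : Vec dx × Vec dy => hyperGradMean p Cb Q f g r.1 r.2 := by
  have h := (hO.measurable_hyperGradEst (Cb := Cb) Q).stronglyMeasurable.integral_prod_right'
    (ν := upperSampleLaw Df Dg)
  have e : (fun r : Vec dx × Vec dy => hyperGradMean p Cb Q f g r.1 r.2) = fun r =>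
      ∫ s, hyperGradEst p Cb Q F G r.1 r.2 s ∂(upperSampleLaw Df Dg) :=
    funext fun r => (hO.integrable_hyperGradEst (Cb := Cb) Q r.1 r.2).2.symm
  rw [e]
  exact h.measurable

lemma Oracle.measurable_momentumNoise (hO : Oracle p σf σg₁ σg₂ f g F G Df Dg)
    (hS : Schedule p P α R K₁ m) (sy : ℕ × ℕ × ℕ → Z) (n : ℕ) :
    Measurable fun sx => momentumNoise p P f g F G x₀ y₀ sy sx n := by
  induction n with
  | zero => exact measurable_const
  | succ n ih =>
    have hx := (hO.measurable_run_of_lower (x₀ := x₀) (y₀ := y₀) hS sy n).1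
    have hy := (hO.measurable_run_of_lower (x₀ := x₀) (y₀ := y₀) hS sy (n + 1)).2
    have h1 := (hO.measurable_hyperGradEst (Cb := P.C) P.Q).comp
      ((hx.prodMk hy).prodMk (measurable_pi_apply (n + 1)))
    have h2 := (hO.measurable_hyperGradMean P.C P.Q).comp (hx.prodMk hy)
    simp only [Function.comp_def] at h1 h2
    exact (ih.const_smul P.β).add ((h1.sub h2).const_smul (1 - P.β))

/-- The variance of the averaged noise is reduced by the factor `1 - β`. -/
lemma Oracle.lintegral_momentumNoise_sq_le (hO : Oracle p σf σg₁ σg₂ f g F G Df Dg)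
    (hg : LowerLevel p μ L₀ L₁ lg₁ lg₂ C g) (hf : UpperLevel p lf₀ lf₁ Δ f g x₀) (hμ : 0 < μ)
    (hlg₁ : 0 ≤ lg₁) (hS : Schedule p P α R K₁ m) (hCb : HessBound μ C σg₂ P.C)
    (hβ0 : 0 ≤ P.β) (hβ1 : P.β ≤ 1) (sy : ℕ × ℕ × ℕ → Z) (n : ℕ) :
    ∫⁻ sx, ‖momentumNoise p P f g F G x₀ y₀ sy sx n‖ₑ ^ 2 ∂(upperLaw Df Dg)
      ≤ ENNReal.ofReal ((1 - P.β) * hyperStd μ lg₁ lf₀ σf σg₂ ^ 2) := by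
  set σ := hyperStd μ lg₁ lf₀ σf σg₂ with hσ
  have hβ : 0 ≤ 1 - P.β := by linarith
  induction n with
  | zero => simp [momentumNoise]
  | succ n ih =>
    have hm := hO.measurable_momentumNoise (x₀ := x₀) (y₀ := y₀) hS sy (n + 1)
    have hstep : ∀ s, ∫⁻ z, ‖momentumNoise p P f g F G x₀ y₀ sy
          (Function.update s (n + 1) z) (n + 1)‖ₑ ^ 2 ∂(upperSampleLaw Df Dg)
        ≤ ENNReal.ofReal (P.β ^ 2) * ‖momentumNoise p P f g F G x₀ y₀ sy s n‖ₑ ^ 2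
          + ENNReal.ofReal (((1 - P.β) * σ) ^ 2) := by
      intro s
      have hs : ∀ z, ∀ t ≤ n, Function.update s (n + 1) z t = s t := fun z t ht =>
        Function.update_of_ne (by omega) _ _
      set x := (run p P F G x₀ y₀ sy s n).x with hx
      set y := (run p P F G x₀ y₀ sy s (n + 1)).y with hy
      have e : ∀ z, momentumNoise p P f g F G x₀ y₀ sy (Function.update s (n + 1) z) (n + 1)
          = P.β • momentumNoise p P f g F G x₀ y₀ sy s n
            + (1 - P.β) • (hyperGradEst p P.C P.Q F G x y z - hyperGradMean p P.C P.Q f g x y) := by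
        intro z
        rw [momentumNoise, momentumNoise_congr (hs z),
          run_congr (sy := sy) (sy' := sy) (fun _ _ _ _ => rfl) (hs z), run_succ_y_congr (hs z),
          Function.update_self]
      simp only [e]
      obtain ⟨hint, hmean⟩ := hO.integrable_hyperGradEst (Cb := P.C) P.Q x y
      have hint0 : Integrable (fun z => hyperGradEst p P.C P.Q F G x y z
          - hyperGradMean p P.C P.Q f g x y) (upperSampleLaw Df Dg) :=
        hint.sub (integrable_const _)
      have hmean0 : ∫ z, (hyperGradEst p P.C P.Q F G x y z
          - hyperGradMean p P.C P.Q f g x y) ∂(upperSampleLaw Df Dg) = 0 := by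
        rw [integral_sub hint (integrable_const _), hmean, integral_const, probReal_univ,
          one_smul, sub_self]
      refine (lintegral_enorm_add_sq_le (σ := (1 - P.β) * σ) (hint0.smul (1 - P.β)) ?_ ?_
        (P.β • momentumNoise p P f g F G x₀ y₀ sy s n)).trans_eq ?_
      · simp only [Pi.smul_apply]
        rw [integral_smul, hmean0, smul_zero]
      · simp only [Pi.smul_apply, enorm_smul, mul_pow]
        rw [lintegral_const_mul' _ _ (by simp), ENNReal.ofReal_mul (by positivity),
          enorm_sq_eq_ofReal (1 - P.β), Real.norm_of_nonneg hβ]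
        gcongr
        exact hO.lintegral_hyperGradEst_sub_sq_le hg hf hμ hlg₁ hCb P.Q x y
      · rw [ENNReal.ofReal_add (by positivity) (by positivity), norm_smul, mul_pow,
          Real.norm_of_nonneg hβ0, ENNReal.ofReal_mul (by positivity), ← enorm_sq_eq_ofReal]
    unfold upperLaw at ih ⊢
    rw [lintegral_update (upperSampleLaw Df Dg) (n + 1) (hm.enorm.pow_const 2)]
    refine (lintegral_mono hstep).trans ?_
    rw [lintegral_add_right _ measurable_const, lintegral_const, measure_univ, mul_one,
      lintegral_const_mul' _ _ ENNReal.ofReal_ne_top]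
    refine (add_le_add_left (mul_le_mul_right ih _) _).trans ?_
    rw [← ENNReal.ofReal_mul (by positivity), ← ENNReal.ofReal_add (by positivity) (by positivity)]
    refine ENNReal.ofReal_le_ofReal ?_
    have h1 : P.β ^ 2 ≤ P.β := by nlinarith
    have h2 : 0 ≤ (1 - P.β) * σ ^ 2 := by positivity
    calc _ = (1 - P.β) * σ ^ 2 * (P.β ^ 2 + (1 - P.β)) := by ring
      _ ≤ (1 - P.β) * σ ^ 2 * 1 := by gcongr; linarith
      _ = _ := mul_one _

lemma integrable_norm_and_integral_le {Ω E : Type*} [MeasurableSpace Ω] {ν : Measure Ω}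
    [IsProbabilityMeasure ν] [NormedAddCommGroup E] {N : Ω → E} (hN : AEStronglyMeasurable N ν)
    {s : ℝ} (hs : 0 < s) (h : ∫⁻ ω, ‖N ω‖ₑ ^ 2 ∂ν ≤ ENNReal.ofReal (s ^ 2)) :
    Integrable (fun ω => ‖N ω‖) ν ∧ ∫ ω, ‖N ω‖ ∂ν ≤ s := by
  have hsq : Integrable (fun ω => ‖N ω‖ ^ 2) ν := by
    refine ⟨hN.norm.pow 2, ?_⟩
    rw [hasFiniteIntegral_iff_ofReal (Filter.Eventually.of_forall fun _ => by positivity)]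
    simp only [← enorm_sq_eq_ofReal]
    exact h.trans_lt ENNReal.ofReal_lt_top
  have hle : ∫ ω, ‖N ω‖ ^ 2 ∂ν ≤ s ^ 2 := by
    simp only [enorm_sq_eq_ofReal] at h
    rw [← ofReal_integral_eq_lintegral_ofReal hsq
      (Filter.Eventually.of_forall fun _ => by positivity)] at h
    exact (ENNReal.ofReal_le_ofReal_iff (sq_nonneg _)).mp h
  have hpt : ∀ ω, ‖N ω‖ ≤ s / 2 + 1 / (2 * s) * ‖N ω‖ ^ 2 := fun ω => by
    have h2 : s / 2 + 1 / (2 * s) * ‖N ω‖ ^ 2 - ‖N ω‖ = (‖N ω‖ - s) ^ 2 / (2 * s) := by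
      field_simp; ring
    have h3 : 0 ≤ (‖N ω‖ - s) ^ 2 / (2 * s) := by positivity
    linarith
  have hb : Integrable (fun ω => s / 2 + 1 / (2 * s) * ‖N ω‖ ^ 2) ν :=
    (integrable_const _).add (hsq.const_mul _)
  have hi : Integrable (fun ω => ‖N ω‖) ν :=
    hb.mono' hN.norm (Filter.Eventually.of_forall fun ω => by rw [norm_norm]; exact hpt ω)
  refine ⟨hi, (integral_mono hi hb hpt).trans ?_⟩
  rw [integral_add (integrable_const _) (hsq.const_mul _), integral_const_mul, integral_const,
    probReal_univ, one_smul]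
  calc _ ≤ s / 2 + 1 / (2 * s) * s ^ 2 := by gcongr
    _ = s := by field_simp; ring

/-- The expected average norm of the hypergradient, for fixed lower-level samples for which the
lower variable is accurate with probability `1 - θ` over the upper-level samples. -/
lemma Oracle.integral_gradient_le (hO : Oracle p σf σg₁ σg₂ f g F G Df Dg)
    (hg : LowerLevel p μ L₀ L₁ lg₁ lg₂ C g) (hf : UpperLevel p lf₀ lf₁ Δ f g x₀) (hp : 2 ≤ p)
    (hμ : 0 < μ) (hlg₁ : 0 ≤ lg₁) (hlg₂ : 0 ≤ lg₂) (hlf₀ : 0 ≤ lf₀) (hlf₁ : 0 ≤ lf₁)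
    (hS : Schedule p P α R K₁ m) (hCb : HessBound μ C σg₂ P.C) (hη : 0 < P.η)
    (hβ0 : 0 ≤ P.β) (hβ1 : P.β < 1) {s : ℝ} (hs : 0 < s)
    (hs2 : (1 - P.β) * hyperStd μ lg₁ lf₀ σf σg₂ ^ 2 ≤ s ^ 2) {T : ℕ} (hT : 1 ≤ T)
    {κ B θ : ℝ} (hκ : 0 ≤ κ) (hB : 0 ≤ B) (hθ : 0 ≤ θ) {sy : ℕ × ℕ × ℕ → Z}
    (hdet : ∀ sx : ℕ → UpperSample Ξ Z, ∀ n < T, ‖(run p P F G x₀ y₀ sy sx (n + 1)).y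
      - lowerSol g (run p P F G x₀ y₀ sy sx n).x‖ ≤ B)
    (hbad : upperLaw Df Dg {sx | ∃ n < T, κ < ‖(run p P F G x₀ y₀ sy sx (n + 1)).y
      - lowerSol g (run p P F G x₀ y₀ sy sx n).x‖} ≤ ENNReal.ofReal θ) :
    (∀ n ∈ Finset.range T, Integrable
      (fun sx => ‖gradient (hyperObj f g) (run p P F G x₀ y₀ sy sx n).x‖) (upperLaw Df Dg)) ∧
    (1 / (T : ℝ)) * ∑ n ∈ Finset.range T,
        ∫ sx, ‖gradient (hyperObj f g) (run p P F G x₀ y₀ sy sx n).x‖ ∂(upperLaw Df Dg)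
      ≤ Δ / (P.η * T) + gradMod p μ lg₁ lg₂ lf₀ lf₁ P.η + 2 * s
        + 2 * ((‖gradient (hyperObj f g) x₀‖ / T + gradMod p μ lg₁ lg₂ lf₀ lf₁ P.η) / (1 - P.β))
        + 2 * (lg₁ * (lf₀ / μ) * contr μ P.C ^ P.Q
          + hyperLip μ lg₁ lg₂ lf₀ lf₁ * (κ + B * θ)) := by
  have : IsProbabilityMeasure (upperLaw Df Dg) := by unfold upperLaw; infer_instance
  set ν := upperLaw Df Dg with hν
  set Ω := gradMod p μ lg₁ lg₂ lf₀ lf₁ P.η with hΩ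
  set H := hyperLip μ lg₁ lg₂ lf₀ lf₁ with hH
  set b₀ := lg₁ * (lf₀ / μ) * contr μ P.C ^ P.Q with hb₀
  set G₀ := ‖gradient (hyperObj f g) x₀‖ with hG₀
  have hH0 : 0 ≤ H := hyperLip_nonneg hμ hlg₁ hlg₂ hlf₀ hlf₁
  have hβ : 0 < 1 - P.β := by linarith
  have hT0 : (0 : ℝ) < T := by exact_mod_cast hT
  set e := fun n (sx : ℕ → UpperSample Ξ Z) => ‖(run p P F G x₀ y₀ sy sx (n + 1)).y
      - lowerSol g (run p P F G x₀ y₀ sy sx n).x‖ with he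
  have hme : ∀ n, Measurable (e n) := fun n =>
    ((hO.measurable_run_of_lower hS sy (n + 1)).2.sub
      ((hg.continuous_lowerSol hp hμ hlg₁).measurable.comp
        (hO.measurable_run_of_lower hS sy n).1)).norm
  have hie : ∀ n < T, Integrable (e n) ν := fun n hn =>
    Integrable.of_bound (hme n).aestronglyMeasurable B (Filter.Eventually.of_forall fun sx => by
      rw [Real.norm_of_nonneg (norm_nonneg _)]; exact hdet sx n hn)
  have hIe : ∀ n < T, ∫ sx, e n sx ∂ν ≤ κ + B * θ := by
    intro n hn
    have hmS : MeasurableSet {sx | κ < e n sx} := measurableSet_lt measurable_const (hme n)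
    have hSle : ν.real {sx | κ < e n sx} ≤ θ := by
      refine ENNReal.toReal_le_of_le_ofReal hθ ((measure_mono fun sx hsx => ?_).trans hbad)
      exact ⟨n, hn, hsx⟩
    have hpt : ∀ sx, e n sx ≤ κ + {sx | κ < e n sx}.indicator (fun _ => B) sx := by
      intro sx
      by_cases h : κ < e n sx
      · rw [Set.indicator_of_mem (by exact h)]
        exact (hdet sx n hn).trans (by linarith)
      · rw [Set.indicator_of_notMem (by exact h), add_zero]
        exact not_lt.mp h
    have hii : Integrable ({sx | κ < e n sx}.indicator (fun _ => B)) ν :=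
      (integrable_const B).indicator hmS
    refine (integral_mono (hie n hn) ((integrable_const κ).add hii) hpt).trans ?_
    rw [integral_add' (integrable_const κ) hii, integral_const, probReal_univ, one_smul,
      integral_indicator_const _ hmS, smul_eq_mul, mul_comm]
    gcongr
  have hN : ∀ n, Integrable (fun sx => ‖momentumNoise p P f g F G x₀ y₀ sy sx n‖) ν ∧
      ∫ sx, ‖momentumNoise p P f g F G x₀ y₀ sy sx n‖ ∂ν ≤ s := fun n =>
    integrable_norm_and_integral_le (hO.measurable_momentumNoise hS sy n).aestronglyMeasurable hs
      ((hO.lintegral_momentumNoise_sq_le hg hf hμ hlg₁ hS hCb hβ0 hβ1.le sy n).trans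
        (ENNReal.ofReal_le_ofReal hs2))
  have hcont : Continuous (gradient (hyperObj f g)) := by
    have h1 : gradient (hyperObj f g) = fun x => hyperGrad p f g x (lowerSol g x) :=
      funext fun x => gradient_hyperObj hg hf hp hμ hlg₁ x
    have h2 := continuous_of_jointDist (φ := hyperGrad p f g) fun x₁ x₂ y₁ y₂ =>
      norm_hyperGrad_sub_le hg hf hμ hlg₁ hlg₂ x₁ x₂ y₁ y₂
    rw [h1]
    exact h2.comp (continuous_id.prodMk (hg.continuous_lowerSol hp hμ hlg₁))
  have hmg : ∀ n, Measurable fun sx =>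
      ‖gradient (hyperObj f g) (run p P F G x₀ y₀ sy sx n).x‖ := fun n =>
    (hcont.measurable.comp (hO.measurable_run_of_lower hS sy n).1).norm
  have hig : ∀ n, Integrable (fun sx =>
      ‖gradient (hyperObj f g) (run p P F G x₀ y₀ sy sx n).x‖) ν := fun n => by
    refine Integrable.of_bound (hmg n).aestronglyMeasurable
      (G₀ + gradMod p μ lg₁ lg₂ lf₀ lf₁ (n * P.η)) (Filter.Eventually.of_forall fun sx => ?_)
    rw [norm_norm]
    have h1 := norm_run_x_sub_le (p := p) (P := P) (F := F) (G := G) (x₀ := x₀) (y₀ := y₀)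
      hη.le sy sx (Nat.zero_le n)
    rw [run_zero_x, Nat.sub_zero] at h1
    have h2 := norm_gradient_sub_le hg hf hp hμ hlg₁ hlg₂ hlf₀ hlf₁
      (run p P F G x₀ y₀ sy sx n).x x₀
    have h3 := gradMod_mono hp hμ hlg₁ hlg₂ hlf₀ hlf₁ (norm_nonneg _) h1
    have h4 := norm_le_norm_add_norm_sub' (gradient (hyperObj f g) (run p P F G x₀ y₀ sy sx n).x)
      (gradient (hyperObj f g) x₀)
    linarith
  refine ⟨fun n _ => hig n, ?_⟩
  have hpath : ∀ sx, ∑ n ∈ Finset.range T,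
      ‖gradient (hyperObj f g) (run p P F G x₀ y₀ sy sx n).x‖
      ≤ ∑ n ∈ Finset.range T, (Δ / (P.η * T) + Ω + 2 * ((G₀ / T + Ω) / (1 - P.β))
        + 2 * ‖momentumNoise p P f g F G x₀ y₀ sy sx (n + 1)‖ + 2 * (b₀ + H * e n sx)) := by
    intro sx
    have h1 := sum_norm_gradient_le (y₀ := y₀) (F := F) (G := G) hg hf hp hμ hlg₁ hlg₂ hlf₀ hlf₁
      hη sy sx T
    have h2 := sum_norm_momentum_sub_noise_le (y₀ := y₀) (F := F) (G := G) hg hf hp hμ hlg₁ hlg₂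
      hlf₀ hlf₁ hη.le hβ0 hβ1.le hCb sy sx T
    have h3 : ∑ n ∈ Finset.range T, ‖(run p P F G x₀ y₀ sy sx (n + 1)).m
          - gradient (hyperObj f g) (run p P F G x₀ y₀ sy sx n).x‖
        ≤ ∑ n ∈ Finset.range T, ‖momentumNoise p P f g F G x₀ y₀ sy sx (n + 1)‖
          + ∑ n ∈ Finset.range T, ‖(run p P F G x₀ y₀ sy sx (n + 1)).m
            - momentumNoise p P f g F G x₀ y₀ sy sx (n + 1)
            - gradient (hyperObj f g) (run p P F G x₀ y₀ sy sx n).x‖ := by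
      rw [← Finset.sum_add_distrib]
      refine Finset.sum_le_sum fun n _ => ?_
      refine le_trans (le_of_eq ?_) (norm_add_le _ _)
      congr 1; abel
    rw [mul_comm, ← le_div_iff₀ hβ, add_div, mul_div_cancel_left₀ _ hβ.ne'] at h2
    simp only [Finset.sum_add_distrib, Finset.sum_const, Finset.card_range, nsmul_eq_mul,
      ← Finset.mul_sum] at h2 ⊢
    have e1 : (T : ℝ) * (Δ / (P.η * T)) = Δ / P.η := by field_simp
    have e2 : (T : ℝ) * (2 * ((G₀ / T + Ω) / (1 - P.β))) = 2 * ((G₀ + T * Ω) / (1 - P.β)) := by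
      have h4 : (G₀ / T + Ω) * T = G₀ + T * Ω := by field_simp
      rw [← h4]; ring
    rw [e1, e2]
    linarith
  have hterm : ∀ n < T, Integrable (fun sx => Δ / (P.η * T) + Ω + 2 * ((G₀ / T + Ω) / (1 - P.β))
        + 2 * ‖momentumNoise p P f g F G x₀ y₀ sy sx (n + 1)‖ + 2 * (b₀ + H * e n sx)) ν ∧
      ∫ sx, (Δ / (P.η * T) + Ω + 2 * ((G₀ / T + Ω) / (1 - P.β))
        + 2 * ‖momentumNoise p P f g F G x₀ y₀ sy sx (n + 1)‖ + 2 * (b₀ + H * e n sx)) ∂ν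
      ≤ Δ / (P.η * T) + Ω + 2 * ((G₀ / T + Ω) / (1 - P.β)) + 2 * s
        + 2 * (b₀ + H * (κ + B * θ)) := by
    intro n hn
    have i1 : Integrable (fun sx => 2 * ‖momentumNoise p P f g F G x₀ y₀ sy sx (n + 1)‖) ν :=
      (hN (n + 1)).1.const_mul 2
    have i2 : Integrable (fun sx => Δ / (P.η * T) + Ω + 2 * ((G₀ / T + Ω) / (1 - P.β))
        + 2 * ‖momentumNoise p P f g F G x₀ y₀ sy sx (n + 1)‖) ν := (integrable_const _).add i1
    have i3 : Integrable (fun sx => H * e n sx) ν := (hie n hn).const_mul H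
    have i4 : Integrable (fun sx => b₀ + H * e n sx) ν := (integrable_const _).add i3
    have i5 : Integrable (fun sx => 2 * (b₀ + H * e n sx)) ν := i4.const_mul 2
    refine ⟨i2.add i5, ?_⟩
    rw [integral_add i2 i5, integral_add (integrable_const _) i1, integral_const_mul,
      integral_const_mul, integral_add (integrable_const _) i3, integral_const_mul H]
    simp only [integral_const, probReal_univ, smul_eq_mul, one_mul]
    have h1 := (hN (n + 1)).2
    have h2 := mul_le_mul_of_nonneg_left (hIe n hn) hH0
    linarith
  rw [← integral_finsetSum _ fun n _ => hig n, one_div, inv_mul_le_iff₀ hT0]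
  refine (integral_mono (integrable_finsetSum _ fun n _ => hig n)
    (integrable_finsetSum _ fun n hn => (hterm n (Finset.mem_range.mp hn)).1) hpath).trans ?_
  rw [integral_finsetSum _ fun n hn => (hterm n (Finset.mem_range.mp hn)).1]
  refine (Finset.sum_le_sum fun n hn => (hterm n (Finset.mem_range.mp hn)).2).trans_eq ?_
  rw [Finset.sum_const, Finset.card_range, nsmul_eq_mul]
  ring

end Expectation

/-! ### The bound with high probability over the lower-level samples -/

section HighProbability

/-- If every section of a measurable set over the second factor has small measure, then most
sections over the first factor have small measure. -/
lemma measure_section_ge_le {Ω₁ Ω₂ : Type*} [MeasurableSpace Ω₁] [MeasurableSpace Ω₂]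
    {ν₁ : Measure Ω₁} {ν₂ : Measure Ω₂} [IsProbabilityMeasure ν₁] [IsProbabilityMeasure ν₂]
    {S : Set (Ω₁ × Ω₂)} (hS : MeasurableSet S) {δ θ : ℝ} (hθ : 0 < θ)
    (h : ∀ ω₂, ν₁ {ω₁ | (ω₁, ω₂) ∈ S} ≤ ENNReal.ofReal (δ * θ)) :
    ν₁ {ω₁ | ENNReal.ofReal θ ≤ ν₂ {ω₂ | (ω₁, ω₂) ∈ S}} ≤ ENNReal.ofReal δ := by
  have hθ' : ENNReal.ofReal θ ≠ 0 := by simpa using hθ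
  have h1 : (ν₁.prod ν₂) S ≤ ENNReal.ofReal (δ * θ) := by
    rw [Measure.prod_apply_symm hS]
    refine (lintegral_mono h).trans ?_
    rw [lintegral_const, measure_univ, mul_one]
  rw [Measure.prod_apply hS] at h1
  have h2 := mul_meas_ge_le_lintegral (μ := ν₁) (measurable_measure_prodMk_left (ν := ν₂) hS)
    (ENNReal.ofReal θ)
  have h3 := h2.trans h1
  rw [mul_comm δ, ENNReal.ofReal_mul hθ.le] at h3
  exact (ENNReal.mul_le_mul_iff_right hθ' ENNReal.ofReal_ne_top).mp h3

variable {dx dy : ℕ} {p μ L₀ L₁ lg₁ lg₂ C lf₀ lf₁ Δ σf σg₁ σg₂ α R B : ℝ} {K₁ m : ℕ}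
  {f g : Vec dx → Vec dy → ℝ} {Ξ Z : Type*} [MeasurableSpace Ξ] [MeasurableSpace Z]
  {F : Ξ → Vec dx → Vec dy → ℝ} {G : Z → Vec dx → Vec dy → ℝ} {Df : Measure Ξ} {Dg : Measure Z}
  [IsProbabilityMeasure Df] [IsProbabilityMeasure Dg] {P : Params} {x₀ : Vec dx} {y₀ : Vec dy}

/-- The expected average norm of the hypergradient is small with high probability. On the
exceptional event of probability `θ` of the upper-level samples the distance of the lower variable
to the solution is only bounded by the lengths of the paths. -/
lemma Oracle.measure_gradient_gt_le (hO : Oracle p σf σg₁ σg₂ f g F G Df Dg)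
    (hg : LowerLevel p μ L₀ L₁ lg₁ lg₂ C g) (hf : UpperLevel p lf₀ lf₁ Δ f g x₀) (hp : 2 ≤ p)
    (hμ : 0 < μ) (hlg₁ : 0 ≤ lg₁) (hlg₂ : 0 ≤ lg₂) (hlf₀ : 0 ≤ lf₀) (hlf₁ : 0 ≤ lf₁) (hΔ : 0 < Δ)
    (hσ : 0 < σg₁) {Gd v L : ℝ} (hP : EpochParams p μ σg₁ Gd R α v L K₁)
    (hGd : ∀ x u, ‖u - lowerSol g x‖ ≤ 2 * R → ‖gradY g x u‖ ≤ Gd)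
    (hS : Schedule p P α R K₁ m) (hCb : HessBound μ C σg₂ P.C) (hI : 1 ≤ P.I) (hη : 0 < P.η)
    (hβ0 : 0 ≤ P.β) (hβ1 : P.β < 1) (hB : 0 ≤ B) (h0 : ‖y₀ - lowerSol g x₀‖ ≤ B) (hBR : B ≤ R)
    (hR : R / 2 ^ ((m : ℝ) / p) + solMod p μ lg₁ (P.I * P.η) ≤ R)
    {s : ℝ} (hs : 0 < s) (hs2 : (1 - P.β) * hyperStd μ lg₁ lf₀ σf σg₂ ^ 2 ≤ s ^ 2)
    (hT : 1 ≤ P.T) {δ θ ε : ℝ} (hθ : 0 < θ)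
    (hL : ((P.T : ℝ) + 1) * m * Real.exp (-L) ≤ δ * θ)
    (hε : Δ / (P.η * P.T) + gradMod p μ lg₁ lg₂ lf₀ lf₁ P.η + 2 * s
        + 2 * (((Δ + gradMod p μ lg₁ lg₂ lf₀ lf₁ 1) / P.T + gradMod p μ lg₁ lg₂ lf₀ lf₁ P.η)
          / (1 - P.β))
        + 2 * (lg₁ * (lf₀ / μ) * contr μ P.C ^ P.Q
          + hyperLip μ lg₁ lg₂ lf₀ lf₁ * (R / 2 ^ ((m : ℝ) / p) + solMod p μ lg₁ (P.I * P.η)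
            + (((P.T : ℝ) + 1) * (m * R) + B + solMod p μ lg₁ (P.T * P.η)) * θ)) ≤ ε) :
    lowerLaw Dg {sy | ¬ ((∀ t ∈ Finset.range P.T, Integrable
          (fun sx => ‖gradient (hyperObj f g) (run p P F G x₀ y₀ sy sx t).x‖) (upperLaw Df Dg)) ∧
        (1 / (P.T : ℝ)) * ∑ t ∈ Finset.range P.T,
          ∫ sx, ‖gradient (hyperObj f g) (run p P F G x₀ y₀ sy sx t).x‖ ∂(upperLaw Df Dg) ≤ ε)}
      ≤ ENNReal.ofReal δ := by
  have : IsProbabilityMeasure (upperLaw Df Dg) := by unfold upperLaw; infer_instance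
  have : IsProbabilityMeasure (lowerLaw Dg) := by unfold lowerLaw; infer_instance
  have hR0 : 0 < R := hP.R_pos
  set κ := R / 2 ^ ((m : ℝ) / p) + solMod p μ lg₁ (P.I * P.η) with hκ
  have hκ0 : 0 ≤ κ := by
    have := solMod_nonneg (s := P.I * P.η) hp hμ hlg₁ (by positivity)
    positivity
  have hsT : 0 ≤ solMod p μ lg₁ (P.T * P.η) := solMod_nonneg hp hμ hlg₁ (by positivity)
  set M := ((P.T : ℝ) + 1) * (m * R) + B + solMod p μ lg₁ (P.T * P.η) with hM
  have hM0 : 0 ≤ M := by positivity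
  set S : Set ((ℕ × ℕ × ℕ → Z) × (ℕ → UpperSample Ξ Z)) := ⋃ n ∈ Finset.range P.T,
    {r | κ < ‖(run p P F G x₀ y₀ r.1 r.2 (n + 1)).y
      - lowerSol g (run p P F G x₀ y₀ r.1 r.2 n).x‖} with hSdef
  have hSm : MeasurableSet S := Finset.measurableSet_biUnion _ fun n _ =>
    measurableSet_lt measurable_const ((hO.measurable_run hS (n + 1)).2.1.sub
      ((hg.continuous_lowerSol hp hμ hlg₁).measurable.comp (hO.measurable_run hS n).1)).norm
  have hmem : ∀ sy sx, (sy, sx) ∈ S ↔ ∃ n < P.T, κ < ‖(run p P F G x₀ y₀ sy sx (n + 1)).y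
      - lowerSol g (run p P F G x₀ y₀ sy sx n).x‖ := fun sy sx => by
    simp only [hSdef, Set.mem_iUnion, Finset.mem_range, exists_prop, Set.mem_ofPred_eq]
  have hsec : ∀ sx, lowerLaw Dg {sy | (sy, sx) ∈ S} ≤ ENNReal.ofReal (δ * θ) := fun sx => by
    simp only [hmem]
    exact (hO.measure_tracking_fail_le hg hp hμ hlg₁ hσ hP hGd hS hI hη.le (h0.trans hBR) hR sx
      P.T).trans (ENNReal.ofReal_le_ofReal hL)
  refine (measure_mono fun sy hsy => ?_).trans
    (measure_section_ge_le (ν₂ := upperLaw Df Dg) hSm hθ hsec)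
  by_contra hlt
  rw [Set.mem_ofPred_eq, not_le] at hlt
  simp only [hmem] at hlt
  refine hsy ?_
  have hdet : ∀ sx : ℕ → UpperSample Ξ Z, ∀ n < P.T, ‖(run p P F G x₀ y₀ sy sx (n + 1)).y
      - lowerSol g (run p P F G x₀ y₀ sy sx n).x‖ ≤ M := by
    intro sx n hn
    have hn' : (n : ℝ) + 1 ≤ P.T := by exact_mod_cast hn
    have h1 := hS.norm_run_y_sub_le (F := F) (G := G) (x₀ := x₀) (y₀ := y₀) (by linarith) hR0.le
      sy sx (n + 1)
    have h2 := hg.lowerSol_holder hp hμ hlg₁ x₀ (run p P F G x₀ y₀ sy sx n).x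
    have h3 := norm_run_x_sub_le (p := p) (P := P) (F := F) (G := G) (x₀ := x₀) (y₀ := y₀)
      hη.le sy sx (Nat.zero_le n)
    rw [run_zero_x, Nat.sub_zero, norm_sub_rev] at h3
    have h4 := solMod_mono hp hμ hlg₁ (norm_nonneg _) (h3.trans
      (mul_le_mul_of_nonneg_right (show (n : ℝ) ≤ P.T by linarith) hη.le))
    have h5 : (((n + 1 : ℕ) : ℝ) + 1) * (m * R) ≤ ((P.T : ℝ) + 1) * (m * R) := by
      push_cast; gcongr
    calc _ = ‖((run p P F G x₀ y₀ sy sx (n + 1)).y - y₀) + (y₀ - lowerSol g x₀)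
          + (lowerSol g x₀ - lowerSol g (run p P F G x₀ y₀ sy sx n).x)‖ := by congr 1; abel
      _ ≤ _ := norm_add₃_le
      _ ≤ M := by rw [hM]; linarith
  have hmain := hO.integral_gradient_le hg hf hp hμ hlg₁ hlg₂ hlf₀ hlf₁ hS hCb hη hβ0 hβ1 hs hs2
    hT hκ0 hM0 hθ.le hdet hlt.le
  refine ⟨hmain.1, hmain.2.trans (le_trans ?_ hε)⟩
  have h6 := norm_gradient_initial_le hg hf hp hμ hlg₁ hlg₂ hlf₀ hlf₁ hΔ
  have hβ : 0 < 1 - P.β := by linarith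
  gcongr

end HighProbability

/-! ### Oracle calls -/

section Calls

variable {dx dy : ℕ} {Ξ Z : Type*} {p α R : ℝ} {K₁ m : ℕ} {P : Params}
  {F : Ξ → Vec dx → Vec dy → ℝ} {G : Z → Vec dx → Vec dy → ℝ} {x₀ : Vec dx} {y₀ : Vec dy}

/-- Besides the warm start there are `n / I` lower-level updates among the first `n` iterations. -/
lemma Schedule.run_calls (hS : Schedule p P α R K₁ m) (sy : ℕ × ℕ × ℕ → Z)
    (sx : ℕ → UpperSample Ξ Z) (n : ℕ) :
    (run p P F G x₀ y₀ sy sx n).calls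
      = (1 + n / P.I) * (∑ k ∈ Finset.range m, epochLen p K₁ k) + n * hyperGradCalls P.Q := by
  induction n with
  | zero => simp [run, hS.lowerUpdate_eq]
  | succ n ih =>
    rw [run]
    simp only [step, ih]
    by_cases hd : P.I ∣ n + 1
    · rw [if_pos hd, hS.lowerUpdate_eq, Nat.succ_div_of_dvd hd]
      ring
    · rw [if_neg hd, Nat.succ_div_of_not_dvd hd]
      ring

lemma hyperGradCalls_le (Q : ℕ) : hyperGradCalls Q ≤ 3 + Q ^ 2 := by
  unfold hyperGradCalls
  have : ∑ q ∈ Finset.range Q, q ≤ ∑ q ∈ Finset.range Q, Q :=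
    Finset.sum_le_sum fun q hq => (Finset.mem_range.mp hq).le
  rw [Finset.sum_const, Finset.card_range, smul_eq_mul] at this
  rw [sq]
  omega

end Calls

/-! ### The choice of the parameters -/

section Scalar

variable {p μ lg₁ lg₂ lf₀ lf₁ : ℝ}

lemma solMod_mul (hp : 2 ≤ p) (hμ : 0 < μ) (hlg₁ : 0 ≤ lg₁) {s t : ℝ} (hs : 0 ≤ s) (ht : 0 ≤ t) :
    solMod p μ lg₁ (s * t) = solMod p μ lg₁ s * t ^ (1 / (p - 1)) := by
  unfold solMod
  have hp0 : 0 < p := by linarith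
  rw [← Real.mul_rpow (by positivity) ht, mul_assoc]

lemma solMod_mul_rpow (hp : 2 ≤ p) (hμ : 0 < μ) (hlg₁ : 0 ≤ lg₁) {s ε : ℝ} (hs : 0 ≤ s)
    (hε : 0 < ε) (a : ℝ) :
    solMod p μ lg₁ (s * ε ^ a) = solMod p μ lg₁ s * ε ^ (a / (p - 1)) := by
  rw [solMod_mul hp hμ hlg₁ hs (by positivity), ← Real.rpow_mul hε.le, mul_one_div]

lemma rpow_anti {ε a b : ℝ} (hε : 0 < ε) (hε1 : ε ≤ 1) (h : a ≤ b) : ε ^ b ≤ ε ^ a :=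
  Real.rpow_le_rpow_of_exponent_ge hε hε1 h

/-- A step of length `O(ε^{3(p-1)})` changes the hypergradient by `O(ε³)`. -/
lemma gradMod_mul_rpow_le (hp : 2 ≤ p) (hμ : 0 < μ) (hlg₁ : 0 ≤ lg₁) (hlg₂ : 0 ≤ lg₂)
    (hlf₀ : 0 ≤ lf₀) (hlf₁ : 0 ≤ lf₁) {s ε : ℝ} (hs : 0 ≤ s) (hε : 0 < ε) (hε1 : ε ≤ 1) :
    gradMod p μ lg₁ lg₂ lf₀ lf₁ (s * ε ^ (3 * p - 3)) ≤ gradMod p μ lg₁ lg₂ lf₀ lf₁ s * ε ^ 3 := by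
  unfold gradMod
  have hH := hyperLip_nonneg hμ hlg₁ hlg₂ hlf₀ hlf₁
  have h3 : ε ^ (3 : ℝ) = ε ^ 3 := by exact_mod_cast Real.rpow_natCast ε 3
  rw [solMod_mul_rpow hp hμ hlg₁ hs hε,
    show (3 * p - 3) / (p - 1) = 3 by rw [div_eq_iff (by linarith)]; ring, h3]
  have h1 : ε ^ (3 * p - 3) ≤ ε ^ 3 := by
    rw [← h3]; exact rpow_anti hε hε1 (by linarith)
  calc _ ≤ hyperLip μ lg₁ lg₂ lf₀ lf₁ * (s * ε ^ 3 + solMod p μ lg₁ s * ε ^ 3) := by gcongr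
    _ = _ := by ring

/-- The constant of the step size is chosen after that of the momentum. -/
lemma exists_step_const (hp : 2 ≤ p) (lg₂ lf₀ lf₁ : ℝ) (c₁ G : ℝ) {e : ℝ} (he : 0 < e) :
    ∃ c₂, 0 < c₂ ∧ gradMod p μ lg₁ lg₂ lf₀ lf₁ c₂ ≤ e ∧ solMod p μ lg₁ (2 * c₂ / c₁) ≤ e ∧
      G * c₂ ≤ e := by
  have hpos : 0 < 1 / (p - 1) := by rw [one_div, inv_pos]; linarith
  have hc : Continuous (solMod p μ lg₁) := by
    unfold solMod
    exact (continuous_const.mul continuous_id).rpow_const fun _ => Or.inr hpos.le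
  have h0 : solMod p μ lg₁ 0 = 0 := by rw [solMod, mul_zero, Real.zero_rpow hpos.ne']
  have c1 : Continuous (gradMod p μ lg₁ lg₂ lf₀ lf₁) := by
    unfold gradMod; exact continuous_const.mul (continuous_id.add hc)
  have c2 : Continuous fun c₂ => solMod p μ lg₁ (2 * c₂ / c₁) :=
    hc.comp ((continuous_const.mul continuous_id).div_const c₁)
  have c3 : Continuous fun c₂ : ℝ => G * c₂ := continuous_const.mul continuous_id
  have e1 := c1.continuousAt.eventually_lt (x₀ := (0 : ℝ)) continuousAt_const
    (by simpa [gradMod, h0] using he)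
  have e2 := c2.continuousAt.eventually_lt (x₀ := (0 : ℝ)) continuousAt_const
    (by simpa [h0] using he)
  have e3 := c3.continuousAt.eventually_lt (x₀ := (0 : ℝ)) continuousAt_const (by simpa using he)
  have hall := ((e1.and (e2.and e3)).filter_mono nhdsWithin_le_nhds).and
    (self_mem_nhdsWithin (s := Set.Ioi (0 : ℝ)))
  obtain ⟨c₂, ⟨h1, h2, h3⟩, h4⟩ := hall.exists
  exact ⟨c₂, h4, h1.le, h2.le, h3.le⟩

/-- Constant step size and variance proxy satisfy the conditions on an epoch, once the first epoch
has a length proportional to the logarithm of the failure probability. -/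
lemma exists_epochParams (hp : 2 ≤ p) (hμ : 0 < μ) {σ Gd R : ℝ} (hσ : 0 < σ) (hR : 0 < R) :
    ∃ α v Kc : ℝ, 0 < α ∧ 0 < Kc ∧ ∀ L : ℝ, 1 ≤ L → ∀ K₁ : ℕ, Kc * L ≤ K₁ →
      EpochParams p μ σ Gd R α v L K₁ := by
  have hp0 : 0 < p := by linarith
  set v := μ * R ^ p / (10 * p) with hv
  have hv0 : 0 < v := by positivity
  set D := Gd ^ 2 + 2 * σ ^ 2 with hD
  have hD0 : 0 < D := by positivity
  set α := v / D with hα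
  have hα0 : 0 < α := by positivity
  have hαD : α * D = v := div_mul_cancel₀ _ hD0.ne'
  set k₁ := R ^ 2 / (2 * α * v) with hk₁
  set k₂ := 16 * R ^ 2 * σ ^ 2 / v ^ 2 with hk₂
  set k₃ := 4 * R * σ / v with hk₃
  have h1 : 0 ≤ k₁ := by positivity
  have h2 : 0 ≤ k₂ := by positivity
  have h3 : 0 ≤ k₃ := by positivity
  refine ⟨α, v, k₁ + k₂ + k₃ + 1, hα0, by positivity, fun L hL K₁ hK => ?_⟩
  have e1 : k₁ ≤ k₁ * L := le_mul_of_one_le_right h1 hL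
  have e2 : 0 ≤ k₂ * L := by positivity
  have e3 : 0 ≤ k₃ * L := by positivity
  refine ⟨hR, hα0, hv0, by linarith, ?_, ?_, ?_, ?_, ?_, ?_, ?_⟩
  · rw [hv]; field_simp; exact le_rfl
  · have : 0 ≤ α * (2 * σ ^ 2) := by positivity
    rw [hD, mul_add] at hαD
    linarith
  · have : 0 ≤ α * Gd ^ 2 := by positivity
    rw [hD, mul_add] at hαD
    linarith
  · linarith
  · have : 16 * L * R ^ 2 * σ ^ 2 / v ^ 2 = k₂ * L := by rw [hk₂]; ring
    linarith
  · have : 4 * L * R * σ / v = k₃ * L := by rw [hk₃]; ring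
    linarith
  · linarith

/-- The number of epochs that reduces the radius by a factor between `X` and `2 X`. -/
lemma exists_numEpochs (hp : 2 ≤ p) {X : ℝ} (hX : 1 ≤ X) :
    ∃ m : ℕ, X ≤ 2 ^ ((m : ℝ) / p) ∧ (2 : ℝ) ^ ((m : ℝ) / p) ≤ 2 * X := by
  have hp0 : 0 < p := by linarith
  have hX0 : 0 < X := by linarith
  have hlog : 0 ≤ Real.logb 2 X := Real.logb_nonneg (by norm_num) hX
  refine ⟨⌈p * Real.logb 2 X⌉₊, ?_, ?_⟩
  · rw [← Real.logb_le_iff_le_rpow (by norm_num) hX0, le_div_iff₀ hp0, mul_comm]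
    exact Nat.le_ceil _
  · have h1 := Nat.ceil_lt_add_one (show 0 ≤ p * Real.logb 2 X by positivity)
    calc (2 : ℝ) ^ ((⌈p * Real.logb 2 X⌉₊ : ℝ) / p) ≤ 2 ^ (Real.logb 2 X + 1) := by
          refine Real.rpow_le_rpow_of_exponent_le (by norm_num) ?_
          rw [div_le_iff₀ hp0]
          linarith
      _ = 2 * X := by
          rw [Real.rpow_add (by norm_num), Real.rpow_logb (by norm_num) (by norm_num) hX0,
            Real.rpow_one, mul_comm]

lemma natCast_le_two_rpow (hp : 2 ≤ p) (m : ℕ) : (m : ℝ) ≤ 2 * p * 2 ^ ((m : ℝ) / p) := by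
  have hp0 : 0 < p := by linarith
  have h1 : (1 : ℝ) / 2 ≤ Real.log 2 := by linarith [Real.log_two_gt_d9]
  have h2 : Real.log 2 * ((m : ℝ) / p) ≤ 2 ^ ((m : ℝ) / p) := by
    rw [Real.rpow_def_of_pos (by norm_num)]
    linarith [Real.add_one_le_exp (Real.log 2 * ((m : ℝ) / p))]
  have h3 : 1 / 2 * ((m : ℝ) / p) ≤ Real.log 2 * ((m : ℝ) / p) := by gcongr
  calc (m : ℝ) = 2 * p * (1 / 2 * ((m : ℝ) / p)) := by field_simp
    _ ≤ _ := by gcongr; exact h3.trans h2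

lemma log_inv_nonneg {ε : ℝ} (hε : 0 < ε) (hε1 : ε ≤ 1) : 0 ≤ Real.log (1 / ε) :=
  Real.log_nonneg ((one_le_div hε).mpr hε1)

/-- A Neumann series of logarithmic length has bias `O(ε)`. -/
lemma exists_truncation {q b : ℝ} (hq0 : 0 < q) (hq1 : q < 1) (hb : 0 ≤ b) :
    ∃ Qc : ℝ, 0 < Qc ∧ ∀ ε, 0 < ε → ε ≤ 1 → ∃ Q : ℕ, 1 ≤ Q ∧
      (Q : ℝ) ≤ Qc * (1 + Real.log (1 / ε)) ∧ b * q ^ Q ≤ ε / 32 := by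
  have hq : 0 < 1 - q := by linarith
  set c := 32 * (b + 1) with hc
  have hc0 : 0 < c := by positivity
  refine ⟨(1 + c) / (1 - q) + 1, by positivity, fun ε hε hε1 => ?_⟩
  have hl := log_inv_nonneg hε hε1
  set y := (1 + c) / (1 - q) * (1 + Real.log (1 / ε)) with hy
  have hy0 : 0 < y := by positivity
  refine ⟨⌈y⌉₊, Nat.one_le_iff_ne_zero.mpr (Nat.ceil_pos.mpr hy0).ne', ?_, ?_⟩
  · have := Nat.ceil_lt_add_one hy0.le
    rw [add_mul, one_mul]
    linarith
  · have h1 : q ≤ Real.exp (-(1 - q)) := by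
      have := Real.add_one_le_exp (-(1 - q))
      linarith
    have h2 : (1 - q) * y = (1 + c) * (1 + Real.log (1 / ε)) := by rw [hy]; field_simp
    have h3 : Real.log (1 / ε) + c ≤ (1 - q) * y := by
      rw [h2]; nlinarith
    have h4 : q ^ ⌈y⌉₊ ≤ ε / c := by
      calc q ^ ⌈y⌉₊ ≤ Real.exp (-(1 - q)) ^ ⌈y⌉₊ := by gcongr
        _ = Real.exp (-((1 - q) * ⌈y⌉₊)) := by rw [← Real.exp_nat_mul]; ring_nf
        _ ≤ Real.exp (-(Real.log (1 / ε) + c)) := by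
            refine Real.exp_le_exp.mpr (neg_le_neg (h3.trans ?_))
            have := Nat.le_ceil y
            gcongr
        _ = ε * Real.exp (-c) := by
            rw [neg_add, Real.exp_add, one_div, Real.log_inv, neg_neg, Real.exp_log hε]
        _ ≤ ε / c := by
            rw [Real.exp_neg, ← div_eq_mul_inv]
            have := Real.add_one_le_exp c
            gcongr
            linarith
    calc b * q ^ ⌈y⌉₊ ≤ b * (ε / c) := by gcongr
      _ = ε / 32 * (b / (b + 1)) := by rw [hc]; field_simp
      _ ≤ ε / 32 * 1 := by
          gcongr
          rw [div_le_one (by linarith)]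
          linarith
      _ = _ := mul_one _

lemma one_le_logFactor {ε δ : ℝ} (hε : 0 < ε) (hε1 : ε ≤ 1) (hδ : 0 < δ) (hδ1 : δ < 1) :
    1 + Real.log (1 / ε) ≤ logFactor ε δ ∧ 1 ≤ logFactor ε δ := by
  have h1 := log_inv_nonneg hε hε1
  have h2 := log_inv_nonneg hδ hδ1.le
  have h3 : Real.log (1 / (ε * δ)) = Real.log (1 / ε) + Real.log (1 / δ) := by
    rw [← Real.log_mul (by positivity) (by positivity)]
    congr 1; field_simp
  unfold logFactor
  rw [h3]
  constructor <;> linarith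

/-- A failure probability that is polynomial in `ε` and linear in `δ` costs a logarithmic factor. -/
lemma exp_neg_logFactor_le {ε δ a N : ℝ} (hε : 0 < ε) (hε1 : ε ≤ 1) (hδ : 0 < δ) (hδ1 : δ < 1)
    (ha : 1 ≤ a) (hN : 0 ≤ N) :
    N * Real.exp (-((a + N) * logFactor ε δ)) ≤ δ * ε ^ a := by
  have hεδ : 0 < ε * δ := by positivity
  have hl := (one_le_logFactor hε hε1 hδ hδ1).2
  have hlog : Real.log (1 / (ε * δ)) = -Real.log (ε * δ) := by rw [one_div, Real.log_inv]
  have h1 : N + a * Real.log (1 / (ε * δ)) ≤ (a + N) * logFactor ε δ := by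
    have h2 : (a + N) * logFactor ε δ = a * logFactor ε δ + N * logFactor ε δ := add_mul _ _ _
    have h3 : N * 1 ≤ N * logFactor ε δ := by gcongr
    have h4 : a * logFactor ε δ = a + a * Real.log (1 / (ε * δ)) := by unfold logFactor; ring
    linarith
  calc N * Real.exp (-((a + N) * logFactor ε δ))
      ≤ N * Real.exp (-(N + a * Real.log (1 / (ε * δ)))) := by
        gcongr
    _ = (N * Real.exp (-N)) * (ε * δ) ^ a := by
        rw [neg_add, Real.exp_add, hlog, Real.rpow_def_of_pos hεδ, mul_assoc]
        congr 3; ring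
    _ ≤ 1 * (ε * δ) ^ a := by
        gcongr
        rw [Real.exp_neg, ← div_eq_mul_inv, div_le_one (Real.exp_pos _)]
        linarith [Real.add_one_le_exp N]
    _ = δ ^ a * ε ^ a := by rw [one_mul, Real.mul_rpow hε.le hδ.le, mul_comm]
    _ ≤ δ * ε ^ a := by
        gcongr
        calc δ ^ a ≤ δ ^ (1 : ℝ) := rpow_anti hδ hδ1.le ha
          _ = δ := Real.rpow_one δ

end Scalar

section Tuning

variable {p μ L₀ L₁ lg₁ lg₂ C lf₀ lf₁ Δ σf σg₁ σg₂ B : ℝ}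

lemma hessBound_sum (hμ : 0 < μ) (hC : 0 < C) :
    HessBound μ C σg₂ (C + 2 * μ + (C ^ 2 + σg₂ ^ 2) / μ) := by
  have h : 0 ≤ (C ^ 2 + σg₂ ^ 2) / μ := by positivity
  refine ⟨by linarith, by linarith, ?_⟩
  have e : μ * ((C ^ 2 + σg₂ ^ 2) / μ) = C ^ 2 + σg₂ ^ 2 := by field_simp
  have h2 : 0 ≤ μ * (C + 2 * μ) := by positivity
  rw [mul_add, e]
  linarith

/-- The number of iterations is of the order `ε^{-3p+2}`. -/
lemma iterations_bounds (hp : 2 ≤ p) (hΔ : 0 < Δ) {c₂ ε η : ℝ} (hc₂ : 0 < c₂) (hε : 0 < ε)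
    (hε1 : ε ≤ 1) (hη : η = c₂ * ε ^ (3 * p - 3)) {T : ℕ} (hT : T = ⌈8 * Δ / (η * ε)⌉₊) :
    1 ≤ T ∧ Δ / (η * T) ≤ ε / 8 ∧ (T : ℝ) ≤ (8 * Δ / c₂ + 1) * ε ^ (-3 * p + 2) ∧
      (T : ℝ) * η ≤ (8 * Δ + c₂) * ε ^ (-1 : ℝ) ∧ 1 / (T : ℝ) ≤ c₂ / (8 * Δ) * ε ^ 3 := by
  have hη0 : 0 < η := by rw [hη]; positivity
  have hx : 0 < 8 * Δ / (η * ε) := by positivity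
  have hT1 : 1 ≤ T := by rw [hT]; exact Nat.one_le_iff_ne_zero.mpr (Nat.ceil_pos.mpr hx).ne'
  have hT0 : (0 : ℝ) < T := by exact_mod_cast hT1
  have hle : 8 * Δ / (η * ε) ≤ T := by rw [hT]; exact Nat.le_ceil _
  have hlt : (T : ℝ) ≤ 8 * Δ / (η * ε) + 1 := by
    rw [hT]; exact (Nat.ceil_lt_add_one hx.le).le
  have hηε : η * ε = c₂ * ε ^ (3 * p - 2) := by
    rw [hη, mul_assoc, ← Real.rpow_add_one hε.ne']
    congr 2; ring
  have hinv : ε ^ (-3 * p + 2) = (ε ^ (3 * p - 2))⁻¹ := by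
    rw [← Real.rpow_neg hε.le]; congr 1; ring
  have h1 : (1 : ℝ) ≤ ε ^ (-3 * p + 2) :=
    Real.one_le_rpow_of_pos_of_le_one_of_nonpos hε hε1 (by linarith)
  have hm : 8 * Δ ≤ T * (η * ε) := (div_le_iff₀ (by positivity)).mp hle
  refine ⟨hT1, ?_, ?_, ?_, ?_⟩
  · rw [div_le_iff₀ (by positivity)]
    linarith
  · calc (T : ℝ) ≤ 8 * Δ / c₂ * ε ^ (-3 * p + 2) + 1 := by
          rw [hinv, ← div_eq_mul_inv, div_div, ← hηε]; exact hlt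
      _ ≤ 8 * Δ / c₂ * ε ^ (-3 * p + 2) + 1 * ε ^ (-3 * p + 2) := by rw [one_mul]; gcongr
      _ = _ := by ring
  · rw [Real.rpow_neg_one, ← div_eq_mul_inv, le_div_iff₀ hε]
    have h3 : T * (η * ε) ≤ 8 * Δ + η * ε := by
      calc T * (η * ε) ≤ (8 * Δ / (η * ε) + 1) * (η * ε) := by gcongr
        _ = _ := by field_simp
    have h4 : η * ε ≤ c₂ := by
      rw [hηε]
      exact mul_le_of_le_one_right hc₂.le (Real.rpow_le_one hε.le hε1 (by linarith))
    linarith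
  · have h3 : ε ^ (3 * p - 2) ≤ ε ^ 3 := by
      rw [show ε ^ 3 = ε ^ (3 : ℝ) by exact_mod_cast (Real.rpow_natCast ε 3).symm]
      exact rpow_anti hε hε1 (by linarith)
    calc 1 / (T : ℝ) ≤ η * ε / (8 * Δ) := by
          rw [div_le_div_iff₀ hT0 (by positivity)]
          linarith
      _ = c₂ / (8 * Δ) * ε ^ (3 * p - 2) := by rw [hηε]; ring
      _ ≤ _ := by gcongr

/-- The period of the lower-level updates: the drift of the solution in one period is `O(ε)`. -/
lemma period_bounds (hp : 2 ≤ p) (hμ : 0 < μ) (hlg₁ : 0 ≤ lg₁) {c₁ c₂ ε η : ℝ} (hc₁ : 0 < c₁)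
    (hc₁1 : c₁ ≤ 1) (hc₂ : 0 < c₂) (hε : 0 < ε) (hε1 : ε ≤ 1) (hη : η = c₂ * ε ^ (3 * p - 3))
    {I : ℕ} (hI : I = ⌈1 / (c₁ * ε ^ 2)⌉₊) :
    1 ≤ I ∧ 1 / (I : ℝ) ≤ ε ^ 2 ∧
      solMod p μ lg₁ (I * η) ≤ solMod p μ lg₁ (2 * c₂ / c₁) * ε := by
  have hc : 0 < c₁ * ε ^ 2 := by positivity
  have hx : 0 < 1 / (c₁ * ε ^ 2) := by positivity
  have hI1 : 1 ≤ I := by rw [hI]; exact Nat.one_le_iff_ne_zero.mpr (Nat.ceil_pos.mpr hx).ne'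
  have hI0 : (0 : ℝ) < I := by exact_mod_cast hI1
  have hle : 1 / (c₁ * ε ^ 2) ≤ I := by rw [hI]; exact Nat.le_ceil _
  have hc1 : c₁ * ε ^ 2 ≤ 1 := mul_le_one₀ hc₁1 (by positivity) (pow_le_one₀ hε.le hε1)
  have hlt : (I : ℝ) ≤ 2 / (c₁ * ε ^ 2) := by
    have h1 := (Nat.ceil_lt_add_one hx.le).le
    have h2 : 1 ≤ 1 / (c₁ * ε ^ 2) := (one_le_div hc).mpr hc1
    rw [← hI] at h1
    calc (I : ℝ) ≤ 1 / (c₁ * ε ^ 2) + 1 / (c₁ * ε ^ 2) := by linarith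
      _ = _ := by ring
  have hη0 : 0 < η := by rw [hη]; positivity
  refine ⟨hI1, ?_, ?_⟩
  · rw [div_le_iff₀ hI0]
    have h1 : 1 ≤ I * (c₁ * ε ^ 2) := (div_le_iff₀ hc).mp hle
    have h2 : c₁ * ε ^ 2 ≤ 1 * ε ^ 2 := by gcongr
    nlinarith
  · have e : 2 / (c₁ * ε ^ 2) * η = 2 * c₂ / c₁ * ε ^ (3 * p - 5) := by
      have : ε ^ (3 * p - 3) = ε ^ (3 * p - 5) * ε ^ 2 := by
        rw [← Real.rpow_natCast ε 2, ← Real.rpow_add hε]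
        congr 1; push_cast; ring
      rw [hη, this]; field_simp
    have h1 : I * η ≤ 2 * c₂ / c₁ * ε ^ (3 * p - 5) := by
      rw [← e]; gcongr
    refine (solMod_mono hp hμ hlg₁ (by positivity) h1).trans ?_
    rw [solMod_mul_rpow hp hμ hlg₁ (by positivity) hε]
    have h2 := solMod_nonneg (s := 2 * c₂ / c₁) hp hμ hlg₁ (by positivity)
    gcongr
    calc ε ^ ((3 * p - 5) / (p - 1)) ≤ ε ^ (1 : ℝ) := by
          refine rpow_anti hε hε1 ?_
          rw [le_div_iff₀ (by linarith)]
          linarith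
      _ = ε := Real.rpow_one ε

/-- With `m` epochs the radius is reduced to the order `ε`, and the budget is of the order
`ε^{-2p+2}`. -/
lemma epochs_bounds (hp : 2 ≤ p) {R a ε : ℝ} (hR : 1 ≤ R) (ha : 0 < a) (ha1 : a ≤ 1) (hε : 0 < ε)
    (hε1 : ε ≤ 1) : ∃ m : ℕ, R / 2 ^ ((m : ℝ) / p) ≤ a * ε ∧
      (m : ℝ) ≤ 4 * p * R / a * ε ^ (-1 : ℝ) ∧
      ∀ K₁ : ℕ, 1 ≤ K₁ → ((∑ k ∈ Finset.range m, epochLen p K₁ k : ℕ) : ℝ)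
        ≤ 2 * K₁ * (2 * R / a) ^ (2 * p - 2) * ε ^ (-2 * p + 2) := by
  have hp0 : 0 < p := by linarith
  have hR0 : 0 < R := by linarith
  have haε : 0 < a * ε := by positivity
  have hX : 1 ≤ R / (a * ε) := by
    rw [one_le_div haε]
    exact (mul_le_one₀ ha1 hε.le hε1).trans hR
  obtain ⟨m, h1, h2⟩ := exists_numEpochs hp hX
  refine ⟨m, ?_, ?_, fun K₁ hK => ?_⟩
  · rw [div_le_iff₀ (by positivity)]
    rw [div_le_iff₀ haε] at h1
    linarith
  · calc (m : ℝ) ≤ 2 * p * 2 ^ ((m : ℝ) / p) := natCast_le_two_rpow hp m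
      _ ≤ 2 * p * (2 * (R / (a * ε))) := by gcongr
      _ = _ := by rw [Real.rpow_neg_one]; field_simp; ring
  · refine (sum_epochLen_le hp hK m).trans ?_
    have e : (2 : ℝ) ^ (2 * (p - 1) / p * (m : ℝ)) = (2 ^ ((m : ℝ) / p)) ^ (2 * p - 2) := by
      rw [← Real.rpow_mul (by norm_num)]
      congr 1; field_simp
    have e2 : (2 * R / a) ^ (2 * p - 2) * ε ^ (-2 * p + 2) = (2 * (R / (a * ε))) ^ (2 * p - 2) := by
      rw [show -2 * p + 2 = -(2 * p - 2) by ring, Real.rpow_neg hε.le, ← Real.inv_rpow hε.le,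
        ← Real.mul_rpow (by positivity) (by positivity)]
      congr 1; field_simp
    rw [e, mul_assoc (2 * (K₁ : ℝ)), e2]
    gcongr
    linarith

end Tuning

section Tuning

variable {p μ L₀ L₁ lg₁ lg₂ C lf₀ lf₁ Δ σf σg₁ σg₂ B : ℝ}

/-- There are `O(T ε²)` lower-level updates, each of which costs `K` calls. -/
lemma calls_bound (hp : 2 ≤ p) {ε ℓ T₀ k₂ q₀ : ℝ} {T I K Q : ℕ} (hε : 0 < ε) (hε1 : ε ≤ 1)
    (hℓ : 1 ≤ ℓ) (hT₀ : 0 ≤ T₀) (hT : (T : ℝ) ≤ T₀ * ε ^ (-3 * p + 2)) (hI : 1 / (I : ℝ) ≤ ε ^ 2)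
    (hK : (K : ℝ) ≤ k₂ * ε ^ (-2 * p + 2) * ℓ ^ 2) (hQ : (Q : ℝ) ≤ q₀ * ℓ) :
    (((1 + T / I) * K + T * hyperGradCalls Q : ℕ) : ℝ)
      ≤ ((1 + T₀) * k₂ + T₀ * (3 + q₀ ^ 2)) * ε ^ (-5 * p + 6) * ℓ ^ 2 := by
  have h2 : ε ^ 2 = ε ^ (2 : ℝ) := by exact_mod_cast (Real.rpow_natCast ε 2).symm
  have hdiv : 1 + ((T / I : ℕ) : ℝ) ≤ (1 + T₀) * ε ^ (-3 * p + 4) := by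
    have h3 : ((T / I : ℕ) : ℝ) ≤ T₀ * ε ^ (-3 * p + 4) := by
      calc ((T / I : ℕ) : ℝ) ≤ (T : ℝ) * (1 / I) := by
            rw [mul_one_div]; exact Nat.cast_div_le
        _ ≤ T₀ * ε ^ (-3 * p + 2) * ε ^ (2 : ℝ) := by rw [← h2]; gcongr
        _ = T₀ * ε ^ (-3 * p + 4) := by
            rw [mul_assoc, ← Real.rpow_add hε]; congr 2; ring
    have h4 : (1 : ℝ) ≤ ε ^ (-3 * p + 4) :=
      Real.one_le_rpow_of_pos_of_le_one_of_nonpos hε hε1 (by linarith)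
    rw [add_mul, one_mul]
    exact add_le_add h4 h3
  have hlow : (1 + ((T / I : ℕ) : ℝ)) * K
      ≤ (1 + T₀) * k₂ * ε ^ (-5 * p + 6) * ℓ ^ 2 := by
    calc (1 + ((T / I : ℕ) : ℝ)) * K
        ≤ ((1 + T₀) * ε ^ (-3 * p + 4)) * (k₂ * ε ^ (-2 * p + 2) * ℓ ^ 2) := by gcongr
      _ = (1 + T₀) * k₂ * (ε ^ (-3 * p + 4) * ε ^ (-2 * p + 2)) * ℓ ^ 2 := by ring
      _ = _ := by rw [← Real.rpow_add hε]; congr 3; ring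
  have hup : (T : ℝ) * hyperGradCalls Q ≤ T₀ * (3 + q₀ ^ 2) * ε ^ (-5 * p + 6) * ℓ ^ 2 := by
    have h5 : (hyperGradCalls Q : ℝ) ≤ (3 + q₀ ^ 2) * ℓ ^ 2 := by
      have h6 : (hyperGradCalls Q : ℝ) ≤ 3 + (Q : ℝ) ^ 2 := by exact_mod_cast hyperGradCalls_le Q
      have h7 : (Q : ℝ) ^ 2 ≤ (q₀ * ℓ) ^ 2 := by gcongr
      have h8 : 1 ≤ ℓ ^ 2 := one_le_pow₀ hℓ
      nlinarith
    have h9 : ε ^ (-3 * p + 2) ≤ ε ^ (-5 * p + 6) := rpow_anti hε hε1 (by linarith)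
    calc (T : ℝ) * hyperGradCalls Q ≤ (T₀ * ε ^ (-5 * p + 6)) * ((3 + q₀ ^ 2) * ℓ ^ 2) := by
          gcongr
          exact hT.trans (by gcongr)
      _ = _ := by ring
  push_cast
  calc _ ≤ (1 + T₀) * k₂ * ε ^ (-5 * p + 6) * ℓ ^ 2
        + T₀ * (3 + q₀ ^ 2) * ε ^ (-5 * p + 6) * ℓ ^ 2 := add_le_add hlow hup
    _ = _ := by ring

set_option maxHeartbeats 1000000 in
/-- The choice of all parameters: the prescribed step sizes together with Epoch-SGD parameters, for
which the error bound and the failure probability of the analysis are at most `ε` and `δ`. -/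
lemma exists_tuning (hp : 2 ≤ p) (hμ : 0 < μ) (hlg₁ : 0 ≤ lg₁) (hlg₂ : 0 ≤ lg₂) (hC : 0 < C)
    (hlf₀ : 0 ≤ lf₀) (hlf₁ : 0 ≤ lf₁) (hΔ : 0 < Δ) (hσg₁ : 0 < σg₁) (hB : 0 ≤ B) (σf σg₂ Gd : ℝ) :
    ∃ Cb : ℝ, HessBound μ C σg₂ Cb ∧ ∃ c₁ c₂ A α v : ℝ, 0 < c₁ ∧ c₁ ≤ 1 ∧ 0 < c₂ ∧ 0 < A ∧
      α ≤ A ∧ B + 1 ≤ A ∧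
    ∀ ε δ : ℝ, 0 < ε → ε ≤ 1 → 0 < δ → δ < 1 → ∃ (P : Params) (K₁ m : ℕ) (L s θ : ℝ),
      P.C = Cb ∧ 1 - P.β = c₁ * ε ^ 2 ∧ P.η = c₂ * ε ^ (3 * p - 3) ∧
      P.I = ⌈1 / (1 - P.β)⌉₊ ∧ P.T = ⌈8 * Δ / (P.η * ε)⌉₊ ∧
      1 ≤ P.Q ∧ (P.Q : ℝ) ≤ A * (1 + Real.log (1 / ε)) ∧
      (K₁ : ℝ) ≤ A * logFactor ε δ ^ (2 : ℝ) ∧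
      (∀ t, (P.K t : ℝ) ≤ A * ε ^ (-2 * p + 2) * logFactor ε δ ^ (2 : ℝ)) ∧
      Schedule p P α (B + 1) K₁ m ∧ EpochParams p μ σg₁ Gd (B + 1) α v L K₁ ∧
      1 ≤ P.I ∧ 1 ≤ P.T ∧ 0 < s ∧ (1 - P.β) * hyperStd μ lg₁ lf₀ σf σg₂ ^ 2 ≤ s ^ 2 ∧ 0 < θ ∧
      ((P.T : ℝ) + 1) * m * Real.exp (-L) ≤ δ * θ ∧
      (B + 1) / 2 ^ ((m : ℝ) / p) + solMod p μ lg₁ (P.I * P.η) ≤ B + 1 ∧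
      Δ / (P.η * P.T) + gradMod p μ lg₁ lg₂ lf₀ lf₁ P.η + 2 * s
        + 2 * (((Δ + gradMod p μ lg₁ lg₂ lf₀ lf₁ 1) / P.T + gradMod p μ lg₁ lg₂ lf₀ lf₁ P.η)
          / (1 - P.β))
        + 2 * (lg₁ * (lf₀ / μ) * contr μ P.C ^ P.Q + hyperLip μ lg₁ lg₂ lf₀ lf₁
          * ((B + 1) / 2 ^ ((m : ℝ) / p) + solMod p μ lg₁ (P.I * P.η)
            + (((P.T : ℝ) + 1) * (m * (B + 1)) + B + solMod p μ lg₁ (P.T * P.η)) * θ)) ≤ ε ∧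
      (((1 + P.T / P.I) * (∑ k ∈ Finset.range m, epochLen p K₁ k)
          + P.T * hyperGradCalls P.Q : ℕ) : ℝ)
        ≤ A * ε ^ (-5 * p + 6) * logFactor ε δ ^ (2 : ℝ) := by
  have hp0 : 0 < p := by linarith
  have hCb := hessBound_sum (σg₂ := σg₂) hμ hC
  set Cb := C + 2 * μ + (C ^ 2 + σg₂ ^ 2) / μ with hCbdef
  set H := hyperLip μ lg₁ lg₂ lf₀ lf₁ with hH
  have hH0 : 0 ≤ H := hyperLip_nonneg hμ hlg₁ hlg₂ hlf₀ hlf₁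
  set S₀ := hyperStd μ lg₁ lf₀ σf σg₂ with hS₀
  set G₀ := Δ + gradMod p μ lg₁ lg₂ lf₀ lf₁ 1 with hG₀
  have hG₀0 : 0 ≤ G₀ := by
    have := gradMod_nonneg (s := 1) hp hμ hlg₁ hlg₂ hlf₀ hlf₁ zero_le_one
    linarith
  set R := B + 1 with hR
  have hR1 : 1 ≤ R := by linarith
  have hR0 : 0 < R := by linarith
  clear_value Cb H S₀ G₀ R
  -- `c₁` controls the noise, `a` the accuracy of the lower variable, and `c₂` everything that moves
  -- while the momentum forgets
  set c₁ := 1 / (256 * S₀ ^ 2 + 1) with hc₁def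
  have hc₁ : 0 < c₁ := by positivity
  have hc₁1 : c₁ ≤ 1 := by
    rw [hc₁def, div_le_one (by positivity)]
    have := sq_nonneg S₀
    linarith
  have hc₁S : c₁ * S₀ ^ 2 ≤ 1 / 256 := by
    rw [hc₁def, one_div_mul_eq_div, div_le_div_iff₀ (by positivity) (by norm_num)]
    linarith
  set a := 1 / (32 * (H + 1)) with hadef
  have ha : 0 < a := by positivity
  have haH : H * a ≤ 1 / 32 := by
    rw [hadef, mul_one_div, div_le_div_iff₀ (by positivity) (by norm_num)]
    linarith
  have ha1 : a ≤ 1 / 32 := by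
    rw [hadef]
    exact one_div_le_one_div_of_le (by norm_num) (by linarith)
  clear_value c₁ a
  obtain ⟨c₂, hc₂, hgc₂, hsc₂, hGc₂⟩ := exists_step_const (μ := μ) (lg₁ := lg₁) hp lg₂ lf₀ lf₁ c₁ G₀
    (e := min (c₁ / 32) (min a (Δ * c₁ / 4))) (by positivity)
  replace hgc₂ := hgc₂.trans (min_le_left _ _)
  replace hsc₂ := hsc₂.trans ((min_le_right _ _).trans (min_le_left _ _))
  replace hGc₂ := hGc₂.trans ((min_le_right _ _).trans (min_le_right _ _))
  obtain ⟨α, v, Kc, hα, hKc, hEpoch⟩ := exists_epochParams (σ := σg₁) (Gd := Gd) hp hμ hσg₁ hR0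
  obtain ⟨Qc, hQc, hQ⟩ := exists_truncation (contr_pos hμ hCb) (contr_lt_one hμ hCb)
    (show 0 ≤ lg₁ * (lf₀ / μ) by positivity)
  set T₀ := 8 * Δ / c₂ + 1 with hT₀
  have hT₀0 : 0 < T₀ := by positivity
  set m₀ := 4 * p * R / a with hm₀
  have hm₀0 : 0 < m₀ := by positivity
  set d₀ := solMod p μ lg₁ (8 * Δ + c₂) with hd₀
  have hd₀0 : 0 ≤ d₀ := solMod_nonneg hp hμ hlg₁ (by positivity)
  set M₀ := (T₀ + 1) * m₀ * R + B + d₀ with hM₀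
  have hM₀0 : 0 < M₀ := by positivity
  set θ₀ := a / M₀ with hθ₀
  have hθ₀0 : 0 < θ₀ := by positivity
  set N := (T₀ + 1) * m₀ / θ₀ with hN
  have hN0 : 0 < N := by positivity
  set Lc := 6 * p - 1 + N with hLc
  have hLc1 : 1 ≤ Lc := by linarith
  set k₁ := Kc * Lc + 1 with hk₁
  have hk₁0 : 0 < k₁ := by positivity
  set k₂ := 2 * k₁ * (2 * R / a) ^ (2 * p - 2) with hk₂
  have hk₂0 : 0 < k₂ := by positivity
  set k₃ := (1 + T₀) * k₂ + T₀ * (3 + Qc ^ 2) with hk₃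
  have hk₃0 : 0 < k₃ := by positivity
  clear_value T₀ m₀ d₀ M₀ θ₀ N Lc k₁ k₂ k₃
  refine ⟨Cb, hCb, c₁, c₂, α + R + Qc + k₁ + k₂ + k₃, α, v, hc₁, hc₁1, hc₂, by positivity,
    by linarith, by linarith, ?_⟩
  set A := α + R + Qc + k₁ + k₂ + k₃ with hA
  have hA0 : 0 < A := by positivity
  clear_value A
  intro ε δ hε hε1 hδ hδ1
  obtain ⟨hlogle, hℓ⟩ := one_le_logFactor hε hε1 hδ hδ1
  set ℓ := logFactor ε δ with hℓdef
  obtain ⟨Q, hQ1, hQle, hQb⟩ := hQ ε hε hε1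
  obtain ⟨m, hmρ, hmle, hmK⟩ := epochs_bounds hp hR1 ha (by linarith) hε hε1
  set L := Lc * ℓ with hLdef
  have hL1 : 1 ≤ L := one_le_mul_of_one_le_of_one_le hLc1 hℓ
  set K₁ := ⌈Kc * L⌉₊ with hK₁def
  have hKL : Kc * L ≤ K₁ := Nat.le_ceil _
  have hK₁1 : 1 ≤ K₁ := Nat.one_le_iff_ne_zero.mpr (Nat.ceil_pos.mpr (by positivity)).ne'
  have hK₁le : (K₁ : ℝ) ≤ k₁ * ℓ := by
    have h1 := (Nat.ceil_lt_add_one (show 0 ≤ Kc * L by positivity)).le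
    have h2 : k₁ * ℓ = Kc * L + ℓ := by rw [hk₁, hLdef]; ring
    rw [h2]
    exact h1.trans (by linarith)
  set η := c₂ * ε ^ (3 * p - 3) with hη
  set I := ⌈1 / (c₁ * ε ^ 2)⌉₊ with hI
  set T := ⌈8 * Δ / (η * ε)⌉₊ with hT
  obtain ⟨hT1, hTΔ, hTle, hTη, hTinv⟩ := iterations_bounds hp hΔ hc₂ hε hε1 hη hT
  obtain ⟨hI1, hIinv, hIη⟩ := period_bounds hp hμ hlg₁ hc₁ hc₁1 hc₂ hε hε1 hη hI
  rw [← hT₀] at hTle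
  rw [← hm₀] at hmle
  have hη0 : 0 < η := by positivity
  clear_value ℓ L K₁ η I T
  have hℓ2 : ℓ ^ (2 : ℝ) = ℓ ^ 2 := by exact_mod_cast Real.rpow_natCast ℓ 2
  have hℓℓ : ℓ ≤ ℓ ^ 2 := le_self_pow₀ hℓ two_ne_zero
  have hℓ20 : 0 < ℓ ^ 2 := by positivity
  have hβ : 1 - (1 - c₁ * ε ^ 2) = c₁ * ε ^ 2 := by ring
  have hε3 : ε ^ 3 ≤ ε := by
    calc ε ^ 3 = ε * ε ^ 2 := by ring
      _ ≤ ε * 1 := by gcongr; exact pow_le_one₀ hε.le hε1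
      _ = ε := mul_one _
  have hKm : ((∑ k ∈ Finset.range m, epochLen p K₁ k : ℕ) : ℝ)
      ≤ k₂ * ε ^ (-2 * p + 2) * ℓ ^ 2 := by
    have h1 : (K₁ : ℝ) ≤ k₁ * ℓ ^ 2 := hK₁le.trans (by gcongr)
    calc _ ≤ 2 * (K₁ : ℝ) * (2 * R / a) ^ (2 * p - 2) * ε ^ (-2 * p + 2) := hmK K₁ hK₁1
      _ ≤ 2 * (k₁ * ℓ ^ 2) * (2 * R / a) ^ (2 * p - 2) * ε ^ (-2 * p + 2) := by gcongr
      _ = _ := by rw [hk₂]; ring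
  -- the total number of epochs is polynomial in `1 / ε`
  have hTm : ((T : ℝ) + 1) * m ≤ (T₀ + 1) * m₀ * ε ^ (-3 * p + 1) := by
    have h1 : (1 : ℝ) ≤ ε ^ (-3 * p + 2) :=
      Real.one_le_rpow_of_pos_of_le_one_of_nonpos hε hε1 (by linarith)
    calc ((T : ℝ) + 1) * m ≤ ((T₀ + 1) * ε ^ (-3 * p + 2)) * (m₀ * ε ^ (-1 : ℝ)) := by
          gcongr
          rw [add_mul, one_mul]
          exact add_le_add hTle h1
      _ = (T₀ + 1) * m₀ * (ε ^ (-3 * p + 2) * ε ^ (-1 : ℝ)) := by ring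
      _ = _ := by rw [← Real.rpow_add hε]; congr 2; ring
  have hM : ((T : ℝ) + 1) * (m * R) + B + solMod p μ lg₁ (T * η) ≤ M₀ * ε ^ (-3 * p + 1) := by
    have h1 : (1 : ℝ) ≤ ε ^ (-3 * p + 1) :=
      Real.one_le_rpow_of_pos_of_le_one_of_nonpos hε hε1 (by linarith)
    have h2 : solMod p μ lg₁ (T * η) ≤ d₀ * ε ^ (-3 * p + 1) := by
      refine (solMod_mono hp hμ hlg₁ (by positivity) hTη).trans ?_
      rw [solMod_mul_rpow hp hμ hlg₁ (by positivity) hε, ← hd₀]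
      refine mul_le_mul_of_nonneg_left (rpow_anti hε hε1 ?_) hd₀0
      rw [le_div_iff₀ (by linarith)]
      have := mul_nonneg (sub_nonneg.mpr hp) hp0.le
      linarith
    have h3 : B ≤ B * ε ^ (-3 * p + 1) := le_mul_of_one_le_right hB h1
    have h4 : ((T : ℝ) + 1) * (m * R) ≤ (T₀ + 1) * m₀ * R * ε ^ (-3 * p + 1) := by
      calc ((T : ℝ) + 1) * (m * R) = ((T : ℝ) + 1) * m * R := by ring
        _ ≤ (T₀ + 1) * m₀ * ε ^ (-3 * p + 1) * R := by gcongr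
        _ = _ := by ring
    have h5 : M₀ * ε ^ (-3 * p + 1) = (T₀ + 1) * m₀ * R * ε ^ (-3 * p + 1)
        + B * ε ^ (-3 * p + 1) + d₀ * ε ^ (-3 * p + 1) := by rw [hM₀]; ring
    linarith
  set θ := θ₀ * ε ^ (3 * p) with hθ
  have hMθ : (((T : ℝ) + 1) * (m * R) + B + solMod p μ lg₁ (T * η)) * θ ≤ a * ε := by
    calc _ ≤ M₀ * ε ^ (-3 * p + 1) * θ := by gcongr
      _ = M₀ * θ₀ * (ε ^ (-3 * p + 1) * ε ^ (3 * p)) := by rw [hθ]; ring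
      _ = a * ε := by
          rw [← Real.rpow_add hε, show -3 * p + 1 + 3 * p = 1 by ring, Real.rpow_one, hθ₀,
            mul_div_cancel₀ _ hM₀0.ne']
  have hfail : ((T : ℝ) + 1) * m * Real.exp (-L) ≤ δ * θ := by
    have h1 : N * Real.exp (-L) ≤ δ * ε ^ (6 * p - 1) := by
      rw [hLdef, hLc, hℓdef]
      exact exp_neg_logFactor_le hε hε1 hδ hδ1 (by linarith) hN0.le
    calc ((T : ℝ) + 1) * m * Real.exp (-L)
        ≤ (T₀ + 1) * m₀ * ε ^ (-3 * p + 1) * Real.exp (-L) := by gcongr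
      _ = θ₀ * ε ^ (-3 * p + 1) * (N * Real.exp (-L)) := by rw [hN]; field_simp
      _ ≤ θ₀ * ε ^ (-3 * p + 1) * (δ * ε ^ (6 * p - 1)) :=
          mul_le_mul_of_nonneg_left h1 (by positivity)
      _ = δ * (θ₀ * (ε ^ (-3 * p + 1) * ε ^ (6 * p - 1))) := by ring
      _ = δ * θ := by rw [← Real.rpow_add hε, hθ]; congr 3; ring
  have hdrift : solMod p μ lg₁ (I * η) ≤ a * ε := hIη.trans (by gcongr)
  have hgη : gradMod p μ lg₁ lg₂ lf₀ lf₁ η ≤ c₁ / 32 * ε ^ 3 := by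
    rw [hη]
    exact (gradMod_mul_rpow_le hp hμ hlg₁ hlg₂ hlf₀ hlf₁ hc₂.le hε hε1).trans
      (mul_le_mul_of_nonneg_right hgc₂ (by positivity))
  have hmom : (G₀ / T + gradMod p μ lg₁ lg₂ lf₀ lf₁ η) / (c₁ * ε ^ 2) ≤ ε / 16 := by
    have h1 : G₀ / T ≤ c₁ / 32 * ε ^ 3 := by
      calc G₀ / T = G₀ * (1 / T) := by ring
        _ ≤ G₀ * (c₂ / (8 * Δ) * ε ^ 3) := by gcongr
        _ = G₀ * c₂ / (8 * Δ) * ε ^ 3 := by ring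
        _ ≤ Δ * c₁ / 4 / (8 * Δ) * ε ^ 3 := by gcongr
        _ = _ := by field_simp; ring
    rw [div_le_iff₀ (by positivity)]
    calc _ ≤ c₁ / 32 * ε ^ 3 + c₁ / 32 * ε ^ 3 := add_le_add h1 hgη
      _ = _ := by ring
  have haε : a * ε ≤ 1 / 32 := by
    calc a * ε ≤ 1 / 32 * 1 := by gcongr
      _ = _ := by norm_num
  refine ⟨{ α := fun _ => α, K₁ := fun _ => K₁, R := fun _ => R,
            K := fun _ => ∑ k ∈ Finset.range m, epochLen p K₁ k, C := Cb, Q := Q,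
            β := 1 - c₁ * ε ^ 2, η := η, I := I, T := T }, K₁, m, L, ε / 16, θ, rfl, hβ, rfl, ?_,
    hT, hQ1, ?_, ?_, fun _ => ?_,
    ⟨fun _ => rfl, fun _ => rfl, fun _ => rfl, fun _ => rfl, hK₁1⟩, hEpoch L hL1 K₁ hKL, hI1, hT1,
    by positivity, ?_, by positivity, hfail, ?_, ?_, ?_⟩
  · simp only [hβ]; exact hI
  · refine hQle.trans ?_
    have := log_inv_nonneg hε hε1
    gcongr
    linarith
  · rw [hℓ2]
    refine hK₁le.trans ?_
    exact mul_le_mul (by linarith) hℓℓ (by positivity) hA0.le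
  · rw [hℓ2]
    refine hKm.trans ?_
    gcongr
    linarith
  · simp only [hβ]
    calc c₁ * ε ^ 2 * S₀ ^ 2 = c₁ * S₀ ^ 2 * ε ^ 2 := by ring
      _ ≤ 1 / 256 * ε ^ 2 := by gcongr
      _ = (ε / 16) ^ 2 := by ring
  · simp only
    linarith
  · simp only [hβ]
    have h1 : H * (R / 2 ^ ((m : ℝ) / p) + solMod p μ lg₁ (I * η)
        + (((T : ℝ) + 1) * (m * R) + B + solMod p μ lg₁ (T * η)) * θ) ≤ 3 * ε / 32 := by
      calc _ ≤ H * (a * ε + a * ε + a * ε) := by gcongr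
        _ = H * a * (3 * ε) := by ring
        _ ≤ 1 / 32 * (3 * ε) := by gcongr
        _ = _ := by ring
    have h2 : c₁ / 32 * ε ^ 3 ≤ ε / 32 := by
      calc c₁ / 32 * ε ^ 3 ≤ 1 / 32 * ε := by gcongr
        _ = _ := by ring
    linarith
  · rw [hℓ2]
    refine (calls_bound hp hε hε1 hℓ hT₀0.le hTle hIinv hKm
      (hQle.trans (by gcongr))).trans ?_
    rw [← hk₃]
    gcongr
    linarith

end Tuning

end UniBiO

end

theorem theorem2
    -- the constants of the problem class
    (p μ L₀ L₁ lg₁ lg₂ C lf₀ lf₁ Δ σf σg₁ σg₂ B : ℝ)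
    (hp : 2 ≤ p) (hμ : 0 < μ) (hL₀ : 0 ≤ L₀) (hL₁ : 0 ≤ L₁) (hlg₁ : 0 ≤ lg₁) (hlg₂ : 0 ≤ lg₂)
    (hC : 0 < C) (hlf₀ : 0 ≤ lf₀) (hlf₁ : 0 ≤ lf₁) (hΔ : 0 < Δ)
    (hσf : 0 ≤ σf) (hσg₁ : 0 < σg₁) (hσg₂ : 0 ≤ σg₂) (hB : 0 ≤ B) :
    -- a valid bound for the generalized Hessian and constants, depending on these only
    ∃ Cb : ℝ, C ≤ Cb ∧
    ∃ c₁ c₂ C₁ A r : ℝ, 0 < c₁ ∧ c₁ ≤ 1 ∧ 0 < c₂ ∧ 0 < C₁ ∧ 0 < A ∧ 0 ≤ r ∧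
    ∀ ε δ : ℝ, 0 < ε → ε ≤ 1 → 0 < δ → δ < 1 →
    -- the choice of the parameters
    ∃ P : UniBiO.Params,
      P.C = Cb ∧
      1 - P.β = c₁ * ε ^ 2 ∧
      P.η = c₂ * ε ^ (3 * p - 3) ∧
      P.I = ⌈1 / (1 - P.β)⌉₊ ∧
      P.T = ⌈C₁ * Δ / (P.η * ε)⌉₊ ∧
      (1 ≤ P.Q ∧ (P.Q : ℝ) ≤ A * (1 + Real.log (1 / ε))) ∧
      (∀ t, 0 < P.α t ∧ P.α t ≤ A) ∧
      (∀ t, 0 < P.R t ∧ P.R t ≤ A) ∧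
      (∀ t, 1 ≤ P.K₁ t ∧ (P.K₁ t : ℝ) ≤ A * UniBiO.logFactor ε δ ^ r) ∧
      (∀ t, (P.K t : ℝ) ≤ A * ε ^ (-2 * p + 2) * UniBiO.logFactor ε δ ^ r) ∧
      -- works for all problems of the class
      ∀ (dx dy : ℕ) (Ξ : Type*) (Z : Type*) [MeasurableSpace Ξ] [MeasurableSpace Z]
        (Df : MeasureTheory.Measure Ξ) (Dg : MeasureTheory.Measure Z)
        [MeasureTheory.IsProbabilityMeasure Df] [MeasureTheory.IsProbabilityMeasure Dg]
        (f g : UniBiO.Vec dx → UniBiO.Vec dy → ℝ)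
        (F : Ξ → UniBiO.Vec dx → UniBiO.Vec dy → ℝ) (G : Z → UniBiO.Vec dx → UniBiO.Vec dy → ℝ)
        (x₀ : UniBiO.Vec dx) (y₀ : UniBiO.Vec dy),
        UniBiO.LowerLevel p μ L₀ L₁ lg₁ lg₂ C g →
        UniBiO.UpperLevel p lf₀ lf₁ Δ f g x₀ →
        UniBiO.Oracle p σf σg₁ σg₂ f g F G Df Dg →
        ‖y₀ - UniBiO.lowerSol g x₀‖ ≤ B →
        -- the hyperobjective is differentiable, and, outside an event of probability at most `δ`
        -- of the lower-level samples, the expected average hypergradient norm is at most `ε`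
        Differentiable ℝ (UniBiO.hyperObj f g) ∧
        UniBiO.lowerLaw Dg {sy | ¬
          ((∀ t ∈ Finset.range P.T, MeasureTheory.Integrable
              (fun sx => ‖gradient (UniBiO.hyperObj f g) (UniBiO.run p P F G x₀ y₀ sy sx t).x‖)
              (UniBiO.upperLaw Df Dg)) ∧
            (1 / (P.T : ℝ)) * ∑ t ∈ Finset.range P.T,
              ∫ sx, ‖gradient (UniBiO.hyperObj f g) (UniBiO.run p P F G x₀ y₀ sy sx t).x‖
                ∂(UniBiO.upperLaw Df Dg) ≤ ε)} ≤ ENNReal.ofReal δ ∧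
        -- the total number of oracle calls
        ∀ sy sx, ((UniBiO.run p P F G x₀ y₀ sy sx P.T).calls : ℝ)
          ≤ A * ε ^ (-5 * p + 6) * UniBiO.logFactor ε δ ^ r := by
  obtain ⟨Cb, hCb, c₁, c₂, A, α, v, hc₁, hc₁1, hc₂, hA, hαA, hRA, htune⟩ :=
    UniBiO.exists_tuning (C := C) hp hμ hlg₁ hlg₂ hC hlf₀ hlf₁ hΔ hσg₁ hB σf σg₂
      (gronwallBound 0 (L₁ * (2 * (B + 1))) (L₀ * (2 * (B + 1))) 1)
  refine ⟨Cb, hCb.ge_C, c₁, c₂, 8, A, 2, hc₁, hc₁1, hc₂, by norm_num, hA, by norm_num, ?_⟩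
  intro ε δ hε hε1 hδ hδ1
  obtain ⟨P, K₁, m, L, s, θ, hPC, hPβ, hPη, hPI, hPT, hQ1, hQ, hK₁, hK, hS, hE, hI1, hT1, hs, hs2,
    hθ, hfail, hR, herr, hcalls⟩ := htune ε δ hε hε1 hδ hδ1
  refine ⟨P, hPC, hPβ, hPη, hPI, hPT, ⟨hQ1, hQ⟩, fun t => ?_, fun t => ?_, fun t => ?_, hK, ?_⟩
  · rw [hS.α_eq]; exact ⟨hE.α_pos, hαA⟩
  · rw [hS.R_eq]; exact ⟨hE.R_pos, hRA⟩
  · rw [hS.K₁_eq]; exact ⟨hS.one_le, hK₁⟩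
  intro dx dy Ξ Z _ _ Df Dg _ _ f g F G x₀ y₀ hg hf hO h0
  have hβ : 0 < 1 - P.β := by rw [hPβ]; positivity
  have hβ1 : 1 - P.β ≤ 1 := by
    rw [hPβ]
    exact mul_le_one₀ hc₁1 (by positivity) (pow_le_one₀ hε.le hε1)
  refine ⟨fun x => (UniBiO.hasGradientAt_hyperObj hg hf hp hμ hlg₁ x).differentiableAt, ?_,
    fun sy sx => ?_⟩
  · exact hO.measure_gradient_gt_le hg hf hp hμ hlg₁ hlg₂ hlf₀ hlf₁ hΔ hσg₁ hE
      (fun x u hu => hg.norm_gradY_le hp hμ hL₀ hL₁ x hu) hS (hPC ▸ hCb) hI1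
      (by rw [hPη]; positivity) (by linarith) (by linarith) hB h0 (by linarith) hR hs hs2 hT1 hθ
      hfail herr
  · rw [hS.run_calls]
    exact hcalls
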